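/- Let $q\in\mathbb C$, $0<|q|<1$, fix a square root $q^{1/2}$ and put $q^{n/2}=(q^{1/2})^n$ for $n\in\mathbb Z$. Write $(a;q)_\infty=\prod_{j\ge0}(1-aq^j)$, $(a_1,\dots,a_r;q)_\infty=\prod_i(a_i;q)_\infty$, and $$[d_nz]=\frac{(1-q^nz^2)(1-q^nz^{-2})}{q^n}\,\frac{dz}{4\pi i z}.$$ For nonzero $t,x,z\in\mathbb C$, $N,m,n\in\mathbb Z$ and $c\ne0$ put $$K_{t,N,c}(x,m;z,n)=\frac{1}{z^{2n}x^{2m}c}\cdot\frac{\bigl(q^{1+\frac{m+N+n}{2}}\frac1{txz},\;q^{1+\frac{m+N-n}{2}}\frac{z}{tx},\;q^{1+\frac{-m+N+n}{2}}\frac{x}{tz},\;q^{1+\frac{-m+N-n}{2}}\frac{xz}{t};q\bigr)_\infty}{\bigl(q^{\frac{m+N+n}{2}}txz,\;q^{\frac{m+N-n}{2}}\frac{tx}{z},\;q^{\frac{-m+N+n}{2}}\frac{tz}{x},\;q^{\frac{-m+N-n}{2}}\frac{t}{xz};q\bigr)_\infty}.$$ For a family $\alpha=(\alpha_n(z))_{n\in\mathbb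 Z}$ of functions on the unit circle $\mathbb T$ define $$M(t,m_t)_{x,m;z,n}\alpha_n(z)=\frac{(q^{m_t}t^2;q)_\infty}{(q^{1+m_t}t^{-2};q)_\infty}\sum_{n\in\mathbb Z}\int_{\mathbb T}[d_nz]\,K_{t,m_t,\,t^{2m_t}}(x,m;z,n)\,\alpha_n(z),$$ $$M(st,n_s,n_t)_{x,m;z,n}\alpha_n(z)=\frac{(q^{n_s+n_t}(st)^2;q)_\infty}{(q^{1+n_s+n_t}(st)^{-2};q)_\infty}\sum_{n\in\mathbb Z}\int_{\mathbb T}[d_nz]\,K_{st,\,n_s+n_t,\,s^{2n_s}t^{2n_t}}(x,m;z,n)\,\alpha_n(z).$$ Such an expression is said to converge absolutely if for each $n$ the integrand is integrable on $\mathbb T$ and $\sum_{n}\int_{\mathbb T}|\text{integrand}|\,|dz|<\infty$. Further let $$D(t,N;w,n;z,m)=\frac{q^{N}}{z^{2m}w^{2n}t^{2N}}\cdot\frac{\bigl(q^{\frac{1+n-N+m}{2}}\frac{t}{zw},\;q^{\frac{1+n-N-m}{2}}\frac{tz}{w},\;q^{\frac{1-n-N+m}{2}}\frac{tw}{z},\;q^{\frac{1-n-N-m}{2}}twz;q\bigr)_\infty}{\bigl(q^{\frac{1+n-N+m}{2}}\frac{wz}{t},\;q^{\frac{1+n-N-m}{2}}\frac{w}{tz},\;q^{\frac{1-n-N+m}{2}}\frac{z}{tw},\;q^{\frac{1-n-N-m}{2}}\frac1{twz};q\bigr)_\infty},$$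 and $D(st,n_s,n_t;w,n;z,m)=D(st,n_s+n_t;w,n;z,m)$. Let $s,t,y\in\mathbb C\setminus\{0\}$ with $|t|<1$, $|q^{1/2}y|<|st|$ and $|q^{1/2}y^{-1}|<|st|$, and let $n_s,n_t,l\in\mathbb Z$ be arbitrary. **(a) Star-triangle relation.** Let $\alpha=(\alpha_j(x))_{j\in\mathbb Z}$ be such that $M(t,n_t)_{z,m;x,j}\alpha_j(x)$ converges absolutely for all $m\in\mathbb Z$, $z\in\mathbb T$. Let $k\in\mathbb Z$ and $\omega\in\mathbb C\setminus\{0\}$ with $|s\omega|<1$, $|s/\omega|<1$. Then $$M(s,n_s)_{\omega,k;z,m}\bigl[D(st,n_s,n_t;y,l;z,m)\,M(t,n_t)_{z,m;x,j}\alpha_j(x)\bigr]\quad\text{and}\quad M(st,n_s,n_t)_{\omega,k;x,j}\bigl[D(s,n_s;y,l;x,j)\alpha_j(x)\bigr]$$ converge absolutely, and if the denominator of $D(t,n_t;y,l;\omega,k)$ does not vanish, then $$M(s,n_s)_{\omega,k;z,m}D(st,n_s,n_t;y,l;z,m)M(t,n_t)_{z,m;x,j}\alpha_j(x)=D(t,n_t;y,l;\omega,k)\,M(st,n_s,n_t)_{\omega,k;x,j}D(s,n_s;y,l;x,j)\alpha_j(x).$$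 **(b) Bailey lemma.** Let $(\alpha,\beta)$ be a Bailey pair relative to $t$ on $\mathbb T$, i.e. for all $m\in\mathbb Z$, $z\in\mathbb T$ the expression $M(t,n_t)_{z,m;x,j}\alpha_j(x)$ converges absolutely and equals $\beta_m(z)$. Put $$\alpha'_k(x)=D(s,n_s;y,l;x,k)\,\alpha_k(x),\qquad \beta'_k(x)=D(t^{-1},-n_t;y,l;x,k)\,M(s,n_s)_{x,k;z,m}D(st,n_s,n_t;y,l;z,m)\beta_m(z).$$ Then $(\alpha',\beta')$ is a Bailey pair relative to $st$: for all $k\in\mathbb Z$ and $\omega\in\mathbb C\setminus\{0\}$ with $|s\omega|<1$, $|s/\omega|<1$ for which the denominator of $D(t^{-1},-n_t;y,l;\omega,k)$ does not vanish, $M(st,n_s,n_t)_{\omega,k;x,j}\alpha'_j(x)$ converges absolutely and equals $\beta'_k(\omega)$. No relation among the integers $n_s,n_t,k,l,j$ is imposed. The associated parameters $(a_1,\dots,a_6)=(s\omega,\,s\omega^{-1},\,q^{1/2}(st)^{-1}y,\,q^{1/2}(st)^{-1}y^{-1},\,tx,\,tx^{-1})$ and $(n_1,\dots,n_6)=(k+n_s,\,-k+n_s,\,l-n_s-n_t,\,-l-n_s-n_t,\,j+n_t,\,-j+n_t)$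 satisfy only $\prod_j a_j=q$ and $\sum_j n_j=0$, not the stronger condition $n_1+n_2=n_3+n_4=n_5+n_6=0$ (which means $n_s=n_t=0$). -/

import Mathlib

namespace QBailey

noncomputable section

open Complex

/-- The infinite `q`-Pochhammer symbol `(a;q)_∞ = ∏_{j ≥ 0} (1 - a q^j)`. -/
def qPoch (a q : ℂ) : ℂ := ∏' j : ℕ, (1 - a * q ^ j)

/-- The product `(a;q)_∞ (b;q)_∞ (c;q)_∞ (d;q)_∞`. -/
def qPoch4 (a b c d q : ℂ) : ℂ := qPoch a q * qPoch b q * qPoch c q * qPoch d q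

/-! Throughout, `r` is a fixed square root of `q`: `q = r ^ 2`, and `q^{n/2}` is `r ^ n` for an
integer `n`. -/

/-- The density `(1 - q^n z^2)(1 - q^n z^{-2}) / q^n` of the measure `[d_n z]` with respect to
`dz / (4 π i z)`. -/
def density (r : ℂ) (n : ℤ) (z : ℂ) : ℂ :=
  (1 - (r ^ 2) ^ n * z ^ 2) * (1 - (r ^ 2) ^ n / z ^ 2) / (r ^ 2) ^ n

/-- The operation `f ↦ ∑_{n ∈ ℤ} ∫_𝕋 [d_n z] f_n(z)`, with
`[d_n z] = density r n z * dz / (4 π i z)`. -/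
def sumInt (r : ℂ) (f : ℤ → ℂ → ℂ) : ℂ :=
  ∑' n : ℤ, ∮ z in C(0, 1), density r n z * f n z / (4 * (Real.pi : ℂ) * I * z)

/-- Absolute convergence of `∑_{n ∈ ℤ} ∫_𝕋 [d_n z] f_n(z)`. -/
def AbsConv (r : ℂ) (f : ℤ → ℂ → ℂ) : Prop :=
  (∀ n : ℤ, CircleIntegrable (fun z => density r n z * f n z) 0 1) ∧
    Summable fun n : ℤ => ∫ θ in (0 : ℝ)..(2 * Real.pi),
      ‖density r n (circleMap 0 1 θ) * f n (circleMap 0 1 θ)‖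

/-- The kernel of the sum-integral operator (without the factor that is independent of `z`, `n`,
`x`, `m`), where `c` is the normalization that stands for `t^{2 m_t}`. -/
def kernel (r t : ℂ) (mt : ℤ) (c x : ℂ) (m : ℤ) (z : ℂ) (n : ℤ) : ℂ :=
  1 / (z ^ (2 * n) * x ^ (2 * m) * c) *
    (qPoch4
        (r ^ (2 + (m + mt + n)) * (1 / (t * x * z)))
        (r ^ (2 + (m + mt - n)) * (z / (t * x)))
        (r ^ (2 + (-m + mt + n)) * (x / (t * z)))
        (r ^ (2 + (-m + mt - n)) * (x * z / t)) (r ^ 2) /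
      qPoch4
        (r ^ (m + mt + n) * (t * x * z))
        (r ^ (m + mt - n) * (t * x / z))
        (r ^ (-m + mt + n) * (t * z / x))
        (r ^ (-m + mt - n) * (t / (x * z))) (r ^ 2))

/-- The factor `(q^{m_t} t^2; q)_∞ / (q^{1 + m_t} t^{-2}; q)_∞`. -/
def prefactor (r t : ℂ) (mt : ℤ) : ℂ :=
  qPoch ((r ^ 2) ^ mt * t ^ 2) (r ^ 2) / qPoch ((r ^ 2) ^ (1 + mt) * (1 / t ^ 2)) (r ^ 2)

/-- The integrand of `M(t, m_t)_{x,m;z,n} α_n(z)` as a function of `n` and `z`. -/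
def integrandM (r t : ℂ) (mt : ℤ) (α : ℤ → ℂ → ℂ) (m : ℤ) (x : ℂ) : ℤ → ℂ → ℂ :=
  fun n z => kernel r t mt (t ^ (2 * mt)) x m z n * α n z

/-- The function `M(t, m_t)_{x,m;z,n} α_n(z)` of `m` and `x`. -/
def opM (r t : ℂ) (mt : ℤ) (α : ℤ → ℂ → ℂ) (m : ℤ) (x : ℂ) : ℂ :=
  prefactor r t mt * sumInt r (integrandM r t mt α m x)

/-- The integrand of the operator `M(st, n_s, n_t)` of the composite parameter: that of
`M(t, m_t)` with `t` replaced by `st` and `m_t` by `n_s + n_t`, except that `t^{2 m_t}` is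
replaced by `s^{2 n_s} t^{2 n_t}`. -/
def integrandMM (r s t : ℂ) (ns nt : ℤ) (α : ℤ → ℂ → ℂ) (m : ℤ) (x : ℂ) : ℤ → ℂ → ℂ :=
  fun n z => kernel r (s * t) (ns + nt) (s ^ (2 * ns) * t ^ (2 * nt)) x m z n * α n z

/-- The function `M(st, n_s, n_t)_{x,m;z,n} α_n(z)` of `m` and `x`. -/
def opMM (r s t : ℂ) (ns nt : ℤ) (α : ℤ → ℂ → ℂ) (m : ℤ) (x : ℂ) : ℂ :=
  prefactor r (s * t) (ns + nt) * sumInt r (integrandMM r s t ns nt α m x)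

/-- The denominator of `D(t, n_t; w, n; z, m)`. -/
def denomD (r t : ℂ) (nt : ℤ) (w : ℂ) (n : ℤ) (z : ℂ) (m : ℤ) : ℂ :=
  qPoch4
    (r ^ (n - nt + m) * r * (w * z / t))
    (r ^ (n - nt - m) * r * (w / (t * z)))
    (r ^ (-n - nt + m) * r * (z / (t * w)))
    (r ^ (-n - nt - m) * r * (1 / (t * w * z))) (r ^ 2)

/-- The function `D(t, n_t; w, n; z, m)`; `D(st, n_s, n_t; ...)` is its value at `s * t` and
`n_s + n_t`. -/
def funD (r t : ℂ) (nt : ℤ) (w : ℂ) (n : ℤ) (z : ℂ) (m : ℤ) : ℂ :=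
  (r ^ 2) ^ nt / (z ^ (2 * m) * w ^ (2 * n) * t ^ (2 * nt)) *
    (qPoch4
        (r ^ (2 + (n - nt + m)) * r⁻¹ * (t / (z * w)))
        (r ^ (2 + (n - nt - m)) * r⁻¹ * (t * z / w))
        (r ^ (2 + (-n - nt + m)) * r⁻¹ * (t * w / z))
        (r ^ (2 + (-n - nt - m)) * r⁻¹ * (t * w * z)) (r ^ 2) /
      denomD r t nt w n z m)

/-- `(α, β)` is a Bailey pair relative to `t` (with discrete parameter `m_t`) at the points
`(m, x)` of `S`: the sum-integral `M(t, m_t)_{x,m;z,n} α_n(z)` converges absolutely and equals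
`β_m(x)`. -/
def IsBaileyPair (r t : ℂ) (mt : ℤ) (S : Set (ℤ × ℂ)) (α β : ℤ → ℂ → ℂ) : Prop :=
  ∀ p ∈ S, AbsConv r (integrandM r t mt α p.1 p.2) ∧ β p.1 p.2 = opM r t mt α p.1 p.2

/-- `(α, β)` is a Bailey pair relative to the composite parameter `st` (with discrete parameters
`n_s`, `n_t`) at the points of `S`. -/
def IsBaileyPair₂ (r s t : ℂ) (ns nt : ℤ) (S : Set (ℤ × ℂ)) (α β : ℤ → ℂ → ℂ) : Prop :=
  ∀ p ∈ S, AbsConv r (integrandMM r s t ns nt α p.1 p.2) ∧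
    β p.1 p.2 = opMM r s t ns nt α p.1 p.2

/-- `α'_k(x) = D(s, n_s; y, l; x, k) α_k(x)`. -/
def newα (r s y : ℂ) (ns l : ℤ) (α : ℤ → ℂ → ℂ) : ℤ → ℂ → ℂ :=
  fun k x => funD r s ns y l x k * α k x

/-- The function `D(st, n_s, n_t; y, l; z, m) β_m(z)` of `m` and `z`. -/
def midβ (r s t y : ℂ) (ns nt l : ℤ) (β : ℤ → ℂ → ℂ) : ℤ → ℂ → ℂ :=
  fun m z => funD r (s * t) (ns + nt) y l z m * β m z

/-- `β'_k(x) = D(t⁻¹, -n_t; y, l; x, k) M(s, n_s)_{x,k;z,m} D(st, n_s, n_t; y, l; z, m) β_m(z)`. -/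
def newβ (r s t y : ℂ) (ns nt l : ℤ) (β : ℤ → ℂ → ℂ) : ℤ → ℂ → ℂ :=
  fun k x => funD r t⁻¹ (-nt) y l x k * opM r s ns (midβ r s t y ns nt l β) k x

end

end QBailey

namespace QBailey
open Complex MeasureTheory Filter Topology

/-! Everything rests on a sum-integral beta evaluation, `betaInt_eq`: for six parameters of modulus
below `1` with `∏ a_j = q = r²` and integers with `∑ n_j = 0`, the sum over `m` of the integrals
over the circle of a density times twelve quotients of `q`-Pochhammer symbols equals `4π` times a
product over the fifteen pairs `i < j`. Given this, the star-triangle relation is an exchange of the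
two sum-integrals. The three kernels that contain `z` combine to the beta integrand
(`star_integrand`), and the closed form factors into the kernels of the other side
(`star_betaProd`). The Bailey lemma follows since `D(t⁻¹, -n_t)` is the reciprocal of `D(t, n_t)`
(`funD_inv_mul_regD`).

The beta evaluation is proved by showing that the ratio of integral to closed form is constant. In
the variable `w = r^m z` a rational identity (`shift_rational`) writes a combination of the
integrands at parameters `(a, n)` and at the shifted ones, `(r a_0, n_0 + 1)` and `(a_5 / r, n_5 -
1)`, as a difference under `(m, z) ↦ (m - 1, z / r)`. After a contour shift from `|z| = 1/|r|` to
`|z| = 1` the difference sums to zero, so the ratio is invariant under the shift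
(`betaRatio_shift`). The symmetry `n ↦ -n` (`betaRatio_reflect`) supplies the companion shift with
`n_0 - 1`. Two holomorphic functions on an annulus that are interchanged by `b ↦ r b` are equal
constants, by the maximum principle applied to their sum and difference (`eq_of_eq_mul_eq_mul`).
Hence the ratio depends neither on `a_0` nor on `n_0` as long as `a_0 a_5` and `n_0 + n_5` are kept
(`betaRatio_moveA`); by symmetry the same holds for each of the first five slots.

The constant is found by pinching. For `a_0 = iτ`, `a_1 = -iτ`, `n = 0` and `τ → 1`, both sides blow
up like `1/(1 - τ²)`. On the integral side only `m = 0` contributes, and a Poisson kernel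
concentrates the integral at `z = ±i` (`tendsto_betaRatio_pinchA`). The annulus argument needs five
parameters close to the unit circle; the identity theorem along a complex line in logarithmic
coordinates (`betaInt_eq_of_eventually`) removes this restriction.

For negative index the quotients have zeros of the denominator cancelled by zeros of the numerator.
All the analysis is therefore done with the regularization `gQuot`, which is holomorphic and whose
size is explicit uniformly in the index. The functions of the theorem agree with the regularized
ones outside countably many angles, hence almost everywhere.

For the exchange, the inner kernels at different `(m, z)` on the circle are bounded by a multiple of
the one at `(0, 1)` (`exists_norm_regK_le_regK`). The double integrand is thus dominated by a
product of two integrable functions, which gives Fubini and both absolute convergence claims. -/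

/-! ### Infinite `q`-Pochhammer symbols -/

lemma summable_norm_mul_pow {q : ℂ} (hq : ‖q‖ < 1) (a : ℂ) :
    Summable fun j : ℕ => ‖-(a * q ^ j)‖ := by
  simp only [norm_neg, norm_mul, norm_pow]
  exact (summable_geometric_of_lt_one (norm_nonneg _) hq).mul_left _

lemma multipliable_qPoch {q : ℂ} (hq : ‖q‖ < 1) (a : ℂ) :
    Multipliable fun j : ℕ => 1 - a * q ^ j := by
  simpa [sub_eq_add_neg] using multipliable_one_add_of_summable (summable_norm_mul_pow hq a)

lemma qPoch_ne_zero {q : ℂ} (hq : ‖q‖ < 1) {a : ℂ} (ha : ∀ j : ℕ, 1 - a * q ^ j ≠ 0) :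
    qPoch a q ≠ 0 := by
  have := tprod_one_add_ne_zero_of_summable (f := fun j : ℕ => -(a * q ^ j))
    (by simpa [sub_eq_add_neg] using ha) (summable_norm_mul_pow hq a)
  simpa [qPoch, sub_eq_add_neg] using this

lemma qPoch_ne_zero_of_norm_lt {q : ℂ} (hq : ‖q‖ < 1) {a : ℂ} (ha : ‖a‖ < 1) :
    qPoch a q ≠ 0 := by
  refine qPoch_ne_zero hq fun j h => ?_
  have h1 : ‖a * q ^ j‖ = 1 := by rw [← sub_eq_zero.mp h, norm_one]
  rw [norm_mul, norm_pow] at h1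
  have h2 : ‖a‖ * ‖q‖ ^ j ≤ ‖a‖ * 1 :=
    mul_le_mul_of_nonneg_left (pow_le_one₀ (norm_nonneg _) hq.le) (norm_nonneg _)
  linarith

lemma qPoch_eq_mul {q : ℂ} (hq : ‖q‖ < 1) (a : ℂ) :
    qPoch a q = (1 - a) * qPoch (a * q) q := by
  have h : Multipliable fun j : ℕ => 1 - a * q ^ (j + 1) := by
    simpa [pow_succ', mul_assoc] using multipliable_qPoch hq (a * q)
  have e := tprod_eq_zero_mul' (f := fun j : ℕ => 1 - a * q ^ j) h
  have e2 : qPoch (a * q) q = ∏' j : ℕ, (1 - a * q ^ (j + 1)) :=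
    tprod_congr fun j => by rw [pow_succ', mul_assoc]
  rw [e2]
  simp only [pow_zero, mul_one] at e
  exact e

lemma qPoch_eq_prod_mul {q : ℂ} (hq : ‖q‖ < 1) (a : ℂ) (N : ℕ) :
    qPoch a q = (∏ i ∈ Finset.range N, (1 - a * q ^ i)) * qPoch (a * q ^ N) q := by
  induction N with
  | zero => simp
  | succ N ih =>
    rw [ih, Finset.prod_range_succ, qPoch_eq_mul hq (a * q ^ N), pow_succ]
    ring_nf

/-- On the ball of radius `‖a‖ + 1` the factors deviate from `1` by a geometric series, so the
product converges locally uniformly there. -/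
lemma differentiable_qPoch {q : ℂ} (hq : ‖q‖ < 1) : Differentiable ℂ fun a => qPoch a q := by
  intro a
  have hs : Summable fun j : ℕ => (‖a‖ + 1) * ‖q‖ ^ j :=
    (summable_geometric_of_lt_one (norm_nonneg _) hq).mul_left _
  have h := Summable.hasProdLocallyUniformlyOn_nat_one_add (f := fun (j : ℕ) (x : ℂ) => -(x * q ^ j))
    (K := Metric.ball (0 : ℂ) (‖a‖ + 1)) Metric.isOpen_ball hs
    (.of_forall fun j x hx => by
      rw [norm_neg, norm_mul, norm_pow]
      exact mul_le_mul_of_nonneg_right (by simpa using (Metric.mem_ball.mp hx).le) (by positivity))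
    (fun j => by fun_prop)
  have hd := h.differentiableOn
    (.of_forall fun _ ↦ by simpa [Finset.prod_fn] using
      DifferentiableOn.finsetProd (fun _ _ ↦ by fun_prop)) Metric.isOpen_ball
  have : DifferentiableAt ℂ (fun x => ∏' j : ℕ, (1 + -(x * q ^ j))) a :=
    hd.differentiableAt (Metric.isOpen_ball.mem_nhds (by simp))
  simpa [qPoch, sub_eq_add_neg] using this

lemma continuous_qPoch {q : ℂ} (hq : ‖q‖ < 1) : Continuous fun a => qPoch a q :=
  (differentiable_qPoch hq).continuous

lemma exists_norm_qPoch_le {q : ℂ} (hq : ‖q‖ < 1) (ρ : ℝ) :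
    ∃ C : ℝ, 0 < C ∧ ∀ a : ℂ, ‖a‖ ≤ ρ → ‖qPoch a q‖ ≤ C := by
  obtain ⟨C, hC⟩ := (isCompact_closedBall (0 : ℂ) ρ).exists_bound_of_continuousOn
    (continuous_qPoch hq).continuousOn
  exact ⟨max C 1, by positivity, fun a ha => (hC a (by simpa using ha)).trans (le_max_left _ _)⟩

lemma exists_le_norm_qPoch {q : ℂ} (hq : ‖q‖ < 1) {ρ : ℝ} (hρ : ρ < 1) :
    ∃ c : ℝ, 0 < c ∧ ∀ a : ℂ, ‖a‖ ≤ ρ → c ≤ ‖qPoch a q‖ := by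
  rcases lt_or_ge ρ 0 with h | h
  · exact ⟨1, one_pos, fun a ha => absurd (ha.trans_lt h) (by simp)⟩
  obtain ⟨x, hx, hm⟩ := (isCompact_closedBall (0 : ℂ) ρ).exists_isMinOn ⟨0, by simpa using h⟩
    (continuous_qPoch hq).norm.continuousOn
  refine ⟨‖qPoch x q‖, ?_, fun a ha => hm (by simpa using ha)⟩
  exact norm_pos_iff.mpr (qPoch_ne_zero_of_norm_lt hq
    ((by simpa using hx : ‖x‖ ≤ ρ).trans_lt hρ))

/-! ### The regularized quotient: functional equations and uniform bounds -/

/-- The monomial relating the quotients `(r^{2+k}/a; r²)_∞ / (r^k a; r²)_∞` at `k` and `|k|`. -/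
noncomputable def gMon (r : ℂ) (k : ℤ) (a : ℂ) : ℂ := if 0 ≤ k then 1 else (-a / r) ^ k

/-- The quotient `(r^{2+k}/a; r²)_∞ / (r^k a; r²)_∞` with its removable singularities removed. -/
noncomputable def gQuot (r : ℂ) (k : ℤ) (a : ℂ) : ℂ :=
  gMon r k a * (qPoch (r ^ (2 + |k|) / a) (r ^ 2) / qPoch (r ^ |k| * a) (r ^ 2))

lemma norm_sq_lt_one {r : ℂ} (hr1 : ‖r‖ < 1) : ‖r ^ 2‖ < 1 := by
  rw [norm_pow]; exact pow_lt_one₀ (norm_nonneg _) hr1 two_ne_zero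

lemma norm_zpow_abs_le_one {r : ℂ} (hr1 : ‖r‖ < 1) (k : ℤ) : ‖r ^ |k|‖ ≤ 1 := by
  obtain ⟨n, hn⟩ := Int.eq_ofNat_of_zero_le (abs_nonneg k)
  rw [hn]
  simpa using pow_le_one₀ (norm_nonneg r) hr1.le

lemma norm_zpow_abs_mul_lt {r : ℂ} (hr1 : ‖r‖ < 1) (k : ℤ) {a : ℂ} {ρ : ℝ} (ha : ‖a‖ < ρ) :
    ‖r ^ |k| * a‖ < ρ := by
  rw [norm_mul]
  exact (mul_le_of_le_one_left (norm_nonneg _) (norm_zpow_abs_le_one hr1 k)).trans_lt ha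

/-- Split `K` factors off each symbol with index `-K`: the tails are the symbols with index `K`, and
the split factors agree in reversed order up to monomials, by `1 - 1/x = -(1/x)(1 - x)`. Stated
without division so that it survives zeros of the symbols. -/
lemma qPoch_mul_qPoch_neg {r : ℂ} (hr : r ≠ 0) (hr1 : ‖r‖ < 1) {a : ℂ} (ha : a ≠ 0) (K : ℕ) :
    qPoch (r ^ (2 - (K : ℤ)) / a) (r ^ 2) * qPoch (r ^ (K : ℤ) * a) (r ^ 2) =
      (-a / r) ^ (-(K : ℤ)) * qPoch (r ^ (2 + (K : ℤ)) / a) (r ^ 2) *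
        qPoch (r ^ (-(K : ℤ)) * a) (r ^ 2) := by
  have hq := norm_sq_lt_one hr1
  rw [qPoch_eq_prod_mul hq (r ^ (2 - (K : ℤ)) / a) K, qPoch_eq_prod_mul hq (r ^ (-(K : ℤ)) * a) K]
  have e1 : r ^ (2 - (K : ℤ)) / a * (r ^ 2) ^ K = r ^ (2 + (K : ℤ)) / a := by
    rw [← pow_mul, ← zpow_natCast r (2 * K), div_mul_eq_mul_div, ← zpow_add₀ hr]
    congr 2; push_cast; ring
  have e2 : r ^ (-(K : ℤ)) * a * (r ^ 2) ^ K = r ^ (K : ℤ) * a := by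
    rw [← pow_mul, ← zpow_natCast r (2 * K), mul_right_comm, ← zpow_add₀ hr]
    congr 2; push_cast; ring
  have e3 : ∏ i ∈ Finset.range K, (1 - r ^ (2 - (K : ℤ)) / a * (r ^ 2) ^ i) =
      (-a / r) ^ (-(K : ℤ)) * ∏ i ∈ Finset.range K, (1 - r ^ (-(K : ℤ)) * a * (r ^ 2) ^ i) := by
    have h1 : ∀ i ∈ Finset.range K, (1 - r ^ (2 - (K : ℤ)) / a * (r ^ 2) ^ (K - 1 - i)) =
        (-(r ^ ((K : ℤ) - 2 * i) / a)) * (1 - r ^ (-(K : ℤ)) * a * (r ^ 2) ^ i) := by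
      intro i hi
      have hi := Finset.mem_range.mp hi
      have h2 : ((r ^ 2) ^ (K - 1 - i) : ℂ) = r ^ (2 * ((K : ℤ) - 1 - i)) := by
        rw [← pow_mul, ← zpow_natCast]; congr 1; omega
      have h3 : ((r ^ 2) ^ i : ℂ) = r ^ (2 * (i : ℤ)) := by
        rw [← pow_mul, ← zpow_natCast]; congr 1
      have h4 : r ^ (2 - (K : ℤ)) * r ^ (2 * ((K : ℤ) - 1 - i)) = r ^ ((K : ℤ) - 2 * i) := by
        rw [← zpow_add₀ hr]; congr 1; ring
      have h5 : r ^ ((K : ℤ) - 2 * i) * (r ^ (-(K : ℤ)) * r ^ (2 * (i : ℤ))) = 1 := by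
        rw [← zpow_add₀ hr, ← zpow_add₀ hr, ← zpow_zero r]; congr 1; ring
      rw [h2, h3, div_mul_eq_mul_div, h4]
      field_simp
      linear_combination (-a) * h5
    rw [← Finset.prod_range_reflect, Finset.prod_congr rfl h1, Finset.prod_mul_distrib]
    congr 1
    -- The induction needs a free upper limit `N`; the correction `r ^ (N * (K - N))` disappears at
    -- `N = K`.
    have h6 : ∀ N : ℕ, ∏ i ∈ Finset.range N, (-(r ^ ((K : ℤ) - 2 * i) / a)) =
        (-a / r) ^ (-(N : ℤ)) * r ^ ((N : ℤ) * (K - N)) := by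
      intro N
      induction N with
      | zero => simp
      | succ N ih =>
        rw [Finset.prod_range_succ, ih]
        have h7 : -a / r ≠ 0 := div_ne_zero (neg_ne_zero.mpr ha) hr
        have : (-((N + 1 : ℕ) : ℤ)) = -(N : ℤ) - 1 := by push_cast; ring
        rw [this, zpow_sub_one₀ h7]
        have : r ^ (((N + 1 : ℕ) : ℤ) * (K - ((N + 1 : ℕ) : ℤ))) =
            r ^ ((N : ℤ) * (K - N)) * r ^ ((K : ℤ) - 2 * N) * r⁻¹ := by
          rw [← zpow_add₀ hr, ← zpow_sub_one₀ hr]; congr 1; push_cast; ring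
        rw [this]
        field_simp
    rw [h6 K]; simp
  rw [e1, e2, e3]; ring

lemma gQuot_eq {r : ℂ} (hr : r ≠ 0) (hr1 : ‖r‖ < 1) {k : ℤ} {a : ℂ} (ha : a ≠ 0) (ha1 : ‖a‖ < 1)
    (h : qPoch (r ^ k * a) (r ^ 2) ≠ 0) :
    gQuot r k a = qPoch (r ^ (2 + k) / a) (r ^ 2) / qPoch (r ^ k * a) (r ^ 2) := by
  have hq := norm_sq_lt_one hr1
  unfold gQuot gMon
  rcases le_or_gt 0 k with hk | hk
  · rw [if_pos hk, abs_of_nonneg hk, one_mul]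
  · have h0 : qPoch (r ^ |k| * a) (r ^ 2) ≠ 0 :=
      qPoch_ne_zero_of_norm_lt hq (norm_zpow_abs_mul_lt hr1 k ha1)
    rw [if_neg (not_le.mpr hk)]
    obtain ⟨K, hK⟩ := Int.eq_ofNat_of_zero_le (abs_nonneg k)
    have hk' : k = -(K : ℤ) := by rw [abs_of_neg hk] at hK; omega
    have := qPoch_mul_qPoch_neg hr hr1 ha K
    rw [hK] at h0 ⊢
    subst hk'
    rw [← mul_div_assoc, div_eq_div_iff h0 h, ← this]
    rfl

/-- The Pochhammer part depends on `|k|` only, so just the monomials are compared. This is the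
source of the symmetry `n ↦ -n`. -/
lemma gQuot_neg {r : ℂ} (hr : r ≠ 0) (k : ℤ) {a : ℂ} (ha : a ≠ 0) :
    gQuot r (-k) a = (-a / r) ^ (-k) * gQuot r k a := by
  have h7 : -a / r ≠ 0 := div_ne_zero (neg_ne_zero.mpr ha) hr
  unfold gQuot gMon
  rw [abs_neg, ← mul_assoc]
  congr 1
  rcases lt_trichotomy k 0 with hk | hk | hk
  · rw [if_pos (by omega), if_neg (by omega), ← zpow_add₀ h7]; simp
  · subst hk; simp
  · rw [if_neg (by omega), if_pos hk.le, mul_one]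

/-- The step keeps `r^{2+k}/a` and multiplies `r^k a` by `q`, so one factor of the denominator is
lost. For `k < 0` the index `|k|` drops instead, and the factor comes from the numerator and the
monomial. All contiguous relations below reduce to this. -/
lemma gQuot_succ {r : ℂ} (hr : r ≠ 0) (hr1 : ‖r‖ < 1) (k : ℤ) {a : ℂ} (ha : a ≠ 0)
    (ha1 : ‖a‖ < 1) : gQuot r (k + 1) (r * a) = (1 - r ^ k * a) * gQuot r k a := by
  have hq := norm_sq_lt_one hr1
  have h7 : -a / r ≠ 0 := div_ne_zero (neg_ne_zero.mpr ha) hr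
  unfold gQuot gMon
  rcases le_or_gt 0 k with hk | hk
  · rw [if_pos (by omega), if_pos hk, abs_of_nonneg hk, abs_of_nonneg (by omega : 0 ≤ k + 1)]
    have h0 : qPoch (r ^ k * a) (r ^ 2) ≠ 0 := by
      have := qPoch_ne_zero_of_norm_lt hq (norm_zpow_abs_mul_lt hr1 k ha1)
      rwa [abs_of_nonneg hk] at this
    have e := qPoch_eq_mul hq (r ^ k * a)
    have e1 : r ^ (2 + (k + 1)) / (r * a) = r ^ (2 + k) / a := by
      rw [← add_assoc, zpow_add_one₀ hr]; field_simp
    have e2 : r ^ (k + 1) * (r * a) = r ^ k * a * r ^ 2 := by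
      rw [zpow_add_one₀ hr]; ring
    rw [e1, e2]
    rw [e] at h0 ⊢
    rw [one_mul, one_mul, mul_div_assoc', mul_div_mul_left _ _ (left_ne_zero_of_mul h0)]
  · obtain ⟨K, rfl⟩ : ∃ K : ℕ, k = -(K : ℤ) - 1 := ⟨(-k - 1).toNat, by omega⟩
    have a1 : |(-(K : ℤ) - 1 + 1)| = K := by rw [sub_add_cancel, abs_neg, Nat.abs_cast]
    have a2 : |(-(K : ℤ) - 1)| = K + 1 := by rw [abs_of_neg hk]; ring
    have m1 : (if (0 : ℤ) ≤ (-(K : ℤ) - 1 + 1) then (1 : ℂ)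
        else (-(r * a) / r) ^ (-(K : ℤ) - 1 + 1)) = (-a) ^ (-(K : ℤ)) := by
      have : -(r * a) / r = -a := by field_simp
      split_ifs with h
      · have : (K : ℤ) = 0 := by omega
        rw [this]; simp
      · rw [this]; congr 1; ring
    rw [a1, a2, m1, if_neg (by omega)]
    have e1 : r ^ (2 + (K : ℤ)) / (r * a) = r ^ ((K : ℤ) + 1) / a := by
      rw [show (2 + (K : ℤ)) = K + 1 + 1 by ring, zpow_add_one₀ hr (K + 1)]; field_simp
    have e2 : r ^ (K : ℤ) * (r * a) = r ^ ((K : ℤ) + 1) * a := by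
      rw [zpow_add_one₀ hr]; ring
    have e3 : r ^ ((K : ℤ) + 1) / a * r ^ 2 = r ^ (2 + ((K : ℤ) + 1)) / a := by
      rw [zpow_add₀ hr 2]; ring_nf; norm_cast
    rw [e1, e2, qPoch_eq_mul hq (r ^ ((K : ℤ) + 1) / a), e3]
    have e4 : (-a) ^ (-(K : ℤ)) * (1 - r ^ ((K : ℤ) + 1) / a) =
        (1 - r ^ (-(K : ℤ) - 1) * a) * (-a / r) ^ (-(K : ℤ) - 1) := by
      have hK : r ^ (-(K : ℤ) - 1) = (r ^ ((K : ℤ) + 1))⁻¹ := by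
        rw [← zpow_neg]; congr 1; ring
      have hK' : (-a / r) ^ (-(K : ℤ) - 1) = (-a) ^ (-(K : ℤ)) * (-a)⁻¹ * r ^ ((K : ℤ) + 1) := by
        rw [div_zpow, zpow_sub_one₀ (neg_ne_zero.mpr ha), hK]; simp
      have := zpow_ne_zero ((K : ℤ) + 1) hr
      rw [hK, hK']; field_simp; ring
    rw [mul_comm (1 - r ^ ((K : ℤ) + 1) / a), mul_div_right_comm, mul_comm _ (1 - r ^ _ / a),
      ← mul_assoc, e4, mul_assoc]

lemma gMon_ne_zero {r : ℂ} (hr : r ≠ 0) (k : ℤ) {a : ℂ} (ha : a ≠ 0) : gMon r k a ≠ 0 := by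
  unfold gMon
  split_ifs
  · exact one_ne_zero
  · exact zpow_ne_zero _ (div_ne_zero (neg_ne_zero.mpr ha) hr)

lemma zpow_two_add_abs_div {r : ℂ} (hr : r ≠ 0) (k : ℤ) (a : ℂ) :
    r ^ (2 + |k|) / a = r ^ |k| * (r ^ 2 / a) := by
  rw [zpow_add₀ hr]; norm_cast; ring

lemma gQuot_ne_zero {r : ℂ} (hr : r ≠ 0) (hr1 : ‖r‖ < 1) (k : ℤ) {a : ℂ} (ha : ‖r ^ 2‖ < ‖a‖)
    (ha1 : ‖a‖ < 1) : gQuot r k a ≠ 0 := by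
  have hq := norm_sq_lt_one hr1
  have ha0 : 0 < ‖a‖ := (norm_nonneg _).trans_lt ha
  refine mul_ne_zero (gMon_ne_zero hr k (norm_pos_iff.mp ha0)) (div_ne_zero ?_ ?_)
  · rw [zpow_two_add_abs_div hr]
    refine qPoch_ne_zero_of_norm_lt hq (norm_zpow_abs_mul_lt hr1 k ?_)
    rw [norm_div]; exact (div_lt_one ha0).mpr ha
  · exact qPoch_ne_zero_of_norm_lt hq (norm_zpow_abs_mul_lt hr1 k ha1)

/-- The inversion `a ↦ q/a` exchanges numerator and denominator, so only the monomials remain. -/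
lemma gQuot_mul_gQuot_div {r : ℂ} (hr : r ≠ 0) (hr1 : ‖r‖ < 1) (k : ℤ) {a : ℂ}
    (ha : ‖r ^ 2‖ < ‖a‖) (ha1 : ‖a‖ < 1) :
    gQuot r k a * gQuot r (-k) (r ^ 2 / a) = (-a / r) ^ k := by
  have hq := norm_sq_lt_one hr1
  have ha0 : 0 < ‖a‖ := (norm_nonneg _).trans_lt ha
  have ha00 := norm_pos_iff.mp ha0
  have h1 : qPoch (r ^ |k| * (r ^ 2 / a)) (r ^ 2) ≠ 0 := by
    refine qPoch_ne_zero_of_norm_lt hq (norm_zpow_abs_mul_lt hr1 k ?_)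
    rw [norm_div]; exact (div_lt_one ha0).mpr ha
  have h2 : qPoch (r ^ |k| * a) (r ^ 2) ≠ 0 :=
    qPoch_ne_zero_of_norm_lt hq (norm_zpow_abs_mul_lt hr1 k ha1)
  have h3 : gMon r k a * gMon r (-k) (r ^ 2 / a) = (-a / r) ^ k := by
    have e : -(r ^ 2 / a) / r = (-a / r)⁻¹ := by
      rw [inv_div]; field_simp
    unfold gMon
    rw [e, zpow_neg, inv_zpow, inv_inv]
    rcases lt_trichotomy k 0 with hk | hk | hk
    · rw [if_neg (by omega), if_pos (by omega), mul_one]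
    · subst hk; simp
    · rw [if_pos hk.le, if_neg (by omega), one_mul]
  unfold gQuot
  rw [abs_neg, zpow_two_add_abs_div hr, zpow_two_add_abs_div hr k (r ^ 2 / a)]
  have e : r ^ 2 / (r ^ 2 / a) = a := by field_simp
  rw [e, ← h3]
  generalize qPoch (r ^ |k| * (r ^ 2 / a)) (r ^ 2) = A at *
  generalize qPoch (r ^ |k| * a) (r ^ 2) = B at *
  field_simp

lemma differentiableAt_gQuot {r : ℂ} (hr : r ≠ 0) (hr1 : ‖r‖ < 1) (k : ℤ) {a : ℂ} (ha : a ≠ 0)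
    (ha1 : ‖r ^ |k| * a‖ < 1) : DifferentiableAt ℂ (gQuot r k) a := by
  have hq := norm_sq_lt_one hr1
  have hd := differentiable_qPoch hq
  unfold gQuot gMon
  refine DifferentiableAt.mul ?_ (DifferentiableAt.div ?_ ?_ (qPoch_ne_zero_of_norm_lt hq ha1))
  · split_ifs
    · fun_prop
    · refine DifferentiableAt.zpow (by fun_prop) (Or.inl (div_ne_zero (neg_ne_zero.mpr ha) hr))
  · exact (hd _).comp a (DifferentiableAt.div (by fun_prop) (by fun_prop) ha)
  · exact (hd _).comp a (by fun_prop)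

/-- The order of magnitude of `gQuot r k a` for `‖a‖ = x`. -/
noncomputable def gSize (r : ℂ) (k : ℤ) (x : ℝ) : ℝ := if 0 ≤ k then 1 else (x / ‖r‖) ^ k

lemma norm_gMon (r : ℂ) (k : ℤ) (a : ℂ) : ‖gMon r k a‖ = gSize r k ‖a‖ := by
  unfold gMon gSize
  split_ifs <;> simp

/-- The upper condition is put on `r^|k| a` rather than on `a`: for `k ≠ 0` the bound then stays
valid up to `‖a‖ = 1`, as the pinching argument requires. -/
lemma exists_norm_gQuot_le {r : ℂ} (hr : r ≠ 0) (hr1 : ‖r‖ < 1) {ρ₀ ρ₁ : ℝ} (h0 : 0 < ρ₀)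
    (h1 : ρ₁ < 1) : ∃ C : ℝ, 0 < C ∧ ∀ (k : ℤ) (a : ℂ), ρ₀ ≤ ‖a‖ → ‖r ^ |k| * a‖ ≤ ρ₁ →
      ‖gQuot r k a‖ ≤ C * gSize r k ‖a‖ := by
  have hq := norm_sq_lt_one hr1
  obtain ⟨C, hC, hCb⟩ := exists_norm_qPoch_le hq (1 / ρ₀)
  obtain ⟨c, hc, hcb⟩ := exists_le_norm_qPoch hq h1
  refine ⟨C / c, by positivity, fun k a ha hka => ?_⟩
  unfold gQuot
  rw [norm_mul, norm_gMon, mul_comm, norm_div]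
  have hg : 0 ≤ gSize r k ‖a‖ := by rw [← norm_gMon]; exact norm_nonneg _
  refine mul_le_mul_of_nonneg_right (div_le_div₀ hC.le (hCb _ ?_) hc (hcb _ hka)) hg
  rw [zpow_two_add_abs_div hr, norm_mul, norm_div]
  calc ‖r ^ |k|‖ * (‖r ^ 2‖ / ‖a‖) ≤ 1 * (1 / ρ₀) := by
        gcongr
        exact norm_zpow_abs_le_one hr1 k
    _ = 1 / ρ₀ := one_mul _

lemma exists_le_norm_gQuot {r : ℂ} (hr : r ≠ 0) (hr1 : ‖r‖ < 1) {ρ₀ ρ₁ : ℝ} (h0 : ‖r ^ 2‖ < ρ₀)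
    (h1 : ρ₁ < 1) : ∃ c : ℝ, 0 < c ∧ ∀ (k : ℤ) (a : ℂ), ρ₀ ≤ ‖a‖ → ‖a‖ ≤ ρ₁ →
      c * gSize r k ‖a‖ ≤ ‖gQuot r k a‖ := by
  have hq := norm_sq_lt_one hr1
  have h00 : 0 < ρ₀ := (norm_nonneg _).trans_lt h0
  obtain ⟨C, hC, hCb⟩ := exists_norm_qPoch_le hq 1
  obtain ⟨c, hc, hcb⟩ := exists_le_norm_qPoch hq ((div_lt_one h00).mpr h0)
  refine ⟨c / C, by positivity, fun k a ha hka => ?_⟩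
  unfold gQuot
  rw [norm_mul, norm_gMon, mul_comm _ (‖_ / _‖), norm_div]
  have hg : 0 ≤ gSize r k ‖a‖ := by rw [← norm_gMon]; exact norm_nonneg _
  have hlt := norm_zpow_abs_mul_lt hr1 k (hka.trans_lt h1)
  refine mul_le_mul_of_nonneg_right (div_le_div₀ (norm_nonneg _) (hcb _ ?_)
    (norm_pos_iff.mpr (qPoch_ne_zero_of_norm_lt hq hlt)) (hCb _ hlt.le)) hg
  rw [zpow_two_add_abs_div hr, norm_mul, norm_div]
  calc ‖r ^ |k|‖ * (‖r ^ 2‖ / ‖a‖) ≤ 1 * (‖r ^ 2‖ / ρ₀) := by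
        gcongr
        exact norm_zpow_abs_le_one hr1 k
    _ = ‖r ^ 2‖ / ρ₀ := one_mul _

attribute [irreducible] gQuot

/-! ### The beta integral: convergence and holomorphy in the parameters -/

/-- Holomorphy of a parametric integral that is locally dominated. -/
lemma differentiableOn_integral_of_dominated {X : Type*} [MeasurableSpace X] {μ : Measure X}
    {F : ℂ → X → ℂ} {V : Set ℂ} (hm : ∀ c ∈ V, AEStronglyMeasurable (F c) μ)
    (hd : ∀ x, DifferentiableOn ℂ (fun c => F c x) V)
    (hb : ∀ c ∈ V, ∃ ε > 0, Metric.closedBall c ε ⊆ V ∧ ∃ b : X → ℝ, Integrable b μ ∧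
      ∀ x, ∀ c' ∈ Metric.closedBall c ε, ‖F c' x‖ ≤ b x) :
    DifferentiableOn ℂ (fun c => ∫ x, F c x ∂μ) V := by
  intro c hc
  obtain ⟨ε, hε, hsub, b, hbi, hbd⟩ := hb c hc
  have hat : ∀ x, ∀ c' ∈ Metric.ball c ε, DifferentiableAt ℂ (fun c => F c x) c' := fun x c' hc' =>
    ((hd x).mono (Metric.ball_subset_closedBall.trans hsub)).differentiableAt
      (Metric.isOpen_ball.mem_nhds hc')
  have hmem : ∀ n : ℕ, c + ((ε / (n + 2) : ℝ) : ℂ) ∈ Metric.closedBall c ε := fun n => by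
    rw [Metric.mem_closedBall, dist_eq_norm, add_sub_cancel_left, norm_real, Real.norm_eq_abs,
      abs_of_nonneg (by positivity)]
    exact div_le_self hε.le (by linarith [n.cast_nonneg (α := ℝ)])
  -- Measurability of the derivative is not assumed; the derivative is a pointwise limit of
  -- measurable difference quotients with steps `ε / (n + 2)`.
  have hmeas : AEStronglyMeasurable (fun x => deriv (fun c => F c x) c) μ := by
    refine aestronglyMeasurable_of_tendsto_ae atTop
      (f := fun (n : ℕ) x => (((ε / (n + 2) : ℝ) : ℂ))⁻¹ *
        (F (c + ((ε / (n + 2) : ℝ) : ℂ)) x - F c x)) (fun n => ?_) (.of_forall fun x => ?_)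
    · exact ((hm _ (hsub (hmem n))).sub (hm c hc)).const_mul _
    · have h1 := (hat x c (Metric.mem_ball_self hε)).hasDerivAt.tendsto_slope_zero
      have h2 : Tendsto (fun n : ℕ => ((ε / (n + 2) : ℝ) : ℂ)) atTop (𝓝[≠] 0) := by
        refine tendsto_nhdsWithin_iff.mpr ⟨?_, .of_forall fun n => ?_⟩
        · rw [← ofReal_zero]
          refine (continuous_ofReal.tendsto 0).comp ?_
          exact Tendsto.div_atTop tendsto_const_nhds
            (tendsto_atTop_add_const_right _ _ tendsto_natCast_atTop_atTop)
        · simp only [Set.mem_compl_iff, Set.mem_singleton_iff, ofReal_eq_zero]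
          positivity
      exact h1.comp h2
  have hhalf : 0 < ε / 2 := by positivity
  refine (hasDerivAt_integral_of_dominated_loc_of_deriv_le (F := F)
    (F' := fun c' x => deriv (fun c => F c x) c') (bound := fun x => b x / (ε / 2))
    (Metric.ball_mem_nhds c hhalf) ?_ ?_ hmeas (.of_forall fun x c' hc' => ?_)
    (hbi.div_const _) (.of_forall fun x c' hc' => ?_)).2.differentiableAt.differentiableWithinAt
  · filter_upwards [Metric.closedBall_mem_nhds c hε] with c' hc' using hm c' (hsub hc')
  · exact hbi.mono' (hm c hc) (.of_forall fun x => hbd x c (Metric.mem_closedBall_self hε.le))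
  -- Cauchy's estimate on a disc of radius `ε / 2` about `c'` turns the bound on `F` into a bound on
  -- its derivative.
  · have hcb : Metric.closedBall c' (ε / 2) ⊆ Metric.closedBall c ε := by
      refine Metric.closedBall_subset_closedBall' ?_
      have := (Metric.mem_ball.mp hc').le
      linarith
    refine norm_deriv_le_of_forall_mem_sphere_norm_le hhalf ?_ fun z hz =>
      hbd x z (hcb (Metric.sphere_subset_closedBall hz))
    exact ((hd x).mono (hcb.trans hsub)).diffContOnCl_ball subset_rfl
  · exact (hat x c' (Metric.ball_subset_ball (by linarith) hc')).hasDerivAt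

/-- The measure `∑_{m ∈ ℤ} dθ` on `ℤ × (0, 2π]`. -/
noncomputable def sumMeas : Measure (ℤ × ℝ) :=
  Measure.count.prod (volume.restrict (Set.Ioc 0 (2 * Real.pi)))

/-- The integrand of the sum-integral analogue of the beta integral. -/
noncomputable def betaTerm (r : ℂ) (a : Fin 6 → ℂ) (n : Fin 6 → ℤ) (m : ℤ) (z : ℂ) : ℂ :=
  density r m z * z ^ (-6 * m) *
    ∏ j, (gQuot r (n j + m) (a j * z) * gQuot r (n j - m) (a j / z))

/-- The sum-integral analogue of the beta integral. -/
noncomputable def betaInt (r : ℂ) (a : Fin 6 → ℂ) (n : Fin 6 → ℤ) : ℂ :=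
  ∫ p, betaTerm r a n p.1 (circleMap 0 1 p.2) ∂sumMeas

lemma differentiableAt_density {r : ℂ} (hr : r ≠ 0) (m : ℤ) {ζ : ℂ → ℂ} {c : ℂ}
    (hζ : DifferentiableAt ℂ ζ c) (h0 : ζ c ≠ 0) :
    DifferentiableAt ℂ (fun c => density r m (ζ c)) c := by
  unfold density
  have h1 := zpow_ne_zero m (pow_ne_zero 2 hr)
  have h2 := pow_ne_zero 2 h0
  fun_prop (disch := assumption)

lemma differentiableAt_betaTerm {r : ℂ} (hr : r ≠ 0) (hr1 : ‖r‖ < 1) (n : Fin 6 → ℤ) (m : ℤ)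
    {a : ℂ → Fin 6 → ℂ} {ζ : ℂ → ℂ} {c : ℂ} (ha : ∀ j, DifferentiableAt ℂ (fun c => a c j) c)
    (hζ : DifferentiableAt ℂ ζ c) (h0 : ζ c ≠ 0) (ha0 : ∀ j, a c j ≠ 0)
    (h1 : ∀ j, ‖r ^ |n j + m| * (a c j * ζ c)‖ < 1)
    (h2 : ∀ j, ‖r ^ |n j - m| * (a c j / ζ c)‖ < 1) :
    DifferentiableAt ℂ (fun c => betaTerm r (a c) n m (ζ c)) c := by
  unfold betaTerm
  refine ((differentiableAt_density hr m hζ h0).mul (hζ.zpow (Or.inl h0))).mul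
    (DifferentiableAt.fun_finsetProd fun j _ => DifferentiableAt.mul ?_ ?_)
  · exact (differentiableAt_gQuot hr hr1 _ (mul_ne_zero (ha0 j) h0) (h1 j)).comp c
      ((ha j).mul hζ)
  · exact (differentiableAt_gQuot hr hr1 _ (div_ne_zero (ha0 j) h0) (h2 j)).comp c
      ((ha j).div hζ h0)

lemma continuous_comp_circleMap {R : ℝ} {f : ℂ → ℂ}
    (h : ∀ z : ℂ, ‖z‖ = |R| → ContinuousAt f z) : Continuous fun θ => f (circleMap 0 R θ) :=
  continuous_iff_continuousAt.mpr fun θ =>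
    (h _ (by simp)).comp (f := circleMap 0 R) (continuous_circleMap 0 R).continuousAt

lemma measurable_int_prod {f : ℤ × ℝ → ℂ} (h : ∀ m, Measurable fun θ => f (m, θ)) :
    Measurable f :=
  measurable_from_prod_countable_right h

lemma continuous_betaTerm {r : ℂ} (hr : r ≠ 0) (hr1 : ‖r‖ < 1) {a : Fin 6 → ℂ} (n : Fin 6 → ℤ)
    (ha0 : ∀ j, a j ≠ 0) (ha1 : ∀ j, ‖a j‖ < 1) (m : ℤ) :
    Continuous fun θ => betaTerm r a n m (circleMap 0 1 θ) := by
  refine continuous_comp_circleMap (f := betaTerm r a n m) fun z hz => ?_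
  rw [abs_one] at hz
  have h0 : z ≠ 0 := norm_pos_iff.mp (by rw [hz]; exact one_pos)
  refine (differentiableAt_betaTerm hr hr1 n m (a := fun _ => a) (ζ := id) (fun j => by fun_prop)
    differentiableAt_id h0 ha0 (fun j => ?_) fun j => ?_).continuousAt
  · exact norm_zpow_abs_mul_lt hr1 _ (by simpa [hz] using ha1 j)
  · exact norm_zpow_abs_mul_lt hr1 _ (by simpa [hz] using ha1 j)

lemma measurable_betaTerm {r : ℂ} (hr : r ≠ 0) (hr1 : ‖r‖ < 1) {a : Fin 6 → ℂ} (n : Fin 6 → ℤ)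
    (ha0 : ∀ j, a j ≠ 0) (ha1 : ∀ j, ‖a j‖ < 1) :
    Measurable fun p : ℤ × ℝ => betaTerm r a n p.1 (circleMap 0 1 p.2) :=
  measurable_int_prod fun m => (continuous_betaTerm hr hr1 n ha0 ha1 m).measurable

lemma gSize_eq {r : ℂ} (k : ℤ) (x : ℝ) : gSize r k x = (x / ‖r‖) ^ (min k 0) := by
  unfold gSize
  split_ifs with h
  · rw [min_eq_right h, zpow_zero]
  · rw [min_eq_left (by omega)]

lemma zpow_le_zpow_natAbs {y K : ℝ} (hy : 0 < y) (h1 : y ≤ K) (h2 : y⁻¹ ≤ K) (d : ℤ) :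
    y ^ d ≤ K ^ d.natAbs := by
  rcases Int.natAbs_eq d with h | h
  · rw [h, Int.natAbs_natCast, zpow_natCast]; exact pow_le_pow_left₀ hy.le h1 _
  · rw [h, Int.natAbs_neg, Int.natAbs_natCast, zpow_neg, zpow_natCast, ← inv_pow]
    exact pow_le_pow_left₀ (by positivity) h2 _

/-- The exponent `min (n+m) 0 + min (n-m) 0` differs from `-|m|` by at most `2|n|`; the constant `K`
absorbs the difference whichever side of `1` the base lies on. -/
lemma gSize_mul_le {r : ℂ} (hr : r ≠ 0) {x K : ℝ} (hx : 0 < x) (hK : 1 ≤ K)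
    (h1 : x / ‖r‖ ≤ K) (h2 : ‖r‖ / x ≤ K) (n m : ℤ) :
    gSize r (n + m) x * gSize r (n - m) x ≤ K ^ (2 * n.natAbs) * (‖r‖ / x) ^ m.natAbs := by
  have hr' := norm_pos_iff.mpr hr
  have hy : 0 < x / ‖r‖ := by positivity
  rw [gSize_eq, gSize_eq, ← zpow_add₀ hy.ne']
  have e : (‖r‖ / x) ^ m.natAbs = (x / ‖r‖) ^ (-(m.natAbs : ℤ)) := by
    rw [zpow_neg, zpow_natCast, ← inv_pow, inv_div]
  obtain ⟨d, hd⟩ : ∃ d : ℤ, min (n + m) 0 + min (n - m) 0 = d + -(m.natAbs : ℤ) := ⟨_, by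
    rw [← sub_eq_iff_eq_add]⟩
  rw [hd, e, zpow_add₀ hy.ne']
  refine mul_le_mul_of_nonneg_right ?_ (by positivity)
  refine (zpow_le_zpow_natAbs hy h1 (by rwa [inv_div]) d).trans (pow_le_pow_right₀ hK ?_)
  omega

lemma norm_density_le {r : ℂ} (hr : r ≠ 0) (hr1 : ‖r‖ < 1) (m : ℤ) {z : ℂ} (hz : ‖z‖ = 1) :
    ‖density r m z‖ ≤ 4 * (‖r‖ ^ 2)⁻¹ ^ m.natAbs := by
  have hr' := norm_pos_iff.mpr hr
  have hx : 0 < ‖r‖ ^ 2 := by positivity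
  have hx1 : ‖r‖ ^ 2 ≤ 1 := pow_le_one₀ hr'.le hr1.le
  have hK : 1 ≤ (‖r‖ ^ 2)⁻¹ := (one_le_inv₀ hx).mpr hx1
  unfold density
  set X := (‖r‖ ^ 2) ^ m with hX
  have hX0 : 0 < X := by positivity
  have b1 : X ≤ (‖r‖ ^ 2)⁻¹ ^ m.natAbs :=
    zpow_le_zpow_natAbs hx (hx1.trans hK) le_rfl m
  have b2 : X⁻¹ ≤ (‖r‖ ^ 2)⁻¹ ^ m.natAbs := by
    have := zpow_le_zpow_natAbs hx (hx1.trans hK) le_rfl (-m)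
    rwa [zpow_neg, Int.natAbs_neg] at this
  have b3 : 1 ≤ (‖r‖ ^ 2)⁻¹ ^ m.natAbs := one_le_pow₀ hK
  have n1 : ‖1 - (r ^ 2) ^ m * z ^ 2‖ ≤ 1 + X := by
    refine (norm_sub_le _ _).trans ?_
    simp [hz, hX]
  have n2 : ‖1 - (r ^ 2) ^ m / z ^ 2‖ ≤ 1 + X := by
    refine (norm_sub_le _ _).trans ?_
    simp [hz, hX]
  rw [norm_div, norm_mul, norm_zpow, norm_pow, ← hX]
  calc ‖1 - (r ^ 2) ^ m * z ^ 2‖ * ‖1 - (r ^ 2) ^ m / z ^ 2‖ / X ≤ (1 + X) * (1 + X) / X := by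
        gcongr
    _ = X⁻¹ + 2 + X := by field_simp; ring
    _ ≤ _ := by linarith

/-- Each pair of quotients contributes `(‖r‖/‖a_j‖)^|m|`. By the balancing condition the six rates
multiply to `‖r‖^6/‖r‖^2 = ‖r‖^4`, which beats the growth `‖r‖^(-2|m|)` of the density. The constant
does not depend on `a`, so the bound serves as a dominating function and also near the pinch. -/
lemma exists_norm_betaTerm_le {r : ℂ} (hr : r ≠ 0) (hr1 : ‖r‖ < 1) (n : Fin 6 → ℤ) {ρ₀ ρ₁ : ℝ}
    (h0 : 0 < ρ₀) (h1 : ρ₁ < 1) : ∃ C : ℝ, 0 < C ∧ ∀ (a : Fin 6 → ℂ) (m : ℤ) (z : ℂ), ‖z‖ = 1 →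
      (∀ j, ρ₀ ≤ ‖a j‖) → (∀ j, ‖a j‖ ≤ 1) → ∏ j, a j = r ^ 2 →
      (∀ j, ‖r ^ |n j + m| * a j‖ ≤ ρ₁) → (∀ j, ‖r ^ |n j - m| * a j‖ ≤ ρ₁) →
      ‖betaTerm r a n m z‖ ≤ C * (‖r‖ ^ 2) ^ m.natAbs := by
  have hr' := norm_pos_iff.mpr hr
  obtain ⟨C, hC, hCb⟩ := exists_norm_gQuot_le hr hr1 h0 h1
  obtain ⟨K, hK1, hK2, hK3⟩ : ∃ K : ℝ, 1 ≤ K ∧ 1 / ‖r‖ ≤ K ∧ ‖r‖ / ρ₀ ≤ K :=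
    ⟨max 1 (max (1 / ‖r‖) (‖r‖ / ρ₀)), by simp, by simp, by simp⟩
  refine ⟨4 * ∏ j, (C * C * K ^ (2 * (n j).natAbs)), by positivity,
    fun a m z hz ha0 ha1 hp hb1 hb2 => ?_⟩
  have hz0 : z ≠ 0 := norm_pos_iff.mp (by rw [hz]; exact one_pos)
  have hj : ∀ j, ‖gQuot r (n j + m) (a j * z) * gQuot r (n j - m) (a j / z)‖ ≤
      C * C * K ^ (2 * (n j).natAbs) * (‖r‖ / ‖a j‖) ^ m.natAbs := by
    intro j
    have hx : 0 < ‖a j‖ := h0.trans_le (ha0 j)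
    have e1 : ‖a j * z‖ = ‖a j‖ := by simp [hz]
    have e2 : ‖a j / z‖ = ‖a j‖ := by simp [hz]
    have g1 := hCb (n j + m) (a j * z) (by rw [e1]; exact ha0 j)
      (by rw [norm_mul, e1, ← norm_mul]; exact hb1 j)
    have g2 := hCb (n j - m) (a j / z) (by rw [e2]; exact ha0 j)
      (by rw [norm_mul, e2, ← norm_mul]; exact hb2 j)
    rw [e1] at g1; rw [e2] at g2
    have g3 := gSize_mul_le hr hx hK1 (((div_le_div_iff_of_pos_right hr').mpr (ha1 j)).trans hK2)
      ((div_le_div_of_nonneg_left hr'.le h0 (ha0 j)).trans hK3) (n j) m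
    rw [norm_mul]
    calc _ ≤ (C * gSize r (n j + m) ‖a j‖) * (C * gSize r (n j - m) ‖a j‖) :=
          mul_le_mul g1 g2 (norm_nonneg _) ((norm_nonneg _).trans g1)
      _ = C * C * (gSize r (n j + m) ‖a j‖ * gSize r (n j - m) ‖a j‖) := by ring
      _ ≤ C * C * (K ^ (2 * (n j).natAbs) * (‖r‖ / ‖a j‖) ^ m.natAbs) := by gcongr
      _ = _ := by ring
  have hprod : ∏ j : Fin 6, (‖r‖ / ‖a j‖) ^ m.natAbs = (‖r‖ ^ 4) ^ m.natAbs := by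
    rw [Finset.prod_pow, Finset.prod_div_distrib, ← norm_prod Finset.univ a, hp]
    congr 1
    simp only [Finset.prod_const, Finset.card_univ, Fintype.card_fin, norm_pow]
    field_simp
  unfold betaTerm
  rw [norm_mul, norm_mul, norm_zpow, hz, one_zpow, mul_one, norm_prod]
  calc _ ≤ (4 * (‖r‖ ^ 2)⁻¹ ^ m.natAbs) *
        ∏ j, (C * C * K ^ (2 * (n j).natAbs) * (‖r‖ / ‖a j‖) ^ m.natAbs) := by
        refine mul_le_mul (norm_density_le hr hr1 m hz)
          (Finset.prod_le_prod (fun _ _ => norm_nonneg _) fun j _ => hj j)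
          (Finset.prod_nonneg fun _ _ => norm_nonneg _) (by positivity)
    _ = 4 * (∏ j, (C * C * K ^ (2 * (n j).natAbs))) *
        ((‖r‖ ^ 2)⁻¹ ^ m.natAbs * (‖r‖ ^ 4) ^ m.natAbs) := by
        rw [Finset.prod_mul_distrib, hprod]; ring
    _ = _ := by
        congr 1
        rw [← mul_pow]
        congr 1
        field_simp

lemma summable_pow_natAbs {x : ℝ} (h0 : 0 ≤ x) (h1 : x < 1) :
    Summable fun m : ℤ => x ^ m.natAbs := by
  refine Summable.of_nat_of_neg ?_ ?_ <;> simpa using summable_geometric_of_lt_one h0 h1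

lemma integrable_pow_natAbs {x : ℝ} (h0 : 0 ≤ x) (h1 : x < 1) (C : ℝ) :
    Integrable (fun p : ℤ × ℝ => C * x ^ p.1.natAbs) sumMeas := by
  have hf : Integrable (fun m : ℤ => C * x ^ m.natAbs) Measure.count := by
    rw [integrable_count_iff]
    simpa using ((summable_pow_natAbs h0 h1).mul_left C).norm
  unfold sumMeas
  simpa using hf.mul_prod (integrable_const (1 : ℝ))
    (ν := volume.restrict (Set.Ioc 0 (2 * Real.pi)))

/-- The parameter domain of the beta integral. -/
structure BetaDom (r : ℂ) (a : Fin 6 → ℂ) : Prop where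
  ne_zero : ∀ j, a j ≠ 0
  lt_one : ∀ j, ‖a j‖ < 1
  prod_eq : ∏ j, a j = r ^ 2

lemma integrable_betaTerm {r : ℂ} (hr : r ≠ 0) (hr1 : ‖r‖ < 1) {a : Fin 6 → ℂ}
    (ha : BetaDom r a) (n : Fin 6 → ℤ) :
    Integrable (fun p : ℤ × ℝ => betaTerm r a n p.1 (circleMap 0 1 p.2)) sumMeas := by
  obtain ⟨i, hi⟩ := Finite.exists_min fun j => ‖a j‖
  obtain ⟨k, hk⟩ := Finite.exists_max fun j => ‖a j‖
  obtain ⟨C, -, hC⟩ := exists_norm_betaTerm_le hr hr1 n (norm_pos_iff.mpr (ha.ne_zero i))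
    (ha.lt_one k)
  refine (integrable_pow_natAbs (by positivity) (pow_lt_one₀ (norm_nonneg r) hr1 two_ne_zero)
    C).mono' (measurable_betaTerm hr hr1 n ha.ne_zero ha.lt_one).aestronglyMeasurable
    (.of_forall fun p => hC a p.1 _ (by simp) hi (fun j => (ha.lt_one j).le) ha.prod_eq
      (fun j => ?_) fun j => ?_)
  all_goals
    rw [norm_mul]
    exact (mul_le_of_le_one_left (norm_nonneg _) (norm_zpow_abs_le_one hr1 _)).trans (hk j)

/-- On a compact disc the moduli of the parameters stay away from `0` and from `1`, so
`exists_norm_betaTerm_le` gives one integrable majorant for the whole disc. -/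
lemma differentiableOn_betaInt {r : ℂ} (hr : r ≠ 0) (hr1 : ‖r‖ < 1) (n : Fin 6 → ℤ) {V : Set ℂ}
    (hV : IsOpen V) {a : ℂ → Fin 6 → ℂ} (ha : ∀ c ∈ V, BetaDom r (a c))
    (hd : ∀ j, DifferentiableOn ℂ (fun c => a c j) V) :
    DifferentiableOn ℂ (fun c => betaInt r (a c) n) V := by
  refine differentiableOn_integral_of_dominated
    (fun c hc => (integrable_betaTerm hr hr1 (ha c hc) n).aestronglyMeasurable) ?_ ?_
  · intro p c hc
    have hz : ‖circleMap 0 1 p.2‖ = 1 := by simp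
    have h0 : circleMap 0 1 p.2 ≠ 0 := norm_pos_iff.mp (by rw [hz]; exact one_pos)
    refine (differentiableAt_betaTerm hr hr1 n p.1 (a := a) (ζ := fun _ => circleMap 0 1 p.2)
      (fun j => (hd j).differentiableAt (hV.mem_nhds hc)) (by fun_prop) h0 (ha c hc).ne_zero
      (fun j => ?_) fun j => ?_).differentiableWithinAt
    · exact norm_zpow_abs_mul_lt hr1 _ (by simpa [hz] using (ha c hc).lt_one j)
    · exact norm_zpow_abs_mul_lt hr1 _ (by simpa [hz] using (ha c hc).lt_one j)
  · intro c hc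
    obtain ⟨ε, hε, hsub⟩ := Metric.nhds_basis_closedBall.mem_iff.mp (hV.mem_nhds hc)
    refine ⟨ε, hε, hsub, ?_⟩
    have hcomp := isCompact_closedBall c ε
    have hne : (Metric.closedBall c ε).Nonempty := ⟨c, Metric.mem_closedBall_self hε.le⟩
    have hmin : ∀ j, ∃ ρ > 0, ∀ x ∈ Metric.closedBall c ε, ρ ≤ ‖a x j‖ := fun j => by
      obtain ⟨x, hx, hm⟩ := hcomp.exists_isMinOn hne
        ((hd j).continuousOn.mono hsub).norm
      exact ⟨_, norm_pos_iff.mpr ((ha x (hsub hx)).ne_zero j), fun y hy => hm hy⟩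
    have hmax : ∀ j, ∃ ρ < 1, ∀ x ∈ Metric.closedBall c ε, ‖a x j‖ ≤ ρ := fun j => by
      obtain ⟨x, hx, hm⟩ := hcomp.exists_isMaxOn hne
        ((hd j).continuousOn.mono hsub).norm
      exact ⟨_, (ha x (hsub hx)).lt_one j, fun y hy => hm hy⟩
    choose lo hlo hlo' using hmin
    choose hi hhi hhi' using hmax
    obtain ⟨i, hi'⟩ := Finite.exists_min lo
    obtain ⟨k, hk'⟩ := Finite.exists_max hi
    obtain ⟨C, -, hC⟩ := exists_norm_betaTerm_le hr hr1 n (hlo i) (hhi k)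
    refine ⟨_, integrable_pow_natAbs (x := ‖r‖ ^ 2) (by positivity)
      (pow_lt_one₀ (norm_nonneg r) hr1 two_ne_zero) C, fun p x hx =>
      hC (a x) p.1 _ (by simp) (fun j => (hi' j).trans (hlo' j x hx))
        (fun j => ((ha x (hsub hx)).lt_one j).le) (ha x (hsub hx)).prod_eq
        (fun j => ?_) fun j => ?_⟩
    all_goals
      rw [norm_mul]
      exact (mul_le_of_le_one_left (norm_nonneg _) (norm_zpow_abs_le_one hr1 _)).trans
        ((hhi' j x hx).trans (hk' j))

/-! ### The closed form: nonvanishing, symmetries and contiguous relation -/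

/-- The closed form of the beta integral, up to the factor `4π`. -/
noncomputable def betaProd (r : ℂ) (a : Fin 6 → ℂ) (n : Fin 6 → ℤ) : ℂ :=
  (∏ j, a j ^ (-n j)) *
    (gQuot r (n 0 + n 1) (a 0 * a 1) * gQuot r (n 0 + n 2) (a 0 * a 2) *
      gQuot r (n 0 + n 3) (a 0 * a 3) * gQuot r (n 0 + n 4) (a 0 * a 4) *
      gQuot r (n 0 + n 5) (a 0 * a 5) * gQuot r (n 1 + n 2) (a 1 * a 2) *
      gQuot r (n 1 + n 3) (a 1 * a 3) * gQuot r (n 1 + n 4) (a 1 * a 4) *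
      gQuot r (n 1 + n 5) (a 1 * a 5) * gQuot r (n 2 + n 3) (a 2 * a 3) *
      gQuot r (n 2 + n 4) (a 2 * a 4) * gQuot r (n 2 + n 5) (a 2 * a 5) *
      gQuot r (n 3 + n 4) (a 3 * a 4) * gQuot r (n 3 + n 5) (a 3 * a 5) *
      gQuot r (n 4 + n 5) (a 4 * a 5))

lemma BetaDom.norm_mul_lt_one {r : ℂ} {a : Fin 6 → ℂ} (ha : BetaDom r a) (i j : Fin 6) :
    ‖a i * a j‖ < 1 := by
  rw [norm_mul]
  exact mul_lt_one_of_nonneg_of_lt_one_left (norm_nonneg _) (ha.lt_one i) (ha.lt_one j).le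

/-- The product of all six is `q`, and the other four have a product of modulus below `1`. This
places `a_i a_j` in the range where `gQuot` has neither zeros nor poles. -/
lemma BetaDom.lt_norm_mul {r : ℂ} {a : Fin 6 → ℂ} (ha : BetaDom r a) {i j : Fin 6} (hij : i ≠ j) :
    ‖r ^ 2‖ < ‖a i * a j‖ := by
  have h1 : ∏ k ∈ (Finset.univ.erase i).erase j, ‖a k‖ < 1 := by
    obtain ⟨k, hk⟩ : ((Finset.univ.erase i).erase j).Nonempty := by
      rw [← Finset.card_pos, Finset.card_erase_of_mem (by simp [hij.symm]),
        Finset.card_erase_of_mem (by simp)]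
      simp
    rw [← Finset.mul_prod_erase _ _ hk]
    exact (mul_le_of_le_one_right (norm_nonneg _) (Finset.prod_le_one (fun _ _ => norm_nonneg _)
      fun k _ => (ha.lt_one k).le)).trans_lt (ha.lt_one k)
  rw [← ha.prod_eq, norm_prod, ← Finset.mul_prod_erase _ _ (Finset.mem_univ i),
    ← Finset.mul_prod_erase _ _ (Finset.mem_erase.mpr ⟨hij.symm, Finset.mem_univ j⟩), norm_mul,
    ← mul_assoc]
  exact mul_lt_of_lt_one_right
    (mul_pos (norm_pos_iff.mpr (ha.ne_zero i)) (norm_pos_iff.mpr (ha.ne_zero j))) h1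

lemma BetaDom.gQuot_ne_zero {r : ℂ} (hr : r ≠ 0) (hr1 : ‖r‖ < 1) {a : Fin 6 → ℂ}
    (ha : BetaDom r a) (k : ℤ) {i j : Fin 6} (hij : i ≠ j) : gQuot r k (a i * a j) ≠ 0 :=
  QBailey.gQuot_ne_zero hr hr1 k (ha.lt_norm_mul hij) (ha.norm_mul_lt_one i j)

lemma BetaDom.betaProd_ne_zero {r : ℂ} (hr : r ≠ 0) (hr1 : ‖r‖ < 1) {a : Fin 6 → ℂ}
    (ha : BetaDom r a) (n : Fin 6 → ℤ) : betaProd r a n ≠ 0 := by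
  unfold betaProd
  refine mul_ne_zero (Finset.prod_ne_zero_iff.mpr fun j _ => zpow_ne_zero _ (ha.ne_zero j)) ?_
  have h : ∀ (k : ℤ) (i j : Fin 6), i ≠ j → gQuot r k (a i * a j) ≠ 0 := fun k _ _ hij =>
    ha.gQuot_ne_zero hr hr1 k hij
  repeat' apply mul_ne_zero
  all_goals exact h _ _ _ (by decide)

lemma differentiableOn_betaProd {r : ℂ} (hr : r ≠ 0) (hr1 : ‖r‖ < 1) (n : Fin 6 → ℤ) {V : Set ℂ}
    {a : ℂ → Fin 6 → ℂ} (ha : ∀ c ∈ V, BetaDom r (a c))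
    (hd : ∀ j, DifferentiableOn ℂ (fun c => a c j) V) :
    DifferentiableOn ℂ (fun c => betaProd r (a c) n) V := by
  have h : ∀ (k : ℤ) (i j : Fin 6),
      DifferentiableOn ℂ (fun c => gQuot r k (a c i * a c j)) V := fun k i j c hc =>
    (differentiableAt_gQuot hr hr1 k (mul_ne_zero ((ha c hc).ne_zero i) ((ha c hc).ne_zero j))
      (norm_zpow_abs_mul_lt hr1 k ((ha c hc).norm_mul_lt_one i j))).comp_differentiableWithinAt c
      (f := fun c => a c i * a c j) (((hd i).mul (hd j)) c hc)
  unfold betaProd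
  refine DifferentiableOn.mul (DifferentiableOn.fun_finsetProd fun j _ => (hd j).zpow
    (Or.inl fun c hc => (ha c hc).ne_zero j)) ?_
  repeat' first | exact h _ _ _ | apply DifferentiableOn.fun_mul

lemma betaTerm_comp_perm (r : ℂ) (a : Fin 6 → ℂ) (n : Fin 6 → ℤ) (σ : Equiv.Perm (Fin 6)) :
    betaTerm r (a ∘ σ) (n ∘ σ) = betaTerm r a n := by
  funext m z
  unfold betaTerm
  congr 1
  exact Equiv.prod_comp σ fun j => gQuot r (n j + m) (a j * z) * gQuot r (n j - m) (a j / z)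

lemma betaInt_comp_perm (r : ℂ) (a : Fin 6 → ℂ) (n : Fin 6 → ℤ) (σ : Equiv.Perm (Fin 6)) :
    betaInt r (a ∘ σ) (n ∘ σ) = betaInt r a n := by
  unfold betaInt
  rw [betaTerm_comp_perm]

/-- Slot `5` always serves as the dependent parameter, so only transpositions that fix it are
needed. -/
lemma betaProd_comp_swap (r : ℂ) (a : Fin 6 → ℂ) (n : Fin 6 → ℤ) {i : Fin 6} (hi : i ≠ 5) :
    betaProd r (a ∘ Equiv.swap 0 i) (n ∘ Equiv.swap 0 i) = betaProd r a n := by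
  have hs : ∀ i j : Fin 6, gQuot r (n i + n j) (a i * a j) = gQuot r (n j + n i) (a j * a i) :=
    fun i j => by rw [add_comm, mul_comm]
  have h1 : ∏ j, (a ∘ Equiv.swap 0 i) j ^ (-(n ∘ Equiv.swap 0 i) j) = ∏ j, a j ^ (-n j) :=
    Equiv.prod_comp (Equiv.swap 0 i) fun j => a j ^ (-n j)
  unfold betaProd
  rw [h1]
  congr 1
  simp only [Function.comp_apply]
  fin_cases i
  · simp
  · have e : ∀ k : Fin 6, Equiv.swap (0 : Fin 6) 1 k = ![1, 0, 2, 3, 4, 5] k := by decide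
    simp only [Fin.mk_one, e, Matrix.cons_val]
    rw [hs 1 0]; ring
  · have e : ∀ k : Fin 6, Equiv.swap (0 : Fin 6) 2 k = ![2, 1, 0, 3, 4, 5] k := by decide
    simp only [Fin.reduceFinMk, e, Matrix.cons_val]
    rw [hs 2 1, hs 2 0, hs 1 0]; ring
  · have e : ∀ k : Fin 6, Equiv.swap (0 : Fin 6) 3 k = ![3, 1, 2, 0, 4, 5] k := by decide
    simp only [Fin.reduceFinMk, e, Matrix.cons_val]
    rw [hs 3 1, hs 3 2, hs 3 0, hs 1 0, hs 2 0]; ring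
  · have e : ∀ k : Fin 6, Equiv.swap (0 : Fin 6) 4 k = ![4, 1, 2, 3, 0, 5] k := by decide
    simp only [Fin.reduceFinMk, e, Matrix.cons_val]
    rw [hs 4 1, hs 4 2, hs 4 3, hs 4 0, hs 1 0, hs 2 0, hs 3 0]; ring
  · exact absurd rfl hi

lemma BetaDom.comp_perm {r : ℂ} {a : Fin 6 → ℂ} (ha : BetaDom r a) (σ : Equiv.Perm (Fin 6)) :
    BetaDom r (a ∘ σ) :=
  ⟨fun _ => ha.ne_zero _, fun _ => ha.lt_one _, (Equiv.prod_comp σ a).trans ha.prod_eq⟩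

lemma gQuot_reflect {r : ℂ} (hr : r ≠ 0) (k : ℤ) {a : ℂ} (ha : a ≠ 0) :
    gQuot r k a = (-a / r) ^ k * gQuot r (-k) a := by
  have := gQuot_neg hr (-k) ha
  rwa [neg_neg] at this

/-- Reflecting the fifteen quotients produces `a_i` to the power `n_i` five times and to each other
`n_j` once. Since the `n_j` sum to zero this is `a_i ^ (4 n_i)`, and the powers of `-1/r` cancel. -/
lemma betaProd_reflect {r : ℂ} (hr : r ≠ 0) {a : Fin 6 → ℂ} (ha : ∀ j, a j ≠ 0)
    {n : Fin 6 → ℤ} (hn : ∑ j, n j = 0) :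
    betaProd r a n = (∏ j, a j ^ (2 * n j)) * betaProd r a (-n) := by
  have h : ∀ i j : Fin 6, gQuot r (n i + n j) (a i * a j) =
      ((-1 / r) ^ n i * (-1 / r) ^ n j * (a i ^ n i * a i ^ n j * (a j ^ n i * a j ^ n j))) *
        gQuot r (-n i + -n j) (a i * a j) := by
    intro i j
    have e : (-1 / r : ℂ) ≠ 0 := div_ne_zero (by norm_num) hr
    rw [gQuot_reflect hr _ (mul_ne_zero (ha i) (ha j)), ← neg_add, ← zpow_add₀ e,
      ← zpow_add₀ (ha i), ← zpow_add₀ (ha j), ← mul_zpow, ← mul_zpow]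
    congr 2
    ring
  have hA : ∀ b : ℂ, b ≠ 0 → b ^ n 0 * b ^ n 1 * b ^ n 2 * b ^ n 3 * b ^ n 4 * b ^ n 5 = 1 := by
    intro b hb
    rw [← zpow_add₀ hb, ← zpow_add₀ hb, ← zpow_add₀ hb, ← zpow_add₀ hb, ← zpow_add₀ hb,
      ← Fin.sum_univ_six, hn, zpow_zero]
  have hm : ∀ j, a j ^ (-n j) * (a j ^ n j) ^ 4 = a j ^ (2 * n j) * a j ^ n j := by
    intro j
    rw [← zpow_natCast, ← zpow_mul, ← zpow_add₀ (ha j), ← zpow_add₀ (ha j)]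
    congr 1; push_cast; ring
  unfold betaProd
  simp only [h, Fin.prod_univ_six, Pi.neg_apply, neg_neg]
  have m0 := hm 0; have m1 := hm 1; have m2 := hm 2; have m3 := hm 3; have m4 := hm 4
  have m5 := hm 5
  have A0 := hA _ (ha 0); have A1 := hA _ (ha 1); have A2 := hA _ (ha 2); have A3 := hA _ (ha 3)
  have A4 := hA _ (ha 4); have A5 := hA _ (ha 5)
  have AE := hA (-1 / r) (div_ne_zero (by norm_num) hr)
  generalize (-1 / r) = e at *
  calc _ = (a 0 ^ (-n 0) * (a 0 ^ n 0) ^ 4) * (a 1 ^ (-n 1) * (a 1 ^ n 1) ^ 4) *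
        (a 2 ^ (-n 2) * (a 2 ^ n 2) ^ 4) * (a 3 ^ (-n 3) * (a 3 ^ n 3) ^ 4) *
        (a 4 ^ (-n 4) * (a 4 ^ n 4) ^ 4) * (a 5 ^ (-n 5) * (a 5 ^ n 5) ^ 4) *
        (e ^ n 0 * e ^ n 1 * e ^ n 2 * e ^ n 3 * e ^ n 4 * e ^ n 5) ^ 5 *
        (a 0 ^ n 0 * a 0 ^ n 1 * a 0 ^ n 2 * a 0 ^ n 3 * a 0 ^ n 4 * a 0 ^ n 5) *
        (a 1 ^ n 0 * a 1 ^ n 1 * a 1 ^ n 2 * a 1 ^ n 3 * a 1 ^ n 4 * a 1 ^ n 5) *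
        (a 2 ^ n 0 * a 2 ^ n 1 * a 2 ^ n 2 * a 2 ^ n 3 * a 2 ^ n 4 * a 2 ^ n 5) *
        (a 3 ^ n 0 * a 3 ^ n 1 * a 3 ^ n 2 * a 3 ^ n 3 * a 3 ^ n 4 * a 3 ^ n 5) *
        (a 4 ^ n 0 * a 4 ^ n 1 * a 4 ^ n 2 * a 4 ^ n 3 * a 4 ^ n 4 * a 4 ^ n 5) *
        (a 5 ^ n 0 * a 5 ^ n 1 * a 5 ^ n 2 * a 5 ^ n 3 * a 5 ^ n 4 * a 5 ^ n 5) *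
        (gQuot r (-n 0 + -n 1) (a 0 * a 1) * gQuot r (-n 0 + -n 2) (a 0 * a 2) *
      gQuot r (-n 0 + -n 3) (a 0 * a 3) * gQuot r (-n 0 + -n 4) (a 0 * a 4) *
      gQuot r (-n 0 + -n 5) (a 0 * a 5) * gQuot r (-n 1 + -n 2) (a 1 * a 2) *
      gQuot r (-n 1 + -n 3) (a 1 * a 3) * gQuot r (-n 1 + -n 4) (a 1 * a 4) *
      gQuot r (-n 1 + -n 5) (a 1 * a 5) * gQuot r (-n 2 + -n 3) (a 2 * a 3) *
      gQuot r (-n 2 + -n 4) (a 2 * a 4) * gQuot r (-n 2 + -n 5) (a 2 * a 5) *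
      gQuot r (-n 3 + -n 4) (a 3 * a 4) * gQuot r (-n 3 + -n 5) (a 3 * a 5) *
      gQuot r (-n 4 + -n 5) (a 4 * a 5)) := by ring
    _ = _ := by
      rw [m0, m1, m2, m3, m4, m5, AE, A0, A1, A2, A3, A4, A5]
      ring

/-- The shift of the continuous parameters. -/
noncomputable def shiftA (r : ℂ) (a : Fin 6 → ℂ) : Fin 6 → ℂ :=
  ![r * a 0, a 1, a 2, a 3, a 4, a 5 / r]

/-- The shift of the discrete parameters. -/
def shiftN (n : Fin 6 → ℤ) : Fin 6 → ℤ := ![n 0 + 1, n 1, n 2, n 3, n 4, n 5 - 1]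

/-- By `gQuot_succ` the pairs `(0, j)` gain `1 - u_0 u_j` and the pairs `(j, 5)` lose `1 - p u_j`,
where `p = u_5 / r²` is the value of `r^{n_5} a_5` after the shift. The pair `(0, 5)` does not
change. -/
lemma betaProd_shift {r : ℂ} (hr : r ≠ 0) (hr1 : ‖r‖ < 1) {a : Fin 6 → ℂ} (ha : BetaDom r a)
    (ha' : BetaDom r (shiftA r a)) (n : Fin 6 → ℤ) {u : Fin 6 → ℂ} (hu : ∀ j, u j = r ^ n j * a j) :
    betaProd r (shiftA r a) (shiftN n) * u 0 *
        ((1 - u 5 / r ^ 2 * u 1) * (1 - u 5 / r ^ 2 * u 2) * (1 - u 5 / r ^ 2 * u 3) *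
          (1 - u 5 / r ^ 2 * u 4)) =
      betaProd r a n * (u 5 / r ^ 2) *
        ((1 - u 0 * u 1) * (1 - u 0 * u 2) * (1 - u 0 * u 3) * (1 - u 0 * u 4)) := by
  have h0 : ∀ j, gQuot r (n 0 + 1 + n j) (r * a 0 * a j) =
      (1 - u 0 * u j) * gQuot r (n 0 + n j) (a 0 * a j) := by
    intro j
    have := gQuot_succ hr hr1 (n 0 + n j) (mul_ne_zero (ha.ne_zero 0) (ha.ne_zero j))
      (ha.norm_mul_lt_one 0 j)
    rw [add_right_comm, mul_assoc, this, hu, hu, zpow_add₀ hr]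
    ring
  have h5 : ∀ j, j ≠ 0 → j ≠ 5 → gQuot r (n j + n 5) (a j * a 5) =
      (1 - u 5 / r ^ 2 * u j) * gQuot r (n j + (n 5 - 1)) (a j * (a 5 / r)) := by
    intro j hj0 hj5
    have hne : a j * (a 5 / r) ≠ 0 :=
      mul_ne_zero (ha.ne_zero j) (div_ne_zero (ha.ne_zero 5) hr)
    have hs : shiftA r a j = a j := by
      fin_cases j <;> first | rfl | exact absurd rfl hj0 | exact absurd rfl hj5
    have hlt : ‖a j * (a 5 / r)‖ < 1 := by
      have := ha'.norm_mul_lt_one j 5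
      rwa [hs] at this
    have := gQuot_succ hr hr1 (n j + (n 5 - 1)) hne hlt
    have e1 : n j + (n 5 - 1) + 1 = n j + n 5 := by ring
    have e2 : r * (a j * (a 5 / r)) = a j * a 5 := by field_simp
    rw [e1, e2] at this
    rw [this, hu, hu]
    congr 2
    rw [zpow_add₀ hr, zpow_sub_one₀ hr]
    field_simp
  have hp : (r * a 0) ^ (-(n 0 + 1)) * (a 5 / r) ^ (-(n 5 - 1)) * u 0 =
      a 0 ^ (-n 0) * a 5 ^ (-n 5) * (u 5 / r ^ 2) := by
    have h0 := ha.ne_zero 0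
    have h5 := ha.ne_zero 5
    have t1 : -(n 0 + 1) = -n 0 - 1 := by ring
    have t2 : -(n 5 - 1) = -n 5 + 1 := by ring
    rw [hu, hu, t1, t2, zpow_sub_one₀ (mul_ne_zero hr h0), zpow_add_one₀ (div_ne_zero h5 hr),
      mul_zpow, div_zpow]
    simp only [zpow_neg]
    have := zpow_ne_zero (n 0) hr
    have := zpow_ne_zero (n 5) hr
    have := zpow_ne_zero (n 0) h0
    have := zpow_ne_zero (n 5) h5
    field_simp
  have h05 : gQuot r (n 0 + 1 + (n 5 - 1)) (r * a 0 * (a 5 / r)) =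
      gQuot r (n 0 + n 5) (a 0 * a 5) := by
    congr 1
    · ring
    · field_simp
  unfold betaProd shiftA shiftN
  simp only [Fin.prod_univ_six, Matrix.cons_val]
  rw [h05, h0 1, h0 2, h0 3, h0 4, h5 1 (by decide) (by decide), h5 2 (by decide) (by decide),
    h5 3 (by decide) (by decide), h5 4 (by decide) (by decide)]
  linear_combination (exp := 1) (a 1 ^ (-n 1) * a 2 ^ (-n 2) * a 3 ^ (-n 3) * a 4 ^ (-n 4) *
    ((1 - u 0 * u 1) * gQuot r (n 0 + n 1) (a 0 * a 1) *
    ((1 - u 0 * u 2) * gQuot r (n 0 + n 2) (a 0 * a 2)) *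
    ((1 - u 0 * u 3) * gQuot r (n 0 + n 3) (a 0 * a 3)) *
    ((1 - u 0 * u 4) * gQuot r (n 0 + n 4) (a 0 * a 4)) *
    gQuot r (n 0 + n 5) (a 0 * a 5) * gQuot r (n 1 + n 2) (a 1 * a 2) *
    gQuot r (n 1 + n 3) (a 1 * a 3) * gQuot r (n 1 + n 4) (a 1 * a 4) *
    gQuot r (n 1 + (n 5 - 1)) (a 1 * (a 5 / r)) * gQuot r (n 2 + n 3) (a 2 * a 3) *
    gQuot r (n 2 + n 4) (a 2 * a 4) * gQuot r (n 2 + (n 5 - 1)) (a 2 * (a 5 / r)) *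
    gQuot r (n 3 + n 4) (a 3 * a 4) * gQuot r (n 3 + (n 5 - 1)) (a 3 * (a 5 / r)) *
    gQuot r (n 4 + (n 5 - 1)) (a 4 * (a 5 / r))) *
    ((1 - u 5 / r ^ 2 * u 1) * (1 - u 5 / r ^ 2 * u 2) * (1 - u 5 / r ^ 2 * u 3) *
          (1 - u 5 / r ^ 2 * u 4))) * hp

/-! ### Reflection and contiguous relation of the beta integral -/

lemma hasSum_integral_sumMeas {f : ℤ × ℝ → ℂ} (hf : Integrable f sumMeas) :
    HasSum (fun m : ℤ => ∫ θ in (0 : ℝ)..(2 * Real.pi), f (m, θ)) (∫ p, f p ∂sumMeas) := by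
  have h1 := hf.integral_prod_left
  have h2 : Summable fun m : ℤ => ∫ θ in Set.Ioc 0 (2 * Real.pi), f (m, θ) :=
    (integrable_count_iff.mp h1).of_norm
  unfold sumMeas at hf ⊢
  rw [integral_prod _ hf, integral_countable h1]
  simp only [intervalIntegral.integral_of_le Real.two_pi_pos.le]
  simpa [Measure.real] using h2.hasSum

/-- The density is even in `m`, and the six pairs of quotients together emit `z^(12 m)`, which turns
`z^(-6m)` into `z^(6m)`. -/
lemma betaTerm_reflect {r : ℂ} (hr : r ≠ 0) {a : Fin 6 → ℂ} (ha : ∀ j, a j ≠ 0)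
    {n : Fin 6 → ℤ} (hn : ∑ j, n j = 0) (m : ℤ) {z : ℂ} (hz : z ≠ 0) :
    betaTerm r a n m z = (∏ j, a j ^ (2 * n j)) * betaTerm r a (-n) (-m) z := by
  have hq : (r ^ 2) ^ m ≠ 0 := zpow_ne_zero _ (pow_ne_zero _ hr)
  have hd : density r m z = density r (-m) z := by
    unfold density
    rw [zpow_neg]
    field_simp
    ring
  have hj : ∀ j, gQuot r (n j + m) (a j * z) * gQuot r (n j - m) (a j / z) =
      (a j ^ (2 * n j) * z ^ (2 * m) * ((-1 / r) ^ 2) ^ n j) *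
      (gQuot r ((-n) j + -m) (a j * z) * gQuot r ((-n) j - -m) (a j / z)) := by
    intro j
    have e0 : (-1 / r : ℂ) ≠ 0 := div_ne_zero (by norm_num) hr
    rw [gQuot_reflect hr (n j + m) (mul_ne_zero (ha j) hz),
      gQuot_reflect hr (n j - m) (div_ne_zero (ha j) hz)]
    have e1 : -(n j + m) = (-n) j + -m := by simp; ring
    have e2 : -(n j - m) = (-n) j - -m := by simp; ring
    have e3 : (-(a j * z) / r) ^ (n j + m) * (-(a j / z) / r) ^ (n j - m) =
        a j ^ (2 * n j) * z ^ (2 * m) * ((-1 / r) ^ 2) ^ n j := by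
      have f1 : -(a j * z) / r = (-1 / r) * (a j * z) := by ring
      have f2 : -(a j / z) / r = (-1 / r) * (a j * z⁻¹) := by ring
      have g1 : a j ^ (2 * n j) = a j ^ (n j + m) * a j ^ (n j - m) := by
        rw [← zpow_add₀ (ha j)]; congr 1; ring
      have g2 : z ^ (2 * m) = z ^ (n j + m) * z⁻¹ ^ (n j - m) := by
        rw [inv_zpow, ← zpow_neg, ← zpow_add₀ hz]; congr 1; ring
      have g3 : ((-1 / r) ^ 2) ^ n j = (-1 / r) ^ (n j + m) * (-1 / r) ^ (n j - m) := by
        rw [← zpow_add₀ e0, ← zpow_natCast, ← zpow_mul]; congr 1; push_cast; ring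
      rw [f1, f2, mul_zpow, mul_zpow, mul_zpow, mul_zpow, g1, g2, g3]
      ring
    rw [e1, e2, ← e3]; ring
  have he : ∏ j, ((-1 / r : ℂ) ^ 2) ^ n j = 1 := by
    have e0 : ((-1 / r) ^ 2 : ℂ) ≠ 0 := pow_ne_zero _ (div_ne_zero (by norm_num) hr)
    rw [Fin.prod_univ_six, ← zpow_add₀ e0, ← zpow_add₀ e0, ← zpow_add₀ e0, ← zpow_add₀ e0,
      ← zpow_add₀ e0, ← Fin.sum_univ_six, hn, zpow_zero]
  have hz12 : z ^ (-6 * m) * ∏ _j : Fin 6, z ^ (2 * m) = z ^ (-6 * -m) := by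
    rw [Finset.prod_const, Finset.card_univ, Fintype.card_fin, ← zpow_natCast, ← zpow_mul,
      ← zpow_add₀ hz]
    congr 1; push_cast; ring
  unfold betaTerm
  simp only [hj, Finset.prod_mul_distrib, he, hd, ← hz12]
  ring

lemma betaInt_reflect {r : ℂ} (hr : r ≠ 0) (hr1 : ‖r‖ < 1) {a : Fin 6 → ℂ} (ha : BetaDom r a)
    {n : Fin 6 → ℤ} (hn : ∑ j, n j = 0) :
    betaInt r a n = (∏ j, a j ^ (2 * n j)) * betaInt r a (-n) := by
  have h1 := hasSum_integral_sumMeas (integrable_betaTerm hr hr1 ha n)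
  have h2 := (hasSum_integral_sumMeas (integrable_betaTerm hr hr1 ha (-n))).mul_left
    (∏ j, a j ^ (2 * n j))
  refine h1.unique (((Equiv.neg ℤ).hasSum_iff.mpr h2).congr_fun fun m => ?_)
  simp only [Function.comp_apply, Equiv.neg_apply, ← intervalIntegral.integral_const_mul]
  refine intervalIntegral.integral_congr fun θ _ => ?_
  exact betaTerm_reflect hr ha.ne_zero hn m (circleMap_ne_center one_ne_zero)

/-- The function whose differences relate the integrand of the beta integral to its shift. -/
noncomputable def shiftAux (r : ℂ) (a : Fin 6 → ℂ) (n : Fin 6 → ℤ) (m : ℤ) (z : ℂ) : ℂ :=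
  (1 - (r ^ 2) ^ m / z ^ 2) / (r ^ 2) ^ m * z ^ (-6 * m) * ((r ^ m * z) ^ 2)⁻¹ *
    (gQuot r (n 0 + m + 1) (r * (a 0 * z)) * gQuot r (n 0 - m) (a 0 / z)) *
    (gQuot r (n 1 + m + 1) (r * (a 1 * z)) * gQuot r (n 1 - m) (a 1 / z)) *
    (gQuot r (n 2 + m + 1) (r * (a 2 * z)) * gQuot r (n 2 - m) (a 2 / z)) *
    (gQuot r (n 3 + m + 1) (r * (a 3 * z)) * gQuot r (n 3 - m) (a 3 / z)) *
    (gQuot r (n 4 + m + 1) (r * (a 4 * z)) * gQuot r (n 4 - m) (a 4 / z)) *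
    (gQuot r (n 5 + m) (a 5 * z) * gQuot r (n 5 - 1 - m) (a 5 / r / z))

/-- Both sides are symmetric in `u1, …, u4`. In terms of their elementary symmetric functions the
balancing condition only fixes the top one, and the remaining identity in `u0, p, w` and three free
symbols holds outright. -/
lemma shift_rational {u0 u1 u2 u3 u4 p w : ℂ} (h : u0 * u1 * u2 * u3 * u4 * p = 1) (hw : w ≠ 0)
    (h0 : u0 ≠ 0) (hp : p ≠ 0) :
    p⁻¹ * ((1 - p * u1) * (1 - p * u2) * (1 - p * u3) * (1 - p * u4)) *
          ((1 - w ^ 2) * ((1 - u0 * w) * (1 - u0 / w))) -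
        u0⁻¹ * ((1 - u0 * u1) * (1 - u0 * u2) * (1 - u0 * u3) * (1 - u0 * u4)) *
          ((1 - w ^ 2) * ((1 - p * w) * (1 - p / w))) =
      (u0 - p) * (w ^ 4 * ((1 - u0 / w) * (1 - u1 / w) * (1 - u2 / w) * (1 - u3 / w) *
          (1 - u4 / w) * (1 - p / w)) -
        (w ^ 2)⁻¹ * ((1 - u0 * w) * (1 - u1 * w) * (1 - u2 * w) * (1 - u3 * w) *
          (1 - u4 * w) * (1 - p * w))) := by
  obtain ⟨s1, hs1⟩ : ∃ s, s = u1 + u2 + u3 + u4 := ⟨_, rfl⟩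
  obtain ⟨s2, hs2⟩ : ∃ s, s = u1 * u2 + u1 * u3 + u1 * u4 + u2 * u3 + u2 * u4 + u3 * u4 := ⟨_, rfl⟩
  obtain ⟨s3, hs3⟩ : ∃ s, s = u1 * u2 * u3 + u1 * u2 * u4 + u1 * u3 * u4 + u2 * u3 * u4 := ⟨_, rfl⟩
  have hs4 : u1 * u2 * u3 * u4 = (u0 * p)⁻¹ := by field_simp; linear_combination h
  have e : ∀ x : ℂ, (1 - x * u1) * (1 - x * u2) * (1 - x * u3) * (1 - x * u4) =
      1 - s1 * x + s2 * x ^ 2 - s3 * x ^ 3 + (u0 * p)⁻¹ * x ^ 4 := fun x => by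
    rw [hs1, hs2, hs3, ← hs4]; ring
  rw [e p, e u0]
  have e1 := e w⁻¹
  have e2 := e w
  calc _ = (u0 - p) * (w ^ 4 * ((1 - u0 / w) * (1 - s1 * w⁻¹ + s2 * w⁻¹ ^ 2 - s3 * w⁻¹ ^ 3 +
          (u0 * p)⁻¹ * w⁻¹ ^ 4) * (1 - p / w)) -
        (w ^ 2)⁻¹ * ((1 - u0 * w) * (1 - s1 * w + s2 * w ^ 2 - s3 * w ^ 3 + (u0 * p)⁻¹ * w ^ 4) *
          (1 - p * w))) := by
        clear e e1 e2 hs1 hs2 hs3 hs4 h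
        field_simp
        ring
    _ = _ := by rw [← e1, ← e2]; ring

/-- With `w = r^m z` every factor split off by `gQuot_succ` is `1 - u_j w` or `1 - u_j / w`. The
move `(m, z) ↦ (m - 1, z / r)` divides `w` by `q` and fixes `r^(-m) z`. All four terms share the
same product of quotients, and what remains is `shift_rational`. -/
lemma betaTerm_shift {r : ℂ} (hr : r ≠ 0) (hr1 : ‖r‖ < 1) {a : Fin 6 → ℂ} (ha : BetaDom r a)
    (ha' : BetaDom r (shiftA r a)) {n : Fin 6 → ℤ} (hn : ∑ j, n j = 0) {u : Fin 6 → ℂ}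
    (hu : ∀ j, u j = r ^ n j * a j) (m : ℤ) {z : ℂ} (hz : ‖z‖ = 1) :
    (u 5 / r ^ 2)⁻¹ * ((1 - u 5 / r ^ 2 * u 1) * (1 - u 5 / r ^ 2 * u 2) *
        (1 - u 5 / r ^ 2 * u 3) * (1 - u 5 / r ^ 2 * u 4)) *
        betaTerm r (shiftA r a) (shiftN n) m z -
      (u 0)⁻¹ * ((1 - u 0 * u 1) * (1 - u 0 * u 2) * (1 - u 0 * u 3) * (1 - u 0 * u 4)) *
        betaTerm r a n m z =
      (u 0 - u 5 / r ^ 2) * (shiftAux r a n (m - 1) (z / r) - shiftAux r a n m z) := by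
  have hz0 : z ≠ 0 := norm_pos_iff.mp (by rw [hz]; exact one_pos)
  obtain ⟨p, hp⟩ : ∃ p, p = u 5 / r ^ 2 := ⟨_, rfl⟩
  obtain ⟨w, hw⟩ : ∃ w, w = r ^ m * z := ⟨_, rfl⟩
  have hrm := zpow_ne_zero m hr
  have hw0 : w ≠ 0 := by rw [hw]; exact mul_ne_zero hrm hz0
  have hu0 : ∀ j, u j ≠ 0 := fun j => by
    rw [hu]; exact mul_ne_zero (zpow_ne_zero _ hr) (ha.ne_zero j)
  have hp0 : p ≠ 0 := by rw [hp]; exact div_ne_zero (hu0 5) (pow_ne_zero 2 hr)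
  have hprod : u 0 * u 1 * u 2 * u 3 * u 4 * p = 1 := by
    have e : ∏ j, u j = r ^ 2 := by
      simp only [hu, Finset.prod_mul_distrib, ha.prod_eq]
      rw [Fin.prod_univ_six, ← zpow_add₀ hr, ← zpow_add₀ hr, ← zpow_add₀ hr, ← zpow_add₀ hr,
        ← zpow_add₀ hr, ← Fin.sum_univ_six, hn, zpow_zero, one_mul]
    rw [Fin.prod_univ_six] at e
    rw [hp]; field_simp; linear_combination e
  have hX : ∀ j, gQuot r (n j + m + 1) (r * (a j * z)) =
      (1 - u j * w) * gQuot r (n j + m) (a j * z) := fun j => by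
    rw [gQuot_succ hr hr1 _ (mul_ne_zero (ha.ne_zero j) hz0) (by simpa [hz] using ha.lt_one j), hu,
      hw, zpow_add₀ hr]
    congr 2; ring
  have hY : ∀ j, gQuot r (n j - m + 1) (r * (a j / z)) =
      (1 - u j / w) * gQuot r (n j - m) (a j / z) := fun j => by
    rw [gQuot_succ hr hr1 _ (div_ne_zero (ha.ne_zero j) hz0) (by simpa [hz] using ha.lt_one j), hu,
      hw, zpow_sub₀ hr]
    congr 2; field_simp
  have ha5 : ‖a 5 / r‖ < 1 := ha'.lt_one 5
  have ha50 : a 5 / r ≠ 0 := div_ne_zero (ha.ne_zero 5) hr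
  have hX5 : gQuot r (n 5 + m) (a 5 * z) = (1 - p * w) * gQuot r (n 5 - 1 + m) (a 5 / r * z) := by
    have := gQuot_succ hr hr1 (n 5 - 1 + m) (mul_ne_zero ha50 hz0)
      (by rw [norm_mul, hz, mul_one]; exact ha5)
    have e1 : n 5 - 1 + m + 1 = n 5 + m := by ring
    have e2 : r * (a 5 / r * z) = a 5 * z := by field_simp
    rw [e1, e2] at this
    rw [this, hp, hu, hw, zpow_add₀ hr, zpow_sub_one₀ hr]
    congr 2; field_simp
  have hY5 : gQuot r (n 5 - m) (a 5 / z) = (1 - p / w) * gQuot r (n 5 - 1 - m) (a 5 / r / z) := by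
    have := gQuot_succ hr hr1 (n 5 - 1 - m) (div_ne_zero ha50 hz0)
      (by rw [norm_div, hz, div_one]; exact ha5)
    have e1 : n 5 - 1 - m + 1 = n 5 - m := by ring
    have e2 : r * (a 5 / r / z) = a 5 / z := by field_simp
    rw [e1, e2] at this
    rw [this, hp, hu, hw, zpow_sub₀ hr, zpow_sub_one₀ hr]
    congr 2; field_simp
  -- The weight of the integrand is `M (1 - w²)`. The factor `1 - (r²)^m / z²` in `M` depends on
  -- `r^(-m) z` alone, so the move changes the weight of `shiftAux` only by a power of `w`.
  obtain ⟨M, hM⟩ : ∃ M, M = (1 - (r ^ 2) ^ m / z ^ 2) / (r ^ 2) ^ m * z ^ (-6 * m) := ⟨_, rfl⟩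
  have hd : density r m z * z ^ (-6 * m) = M * (1 - w ^ 2) := by
    have : w ^ 2 = (r ^ 2) ^ m * z ^ 2 := by
      rw [hw, mul_pow, ← zpow_natCast (r ^ m), ← zpow_natCast r 2, ← zpow_mul, ← zpow_mul,
        mul_comm m]
    rw [hM, this]; unfold density; ring
  have hmon : (1 - (r ^ 2) ^ (m - 1) / (z / r) ^ 2) / (r ^ 2) ^ (m - 1) * (z / r) ^ (-6 * (m - 1)) *
      ((r ^ (m - 1) * (z / r)) ^ 2)⁻¹ = M * w ^ 4 := by
    have e1 : (z / r) ^ (-6 * (m - 1)) = z ^ (-6 * m) * z ^ 6 * ((r ^ m) ^ 6 * (r ^ 6)⁻¹) := by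
      have : -6 * (m - 1) = -6 * m + 6 := by ring
      rw [this, zpow_add₀ (div_ne_zero hz0 hr), div_zpow, div_zpow,
        show (-6 * m) = m * (-6 : ℤ) by ring, zpow_mul r, zpow_neg (r ^ m)]
      norm_cast
      field_simp
    have e2 : (r ^ 2) ^ (m - 1) = (r ^ m) ^ 2 * (r ^ 2)⁻¹ := by
      rw [zpow_sub_one₀ (pow_ne_zero 2 hr), ← zpow_natCast r 2, ← zpow_mul, mul_comm _ m, zpow_mul]
      norm_cast
    have e3 : (r ^ 2) ^ m = (r ^ m) ^ 2 := by
      rw [← zpow_natCast r 2, ← zpow_mul, mul_comm _ m, zpow_mul]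
      norm_cast
    rw [hM, hw, e1, e2, e3, zpow_sub_one₀ hr]
    generalize r ^ m = R at *
    field_simp
  have hS : shiftAux r a n m z = M * (w ^ 2)⁻¹ *
      ((1 - u 0 * w) * (1 - u 1 * w) * (1 - u 2 * w) * (1 - u 3 * w) *
          (1 - u 4 * w) * (1 - p * w)) *
      (gQuot r (n 0 + m) (a 0 * z) * gQuot r (n 0 - m) (a 0 / z) *
        (gQuot r (n 1 + m) (a 1 * z) * gQuot r (n 1 - m) (a 1 / z)) *
        (gQuot r (n 2 + m) (a 2 * z) * gQuot r (n 2 - m) (a 2 / z)) *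
        (gQuot r (n 3 + m) (a 3 * z) * gQuot r (n 3 - m) (a 3 / z)) *
        (gQuot r (n 4 + m) (a 4 * z) * gQuot r (n 4 - m) (a 4 / z)) *
        (gQuot r (n 5 - 1 + m) (a 5 / r * z) * gQuot r (n 5 - 1 - m) (a 5 / r / z))) := by
    unfold shiftAux
    rw [hX 0, hX 1, hX 2, hX 3, hX 4, hX5, ← hM, ← hw]
    ring
  have hS' : shiftAux r a n (m - 1) (z / r) = M * w ^ 4 *
      ((1 - u 0 / w) * (1 - u 1 / w) * (1 - u 2 / w) * (1 - u 3 / w) *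
          (1 - u 4 / w) * (1 - p / w)) *
      (gQuot r (n 0 + m) (a 0 * z) * gQuot r (n 0 - m) (a 0 / z) *
        (gQuot r (n 1 + m) (a 1 * z) * gQuot r (n 1 - m) (a 1 / z)) *
        (gQuot r (n 2 + m) (a 2 * z) * gQuot r (n 2 - m) (a 2 / z)) *
        (gQuot r (n 3 + m) (a 3 * z) * gQuot r (n 3 - m) (a 3 / z)) *
        (gQuot r (n 4 + m) (a 4 * z) * gQuot r (n 4 - m) (a 4 / z)) *
        (gQuot r (n 5 - 1 + m) (a 5 / r * z) * gQuot r (n 5 - 1 - m) (a 5 / r / z))) := by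
    have i1 : ∀ j, n j + (m - 1) + 1 = n j + m := fun j => by ring
    have i2 : ∀ j, r * (a j * (z / r)) = a j * z := fun j => by field_simp
    have i3 : ∀ j, n j - (m - 1) = n j - m + 1 := fun j => by ring
    have i4 : ∀ j, a j / (z / r) = r * (a j / z) := fun j => by field_simp
    have i5 : n 5 + (m - 1) = n 5 - 1 + m := by ring
    have i6 : a 5 * (z / r) = a 5 / r * z := by ring
    have i7 : n 5 - 1 - (m - 1) = n 5 - m := by ring
    have i8 : a 5 / r / (z / r) = a 5 / z := by field_simp
    unfold shiftAux
    rw [hmon, i5, i6, i7, i8]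
    simp only [i1, i2, i3, i4]
    rw [hY 0, hY 1, hY 2, hY 3, hY 4, hY5]
    ring
  have hB : betaTerm r a n m z = M * ((1 - w ^ 2) * ((1 - p * w) * (1 - p / w))) *
      (gQuot r (n 0 + m) (a 0 * z) * gQuot r (n 0 - m) (a 0 / z) *
        (gQuot r (n 1 + m) (a 1 * z) * gQuot r (n 1 - m) (a 1 / z)) *
        (gQuot r (n 2 + m) (a 2 * z) * gQuot r (n 2 - m) (a 2 / z)) *
        (gQuot r (n 3 + m) (a 3 * z) * gQuot r (n 3 - m) (a 3 / z)) *
        (gQuot r (n 4 + m) (a 4 * z) * gQuot r (n 4 - m) (a 4 / z)) *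
        (gQuot r (n 5 - 1 + m) (a 5 / r * z) * gQuot r (n 5 - 1 - m) (a 5 / r / z))) := by
    unfold betaTerm
    rw [hd, Fin.prod_univ_six, hX5, hY5]
    ring
  have hB' : betaTerm r (shiftA r a) (shiftN n) m z =
      M * ((1 - w ^ 2) * ((1 - u 0 * w) * (1 - u 0 / w))) *
      (gQuot r (n 0 + m) (a 0 * z) * gQuot r (n 0 - m) (a 0 / z) *
        (gQuot r (n 1 + m) (a 1 * z) * gQuot r (n 1 - m) (a 1 / z)) *
        (gQuot r (n 2 + m) (a 2 * z) * gQuot r (n 2 - m) (a 2 / z)) *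
        (gQuot r (n 3 + m) (a 3 * z) * gQuot r (n 3 - m) (a 3 / z)) *
        (gQuot r (n 4 + m) (a 4 * z) * gQuot r (n 4 - m) (a 4 / z)) *
        (gQuot r (n 5 - 1 + m) (a 5 / r * z) * gQuot r (n 5 - 1 - m) (a 5 / r / z))) := by
    unfold betaTerm shiftA shiftN
    rw [hd, Fin.prod_univ_six]
    simp only [Matrix.cons_val]
    rw [add_right_comm (n 0) 1 m, mul_assoc r, hX 0, sub_eq_add_neg (n 0 + 1), add_right_comm (n 0),
      ← sub_eq_add_neg, mul_div_assoc r, hY 0]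
    ring
  rw [← hp, hS, hS', hB, hB']
  have key := shift_rational hprod hw0 (hu0 0) hp0
  linear_combination (M * (gQuot r (n 0 + m) (a 0 * z) * gQuot r (n 0 - m) (a 0 / z) *
        (gQuot r (n 1 + m) (a 1 * z) * gQuot r (n 1 - m) (a 1 / z)) *
        (gQuot r (n 2 + m) (a 2 * z) * gQuot r (n 2 - m) (a 2 / z)) *
        (gQuot r (n 3 + m) (a 3 * z) * gQuot r (n 3 - m) (a 3 / z)) *
        (gQuot r (n 4 + m) (a 4 * z) * gQuot r (n 4 - m) (a 4 / z)) *
        (gQuot r (n 5 - 1 + m) (a 5 / r * z) * gQuot r (n 5 - 1 - m) (a 5 / r / z)))) * key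

/-- A one-sided estimate: a single quotient varies geometrically for negative `m` and stays bounded
for positive `m`. It replaces the paired bound, because the two factors in `shiftAux` have different
moduli. -/
lemma exists_norm_gQuot_circle_le {r : ℂ} (hr : r ≠ 0) (hr1 : ‖r‖ < 1) (k : ℤ) {b : ℂ}
    (hb : b ≠ 0) (hb1 : ‖b‖ < 1) : ∃ C : ℝ, 0 < C ∧ ∀ (m : ℤ) (z : ℂ), ‖z‖ = 1 →
      ‖gQuot r (k + m) (b * z)‖ ≤ C * (‖r‖ / ‖b‖) ^ (-m).toNat := by
  have hr' := norm_pos_iff.mpr hr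
  have hb' := norm_pos_iff.mpr hb
  have hy : 0 < ‖b‖ / ‖r‖ := by positivity
  obtain ⟨C, hC, hCb⟩ := exists_norm_gQuot_le hr hr1 hb' hb1
  obtain ⟨K, hK1, hK2, hK3⟩ : ∃ K : ℝ, 1 ≤ K ∧ ‖b‖ / ‖r‖ ≤ K ∧ (‖b‖ / ‖r‖)⁻¹ ≤ K :=
    ⟨max 1 (max (‖b‖ / ‖r‖) (‖b‖ / ‖r‖)⁻¹), by simp, by simp, by simp⟩
  refine ⟨C * K ^ k.natAbs, by positivity, fun m z hz => ?_⟩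
  have e1 : ‖b * z‖ = ‖b‖ := by simp [hz]
  have h1 := hCb (k + m) (b * z) e1.ge (by
    rw [norm_mul, e1]
    exact mul_le_of_le_one_left (norm_nonneg _) (norm_zpow_abs_le_one hr1 _))
  rw [e1, gSize_eq] at h1
  refine h1.trans ?_
  rw [mul_assoc]
  refine mul_le_mul_of_nonneg_left ?_ hC.le
  have e : (‖r‖ / ‖b‖) ^ (-m).toNat = (‖b‖ / ‖r‖) ^ (min m 0) := by
    have : min m 0 = -((-m).toNat : ℤ) := by omega
    rw [this, zpow_neg, zpow_natCast, ← inv_pow, inv_div]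
  obtain ⟨d, hd⟩ : ∃ d : ℤ, min (k + m) 0 = d + min m 0 := ⟨_, by rw [← sub_eq_iff_eq_add]⟩
  rw [e, hd, zpow_add₀ hy.ne']
  refine mul_le_mul_of_nonneg_right ?_ (by positivity)
  refine (zpow_le_zpow_natAbs hy hK2 hK3 d).trans (pow_le_pow_right₀ hK1 ?_)
  omega

lemma exists_norm_gQuot_circle_le' {r : ℂ} (hr : r ≠ 0) (hr1 : ‖r‖ < 1) (k : ℤ) {b : ℂ}
    (hb : b ≠ 0) (hb1 : ‖b‖ < 1) : ∃ C : ℝ, 0 < C ∧ ∀ (m : ℤ) (z : ℂ), ‖z‖ = 1 →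
      ‖gQuot r (k - m) (b / z)‖ ≤ C * (‖r‖ / ‖b‖) ^ m.toNat := by
  obtain ⟨C, hC, h⟩ := exists_norm_gQuot_circle_le hr hr1 k hb hb1
  refine ⟨C, hC, fun m z hz => ?_⟩
  have := h (-m) z⁻¹ (by simp [hz])
  rwa [neg_neg, ← sub_eq_add_neg, ← div_eq_mul_inv] at this

lemma norm_shiftAux_weight_le {r : ℂ} (hr : r ≠ 0) (hr1 : ‖r‖ < 1) (m : ℤ) {z : ℂ}
    (hz : ‖z‖ = 1) : ‖(1 - (r ^ 2) ^ m / z ^ 2) / (r ^ 2) ^ m * z ^ (-6 * m) * ((r ^ m * z) ^ 2)⁻¹‖ ≤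
      2 * ((‖r‖ ^ 2) ^ (-m).toNat * ((‖r‖ ^ 4)⁻¹) ^ m.toNat) := by
  have hr' := norm_pos_iff.mpr hr
  rw [norm_mul, norm_mul, norm_zpow z, hz, one_zpow, mul_one, norm_inv, norm_pow, norm_mul,
    norm_zpow, hz, mul_one, norm_div, norm_zpow, norm_pow]
  have n1 : ‖1 - (r ^ 2) ^ m / z ^ 2‖ ≤ 1 + (‖r‖ ^ 2) ^ m := by
    refine (norm_sub_le _ _).trans ?_
    simp [hz]
  rcases le_or_gt 0 m with hm | hm
  · obtain ⟨k, rfl⟩ := Int.eq_ofNat_of_zero_le hm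
    have : (‖r‖ ^ 2) ^ k ≤ 1 := pow_le_one₀ (by positivity) (pow_le_one₀ hr'.le hr1.le)
    have t1 : (-(k : ℤ)).toNat = 0 := by omega
    simp only [zpow_natCast, t1, pow_zero, one_mul, Int.toNat_natCast] at *
    calc _ ≤ 2 / (‖r‖ ^ 2) ^ k * ((‖r‖ ^ k) ^ 2)⁻¹ := by gcongr; linarith
      _ = _ := by rw [inv_pow]; field_simp; ring
  · obtain ⟨k, rfl⟩ : ∃ k : ℕ, m = -(k : ℤ) := ⟨m.natAbs, by omega⟩
    have h1 : (‖r‖ ^ 2) ^ k ≤ 1 := pow_le_one₀ (by positivity) (pow_le_one₀ hr'.le hr1.le)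
    have t1 : (-(k : ℤ)).toNat = 0 := by omega
    simp only [zpow_neg, zpow_natCast, t1, pow_zero, mul_one, neg_neg, Int.toNat_natCast] at *
    calc _ ≤ (1 + ((‖r‖ ^ 2) ^ k)⁻¹) / ((‖r‖ ^ 2) ^ k)⁻¹ * (((‖r‖ ^ k)⁻¹) ^ 2)⁻¹ := by gcongr
      _ = ((‖r‖ ^ 2) ^ k + 1) * (‖r‖ ^ 2) ^ k := by field_simp; ring
      _ ≤ 2 * (‖r‖ ^ 2) ^ k := by gcongr; linarith

/-- Positive and negative `m` are tracked by separate exponents. In both directions the rates,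
multiplied by means of `∏ ‖a_j‖ = ‖r‖²`, leave exactly `‖r‖`. -/
lemma exists_norm_shiftAux_le {r : ℂ} (hr : r ≠ 0) (hr1 : ‖r‖ < 1) {a : Fin 6 → ℂ}
    (ha : BetaDom r a) (ha' : BetaDom r (shiftA r a)) (n : Fin 6 → ℤ) :
    ∃ C : ℝ, ∀ (m : ℤ) (z : ℂ), ‖z‖ = 1 → ‖shiftAux r a n m z‖ ≤ C * ‖r‖ ^ m.natAbs := by
  have hr' := norm_pos_iff.mpr hr
  have hp : ∀ j, 0 < ‖a j‖ := fun j => norm_pos_iff.mpr (ha.ne_zero j)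
  have hra : ∀ j, ‖r * a j‖ < 1 := fun j => by
    rw [norm_mul]
    exact mul_lt_one_of_nonneg_of_lt_one_left (norm_nonneg _) hr1 (ha.lt_one j).le
  have hU : ∀ j, ∃ C : ℝ, 0 < C ∧ ∀ (m : ℤ) (z : ℂ), ‖z‖ = 1 →
      ‖gQuot r (n j + m + 1) (r * (a j * z)) * gQuot r (n j - m) (a j / z)‖ ≤
        C * ((‖a j‖⁻¹) ^ (-m).toNat * (‖r‖ / ‖a j‖) ^ m.toNat) := by
    intro j
    obtain ⟨C, hC, h⟩ := exists_norm_gQuot_circle_le hr hr1 (n j + 1)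
      (mul_ne_zero hr (ha.ne_zero j)) (hra j)
    obtain ⟨D, hD, h'⟩ := exists_norm_gQuot_circle_le' hr hr1 (n j) (ha.ne_zero j) (ha.lt_one j)
    refine ⟨C * D, by positivity, fun m z hz => ?_⟩
    have h1 := h m z hz
    have h2 := h' m z hz
    have e : ‖r‖ / ‖r * a j‖ = ‖a j‖⁻¹ := by rw [norm_mul]; field_simp
    rw [e, add_right_comm, mul_assoc] at h1
    rw [norm_mul]
    calc _ ≤ _ := mul_le_mul h1 h2 (norm_nonneg _) ((norm_nonneg _).trans h1)
      _ = _ := by ring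
  obtain ⟨C0, hC0, h0⟩ := hU 0
  obtain ⟨C1, hC1, h1⟩ := hU 1
  obtain ⟨C2, hC2, h2⟩ := hU 2
  obtain ⟨C3, hC3, h3⟩ := hU 3
  obtain ⟨C4, hC4, h4⟩ := hU 4
  obtain ⟨C5, hC5, h5⟩ := exists_norm_gQuot_circle_le hr hr1 (n 5) (ha.ne_zero 5) (ha.lt_one 5)
  obtain ⟨C6, hC6, h6⟩ := exists_norm_gQuot_circle_le' hr hr1 (n 5 - 1)
    (div_ne_zero (ha.ne_zero 5) hr) (ha'.lt_one 5)
  have e5 : ‖r‖ / ‖a 5 / r‖ = ‖r‖ ^ 2 / ‖a 5‖ := by rw [norm_div]; field_simp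
  rw [e5] at h6
  have hpr : ‖a 0‖ * ‖a 1‖ * ‖a 2‖ * ‖a 3‖ * ‖a 4‖ * ‖a 5‖ = ‖r‖ ^ 2 := by
    rw [← Fin.prod_univ_six fun j => ‖a j‖, ← norm_prod, ha.prod_eq, norm_pow]
  refine ⟨2 * (C0 * C1 * C2 * C3 * C4 * C5 * C6), fun m z hz => ?_⟩
  unfold shiftAux
  simp only [norm_mul _ (gQuot r (n 5 + m) (a 5 * z) * _),
    norm_mul _ (gQuot r (n 0 + m + 1) (r * (a 0 * z)) * _),
    norm_mul _ (gQuot r (n 1 + m + 1) (r * (a 1 * z)) * _),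
    norm_mul _ (gQuot r (n 2 + m + 1) (r * (a 2 * z)) * _),
    norm_mul _ (gQuot r (n 3 + m + 1) (r * (a 3 * z)) * _),
    norm_mul _ (gQuot r (n 4 + m + 1) (r * (a 4 * z)) * _),
    norm_mul (gQuot r (n 5 + m) (a 5 * z))]
  set e := (-m).toNat with he
  set f := m.toNat with hf
  have hef : m.natAbs = e + f := by omega
  calc _ ≤ 2 * ((‖r‖ ^ 2) ^ e * ((‖r‖ ^ 4)⁻¹) ^ f) *
          (C0 * ((‖a 0‖⁻¹) ^ e * (‖r‖ / ‖a 0‖) ^ f)) * (C1 * ((‖a 1‖⁻¹) ^ e * (‖r‖ / ‖a 1‖) ^ f)) *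
          (C2 * ((‖a 2‖⁻¹) ^ e * (‖r‖ / ‖a 2‖) ^ f)) * (C3 * ((‖a 3‖⁻¹) ^ e * (‖r‖ / ‖a 3‖) ^ f)) *
          (C4 * ((‖a 4‖⁻¹) ^ e * (‖r‖ / ‖a 4‖) ^ f)) *
          ((C5 * (‖r‖ / ‖a 5‖) ^ e) * (C6 * (‖r‖ ^ 2 / ‖a 5‖) ^ f)) := by
        gcongr
        · exact norm_shiftAux_weight_le hr hr1 m hz
        · exact h0 m z hz
        · exact h1 m z hz
        · exact h2 m z hz
        · exact h3 m z hz
        · exact h4 m z hz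
        · exact h5 m z hz
        · exact h6 m z hz
    _ = 2 * (C0 * C1 * C2 * C3 * C4 * C5 * C6) *
        ((‖r‖ ^ 2 * ‖a 0‖⁻¹ * ‖a 1‖⁻¹ * ‖a 2‖⁻¹ * ‖a 3‖⁻¹ * ‖a 4‖⁻¹ * (‖r‖ / ‖a 5‖)) ^ e *
        ((‖r‖ ^ 4)⁻¹ * (‖r‖ / ‖a 0‖) * (‖r‖ / ‖a 1‖) * (‖r‖ / ‖a 2‖) * (‖r‖ / ‖a 3‖) *
          (‖r‖ / ‖a 4‖) * (‖r‖ ^ 2 / ‖a 5‖)) ^ f) := by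
        simp only [mul_pow]; ring
    _ = _ := by
        have q1 : ‖r‖ ^ 2 * ‖a 0‖⁻¹ * ‖a 1‖⁻¹ * ‖a 2‖⁻¹ * ‖a 3‖⁻¹ * ‖a 4‖⁻¹ * (‖r‖ / ‖a 5‖) =
            ‖r‖ := by
          have := hp 0; have := hp 1; have := hp 2; have := hp 3; have := hp 4; have := hp 5
          rw [← hpr]; field_simp
        have q2 : (‖r‖ ^ 4)⁻¹ * (‖r‖ / ‖a 0‖) * (‖r‖ / ‖a 1‖) * (‖r‖ / ‖a 2‖) * (‖r‖ / ‖a 3‖) *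
          (‖r‖ / ‖a 4‖) * (‖r‖ ^ 2 / ‖a 5‖) = ‖r‖ := by
          have := hp 0; have := hp 1; have := hp 2; have := hp 3; have := hp 4; have := hp 5
          field_simp; linear_combination -hpr
        rw [q1, q2, hef, pow_add]

/-- On this closed annulus no pole is met: the arguments `r a_j z` and `a_5 z` are bounded by
`‖a_j‖` and `‖a_5 / r‖`. The latter is below `1` because the shifted parameters lie in the domain
too. -/
lemma differentiableAt_shiftAux {r : ℂ} (hr : r ≠ 0) (hr1 : ‖r‖ < 1) {a : Fin 6 → ℂ}
    (ha : BetaDom r a) (ha' : BetaDom r (shiftA r a)) (n : Fin 6 → ℤ) (m : ℤ) {z : ℂ}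
    (h1 : 1 ≤ ‖z‖) (h2 : ‖z‖ ≤ ‖r‖⁻¹) : DifferentiableAt ℂ (shiftAux r a n m) z := by
  have hr' := norm_pos_iff.mpr hr
  have hz : z ≠ 0 := norm_pos_iff.mp (one_pos.trans_le h1)
  have hz2 := pow_ne_zero 2 hz
  have hrm := zpow_ne_zero m hr
  have hrz := pow_ne_zero 2 (mul_ne_zero hrm hz)
  have hq := zpow_ne_zero m (pow_ne_zero 2 hr)
  have ha5 : ‖a 5 / r‖ < 1 := ha'.lt_one 5
  have hX : ∀ j, DifferentiableAt ℂ (fun z => gQuot r (n j + m + 1) (r * (a j * z)) *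
      gQuot r (n j - m) (a j / z)) z := fun j => by
    refine DifferentiableAt.mul ?_ ?_
    · refine (differentiableAt_gQuot hr hr1 _ (mul_ne_zero hr (mul_ne_zero (ha.ne_zero j) hz))
        (norm_zpow_abs_mul_lt hr1 _ ?_)).comp z (f := fun z => r * (a j * z)) (by fun_prop)
      rw [norm_mul, norm_mul]
      calc ‖r‖ * (‖a j‖ * ‖z‖) ≤ ‖r‖ * (‖a j‖ * ‖r‖⁻¹) := by gcongr
        _ = ‖a j‖ := by field_simp
        _ < 1 := ha.lt_one j
    · refine (differentiableAt_gQuot hr hr1 _ (div_ne_zero (ha.ne_zero j) hz)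
        (norm_zpow_abs_mul_lt hr1 _ ?_)).comp z (f := fun z => a j / z) (by fun_prop (disch := assumption))
      rw [norm_div]
      exact (div_le_self (norm_nonneg _) h1).trans_lt (ha.lt_one j)
  unfold shiftAux
  refine DifferentiableAt.mul (DifferentiableAt.mul (DifferentiableAt.mul (DifferentiableAt.mul
    (DifferentiableAt.mul (DifferentiableAt.mul ?_ (hX 0)) (hX 1)) (hX 2)) (hX 3)) (hX 4))
    (DifferentiableAt.mul ?_ ?_)
  · refine DifferentiableAt.mul (DifferentiableAt.mul ?_ (differentiableAt_id.zpow (Or.inl hz))) ?_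
    · fun_prop (disch := assumption)
    · fun_prop (disch := assumption)
  · refine (differentiableAt_gQuot hr hr1 _ (mul_ne_zero (ha.ne_zero 5) hz)
        (norm_zpow_abs_mul_lt hr1 _ ?_)).comp z (f := fun z => a 5 * z) (by fun_prop)
    rw [norm_mul]
    calc ‖a 5‖ * ‖z‖ ≤ ‖a 5‖ * ‖r‖⁻¹ := by gcongr
      _ = ‖a 5 / r‖ := by rw [norm_div]; rfl
      _ < 1 := ha5
  · refine (differentiableAt_gQuot hr hr1 _ (div_ne_zero (div_ne_zero (ha.ne_zero 5) hr) hz)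
        (norm_zpow_abs_mul_lt hr1 _ ?_)).comp z (f := fun z => a 5 / r / z) (by fun_prop (disch := assumption))
    rw [norm_div]
    exact (div_le_self (norm_nonneg _) h1).trans_lt ha5

lemma integral_circle_div (r : ℂ) (f : ℂ → ℂ) :
    ∫ θ in (0 : ℝ)..(2 * Real.pi), f (circleMap 0 1 θ / r) =
      ∫ θ in (0 : ℝ)..(2 * Real.pi), f (circleMap 0 ‖r‖⁻¹ θ) := by
  have h : ∀ θ, circleMap 0 1 θ / r = circleMap 0 ‖r‖⁻¹ (θ - arg r) := fun θ => by
    simp only [circleMap, zero_add, ofReal_one, one_mul, ofReal_inv, ofReal_sub, sub_mul, exp_sub]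
    conv_lhs => rw [← norm_mul_exp_arg_mul_I r]
    field_simp
  simp only [h]
  rw [intervalIntegral.integral_comp_sub_right (fun θ => f (circleMap 0 ‖r‖⁻¹ θ)), zero_sub,
    sub_eq_neg_add]
  have := ((periodic_circleMap 0 ‖r‖⁻¹).comp f).intervalIntegral_add_eq (-arg r) 0
  simpa [Function.comp_def] using this

/-- Cauchy's theorem for `f(z) dz / z`, which is `i f dθ` on each circle. -/
lemma integral_circle_eq_of_annulus {R : ℝ} (hR : 1 ≤ R) {f : ℂ → ℂ}
    (hf : ∀ z : ℂ, 1 ≤ ‖z‖ → ‖z‖ ≤ R → DifferentiableAt ℂ f z) :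
    ∫ θ in (0 : ℝ)..(2 * Real.pi), f (circleMap 0 R θ) =
      ∫ θ in (0 : ℝ)..(2 * Real.pi), f (circleMap 0 1 θ) := by
  have h := circleIntegral_sub_center_inv_smul_eq_of_differentiable_on_annulus_off_countable
    (c := (0 : ℂ)) one_pos hR (f := f) Set.countable_empty
    (fun z hz => (hf z (by simpa using hz.2) (by simpa using hz.1)).continuousAt.continuousWithinAt)
    (fun z hz => hf z (by simpa using hz.1.2 : 1 < ‖z‖).le (by simpa using hz.1.1 : ‖z‖ < R).le)
  have e : ∀ S : ℝ, S ≠ 0 → (∮ z in C(0, S), (z - 0)⁻¹ • f z) =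
      I * ∫ θ in (0 : ℝ)..(2 * Real.pi), f (circleMap 0 S θ) := fun S hS => by
    rw [circleIntegral, ← intervalIntegral.integral_const_mul]
    refine intervalIntegral.integral_congr fun θ _ => ?_
    have : circleMap 0 S θ ≠ 0 := circleMap_ne_center hS
    simp only [deriv_circleMap, sub_zero, smul_eq_mul]
    field_simp
  rw [e R (by positivity), e 1 one_ne_zero] at h
  exact mul_left_cancel₀ I_ne_zero h

/-- Integrating `betaTerm_shift`: the integral at `z / r` runs over `|z| = 1/‖r‖` and moves back to
the unit circle, and reindexing `m - 1` then makes the two sums of `shiftAux` equal. -/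
lemma betaInt_shift {r : ℂ} (hr : r ≠ 0) (hr1 : ‖r‖ < 1) {a : Fin 6 → ℂ} (ha : BetaDom r a)
    (ha' : BetaDom r (shiftA r a)) {n : Fin 6 → ℤ} (hn : ∑ j, n j = 0) {u : Fin 6 → ℂ}
    (hu : ∀ j, u j = r ^ n j * a j) :
    (u 5 / r ^ 2)⁻¹ * ((1 - u 5 / r ^ 2 * u 1) * (1 - u 5 / r ^ 2 * u 2) *
        (1 - u 5 / r ^ 2 * u 3) * (1 - u 5 / r ^ 2 * u 4)) *
        betaInt r (shiftA r a) (shiftN n) =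
      (u 0)⁻¹ * ((1 - u 0 * u 1) * (1 - u 0 * u 2) * (1 - u 0 * u 3) * (1 - u 0 * u 4)) *
        betaInt r a n := by
  have hr' := norm_pos_iff.mpr hr
  obtain ⟨C, hC⟩ := exists_norm_shiftAux_le hr hr1 ha ha' n
  have hR : 1 ≤ ‖r‖⁻¹ := (one_le_inv₀ hr').mpr hr1.le
  have hc : ∀ m, Continuous fun θ => shiftAux r a n m (circleMap 0 1 θ) := fun m =>
    continuous_comp_circleMap (f := shiftAux r a n m) fun z hz => by
      rw [abs_one] at hz
      exact (differentiableAt_shiftAux hr hr1 ha ha' n m hz.ge (by rwa [hz])).continuousAt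
  have hc' : ∀ m, Continuous fun θ => shiftAux r a n m (circleMap 0 1 θ / r) := fun m =>
    continuous_comp_circleMap (f := fun z => shiftAux r a n m (z / r)) fun z hz => by
      rw [abs_one] at hz
      have hzr : ‖z / r‖ = ‖r‖⁻¹ := by rw [norm_div, hz, one_div]
      exact (differentiableAt_shiftAux hr hr1 ha ha' n m (by rwa [hzr]) hzr.le).continuousAt.comp
        (f := fun z => z / r) (continuous_id.div_const r).continuousAt
  have hint : Integrable (fun p : ℤ × ℝ => shiftAux r a n p.1 (circleMap 0 1 p.2)) sumMeas :=
    (integrable_pow_natAbs (norm_nonneg r) hr1 C).mono'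
      (measurable_int_prod fun m => (hc m).measurable).aestronglyMeasurable
      (.of_forall fun p => hC p.1 _ (by simp))
  have hS := hasSum_integral_sumMeas hint
  have hS' : HasSum (fun m : ℤ => ∫ θ in (0 : ℝ)..(2 * Real.pi),
      shiftAux r a n (m - 1) (circleMap 0 1 θ / r))
      (∫ p, shiftAux r a n p.1 (circleMap 0 1 p.2) ∂sumMeas) := by
    refine ((Equiv.subRight (1 : ℤ)).hasSum_iff.mpr hS).congr_fun fun m => ?_
    rw [integral_circle_div r, integral_circle_eq_of_annulus hR
      fun z h1 h2 => differentiableAt_shiftAux hr hr1 ha ha' n (m - 1) h1 h2]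
    rfl
  have hD := (hS'.sub hS).mul_left (u 0 - u 5 / r ^ 2)
  rw [sub_self, mul_zero] at hD
  have hi := (integrable_betaTerm hr hr1 ha n)
  have hi' := (integrable_betaTerm hr hr1 ha' (shiftN n))
  have hJ := ((hasSum_integral_sumMeas hi').mul_left ((u 5 / r ^ 2)⁻¹ *
    ((1 - u 5 / r ^ 2 * u 1) * (1 - u 5 / r ^ 2 * u 2) *
        (1 - u 5 / r ^ 2 * u 3) * (1 - u 5 / r ^ 2 * u 4)))).sub
    ((hasSum_integral_sumMeas hi).mul_left ((u 0)⁻¹ * ((1 - u 0 * u 1) * (1 - u 0 * u 2) *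
      (1 - u 0 * u 3) * (1 - u 0 * u 4))))
  refine sub_eq_zero.mp (hJ.unique (hD.congr_fun fun m => ?_))
  have ii : ∀ {f : ℝ → ℂ}, Continuous f → IntervalIntegrable f volume 0 (2 * Real.pi) :=
    fun hf => hf.intervalIntegrable _ _
  have k1 := continuous_betaTerm hr hr1 n ha.ne_zero ha.lt_one m
  have k2 := continuous_betaTerm hr hr1 (shiftN n) ha'.ne_zero ha'.lt_one m
  rw [← intervalIntegral.integral_sub (ii (hc' _)) (ii (hc m)),
    ← intervalIntegral.integral_const_mul, ← intervalIntegral.integral_const_mul,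
    ← intervalIntegral.integral_const_mul,
    ← intervalIntegral.integral_sub (ii (k2.const_mul _)) (ii (k1.const_mul _))]
  refine intervalIntegral.integral_congr fun θ _ => ?_
  exact betaTerm_shift hr hr1 ha ha' hn hu m (by simp)

/-! ### Independence of the ratio from one parameter -/

lemma isPreconnected_annulus {ρ : ℝ} (hρ : 0 < ρ) :
    IsPreconnected {b : ℂ | ρ < ‖b‖ ∧ ‖b‖ < 1} := by
  have h : {b : ℂ | ρ < ‖b‖ ∧ ‖b‖ < 1} = exp '' {x : ℂ | Real.log ρ < x.re ∧ x.re < 0} := by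
    ext b
    simp only [Set.mem_ofPred_eq, Set.mem_image]
    constructor
    · rintro ⟨h1, h2⟩
      have hb : b ≠ 0 := norm_pos_iff.mp (hρ.trans h1)
      refine ⟨log b, ⟨?_, ?_⟩, exp_log hb⟩
      · rw [log_re]; exact Real.log_lt_log hρ h1
      · rw [log_re]; exact Real.log_neg (hρ.trans h1) h2
    · rintro ⟨x, ⟨h1, h2⟩, rfl⟩
      rw [norm_exp]
      exact ⟨(Real.log_lt_iff_lt_exp hρ).mp h1, by simpa using h2⟩
  rw [h]
  exact ((convex_halfSpace_re_gt _).inter (convex_halfSpace_re_lt _)).isPreconnected.image _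
    continuous_exp.continuousOn

lemma isOpen_annulus (ρ : ℝ) : IsOpen {b : ℂ | ρ < ‖b‖ ∧ ‖b‖ < 1} :=
  (isOpen_lt continuous_const continuous_norm).inter (isOpen_lt continuous_norm continuous_const)

/-- A holomorphic function on an annulus whose modulus is invariant under multiplication by `r` is
constant, if the annulus is wide enough. -/
lemma eq_of_norm_eq_norm_mul {r : ℂ} (hr : r ≠ 0) (hr1 : ‖r‖ < 1) {ρ : ℝ} (h1 : ‖r‖ ^ 2 ≤ ρ)
    (h2 : ρ < ‖r‖) {h : ℂ → ℂ} (hd : DifferentiableOn ℂ h {b : ℂ | ρ < ‖b‖ ∧ ‖b‖ < 1})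
    (hm : ∀ b : ℂ, ρ < ‖r * b‖ → ‖b‖ < 1 → ‖h (r * b)‖ = ‖h b‖) :
    ∃ c, ∀ b : ℂ, ρ < ‖b‖ → ‖b‖ < 1 → h b = c := by
  have hr' := norm_pos_iff.mpr hr
  have hρ : 0 < ρ := lt_of_lt_of_le (by positivity) h1
  -- The ring `‖r‖σ ≤ ‖b‖ ≤ σ` is compact in the annulus because `ρ/‖r‖ < σ < 1`. Since also `‖r‖ <
  -- σ` and `‖r‖² ≤ ρ`, one multiplication or division by `r` brings every point of the annulus into
  -- it, so `‖h‖` attains a global maximum.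
  obtain ⟨σ, hσ1, hσ2⟩ := exists_between (max_lt ((div_lt_one hr').mpr h2) hr1)
  have hσ3 : ρ < ‖r‖ * σ := by
    have := (le_max_left _ _).trans_lt hσ1
    rwa [div_lt_iff₀' hr'] at this
  have hσ4 : ‖r‖ < σ := (le_max_right _ _).trans_lt hσ1
  have hσ0 : 0 < σ := hr'.trans hσ4
  set A := {b : ℂ | ρ < ‖b‖ ∧ ‖b‖ < 1}
  have hK : IsCompact {b : ℂ | ‖r‖ * σ ≤ ‖b‖ ∧ ‖b‖ ≤ σ} := by
    refine (isCompact_closedBall (0 : ℂ) σ).of_isClosed_subset ?_ fun b hb => by simpa using hb.2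
    exact (isClosed_le continuous_const continuous_norm).inter
      (isClosed_le continuous_norm continuous_const)
  have hKA : {b : ℂ | ‖r‖ * σ ≤ ‖b‖ ∧ ‖b‖ ≤ σ} ⊆ A := fun b hb =>
    ⟨hσ3.trans_le hb.1, hb.2.trans_lt hσ2⟩
  have hσn : ‖(σ : ℂ)‖ = σ := by rw [norm_real, Real.norm_eq_abs, abs_of_pos hσ0]
  obtain ⟨x, hx, hmax⟩ := hK.exists_isMaxOn
    ⟨(σ : ℂ), by rw [hσn]; exact mul_le_of_le_one_left hσ0.le hr1.le, hσn.le⟩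
    (hd.continuousOn.mono hKA).norm
  have hmaxA : IsMaxOn (norm ∘ h) A x := by
    intro b hb
    simp only [Set.mem_ofPred_eq, Function.comp_apply]
    rcases lt_or_ge σ ‖b‖ with hbσ | hbσ
    · have e : ‖r * b‖ = ‖r‖ * ‖b‖ := norm_mul _ _
      have h3 : ‖r‖ * σ ≤ ‖r * b‖ := by rw [e]; gcongr
      rw [← hm b (hσ3.trans_le h3) hb.2]
      refine hmax ⟨h3, ?_⟩
      rw [e]
      exact (mul_le_of_le_one_right hr'.le hb.2.le).trans hσ4.le
    rcases lt_or_ge ‖b‖ (‖r‖ * σ) with hbr | hbr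
    · have e : ‖b / r‖ = ‖b‖ / ‖r‖ := norm_div _ _
      have h3 : ‖b / r‖ < σ := by rw [e, div_lt_iff₀' hr']; exact hbr
      have h4 : ‖r‖ * σ ≤ ‖b / r‖ := by
        rw [e, le_div_iff₀' hr']
        calc ‖r‖ * (‖r‖ * σ) = ‖r‖ ^ 2 * σ := by ring
          _ ≤ ‖r‖ ^ 2 := mul_le_of_le_one_right (by positivity) hσ2.le
          _ ≤ ‖b‖ := h1.trans hb.1.le
      have h5 : r * (b / r) = b := by field_simp
      have := hm (b / r) (by rw [h5]; exact hb.1) (h3.trans hσ2)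
      rw [h5] at this
      rw [this]
      exact hmax ⟨h4, h3.le⟩
    · exact hmax ⟨hbr, hbσ⟩
  have := eqOn_of_isPreconnected_of_isMaxOn_norm (isPreconnected_annulus hρ) (isOpen_annulus ρ) hd
    (hKA hx) hmaxA
  exact ⟨h x, fun b hb1 hb2 => this ⟨hb1, hb2⟩⟩

/-- Under `b ↦ r b` the sum is invariant and the difference changes sign, so both have invariant
modulus and are constant; a constant that changes sign is zero. -/
lemma eq_of_eq_mul_eq_mul {r : ℂ} (hr : r ≠ 0) (hr1 : ‖r‖ < 1) {ρ : ℝ} (h1 : ‖r‖ ^ 2 ≤ ρ)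
    (h2 : ρ < ‖r‖) {f g : ℂ → ℂ} (hf : DifferentiableOn ℂ f {b : ℂ | ρ < ‖b‖ ∧ ‖b‖ < 1})
    (hg : DifferentiableOn ℂ g {b : ℂ | ρ < ‖b‖ ∧ ‖b‖ < 1})
    (hfg : ∀ b : ℂ, ρ < ‖r * b‖ → ‖b‖ < 1 → g (r * b) = f b)
    (hgf : ∀ b : ℂ, ρ < ‖r * b‖ → ‖b‖ < 1 → f (r * b) = g b) :
    ∃ c, ∀ b : ℂ, ρ < ‖b‖ → ‖b‖ < 1 → f b = c ∧ g b = c := by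
  have hr' := norm_pos_iff.mpr hr
  obtain ⟨c, hc⟩ := eq_of_norm_eq_norm_mul hr hr1 h1 h2 (hf.add hg) fun b hb1 hb2 => by
    rw [Pi.add_apply, Pi.add_apply, hfg b hb1 hb2, hgf b hb1 hb2, add_comm]
  obtain ⟨d, hd⟩ := eq_of_norm_eq_norm_mul hr hr1 h1 h2 (hf.sub hg) fun b hb1 hb2 => by
    rw [Pi.sub_apply, Pi.sub_apply, hfg b hb1 hb2, hgf b hb1 hb2, norm_sub_rev]
  have hd0 : d = 0 := by
    obtain ⟨σ, hσ1, hσ2⟩ := exists_between ((div_lt_one hr').mpr h2)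
    have hσ0 : 0 < σ := (div_nonneg ((by positivity : 0 ≤ ‖r‖ ^ 2).trans h1) hr'.le).trans_lt hσ1
    have hσn : ‖(σ : ℂ)‖ = σ := by rw [norm_real, Real.norm_eq_abs, abs_of_pos hσ0]
    have h3 : ρ < ‖r * σ‖ := by
      rw [norm_mul, hσn]; rwa [div_lt_iff₀' hr'] at hσ1
    have h4 : ‖r * σ‖ < ‖(σ : ℂ)‖ := by
      rw [norm_mul, hσn]; exact mul_lt_of_lt_one_left hσ0 hr1
    have h5 := hd σ (h3.trans h4) (by rwa [hσn])
    have h6 := hd (r * σ) h3 (h4.trans (by rwa [hσn]))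
    rw [Pi.sub_apply] at h5 h6
    rw [hfg _ h3 (by rwa [hσn]), hgf _ h3 (by rwa [hσn])] at h6
    linear_combination (-(h5 + h6)) / 2
  refine ⟨c / 2, fun b hb1 hb2 => ?_⟩
  have e1 := hc b hb1 hb2
  have e2 := hd b hb1 hb2
  rw [hd0] at e2
  simp only [Pi.add_apply, Pi.sub_apply] at e1 e2
  exact ⟨by linear_combination (e1 + e2) / 2, by linear_combination (e1 - e2) / 2⟩

/-- The quotient of the beta integral and its closed form. -/
noncomputable def betaRatio (r : ℂ) (a : Fin 6 → ℂ) (n : Fin 6 → ℤ) : ℂ :=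
  betaInt r a n / betaProd r a n

lemma betaRatio_shift {r : ℂ} (hr : r ≠ 0) (hr1 : ‖r‖ < 1) {a : Fin 6 → ℂ} (ha : BetaDom r a)
    (ha' : BetaDom r (shiftA r a)) {n : Fin 6 → ℤ} (hn : ∑ j, n j = 0) :
    betaRatio r (shiftA r a) (shiftN n) = betaRatio r a n := by
  obtain ⟨u, hu⟩ : ∃ u : Fin 6 → ℂ, ∀ j, u j = r ^ n j * a j := ⟨_, fun j => rfl⟩
  have h1 := betaInt_shift hr hr1 ha ha' hn hu
  have h2 := betaProd_shift hr hr1 ha ha' n hu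
  have hu0 : ∀ j, u j ≠ 0 := fun j => by
    rw [hu]; exact mul_ne_zero (zpow_ne_zero _ hr) (ha.ne_zero j)
  have hP := ha.betaProd_ne_zero hr hr1 n
  have hP' := ha'.betaProd_ne_zero hr hr1 (shiftN n)
  have hp0 : u 5 / r ^ 2 ≠ 0 := div_ne_zero (hu0 5) (pow_ne_zero 2 hr)
  have hU0 := hu0 0
  unfold betaRatio
  generalize betaProd r (shiftA r a) (shiftN n) = P' at *
  generalize betaProd r a n = P at *
  generalize betaInt r (shiftA r a) (shiftN n) = J' at *
  generalize betaInt r a n = J at *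
  -- By `gQuot_succ` this number is a factor of the nonzero quotient belonging to the pair `(j, 5)`.
  have hX : ∀ j, j ≠ 0 → j ≠ 5 → 1 - u 5 / r ^ 2 * u j ≠ 0 := by
    intro j hj0 hj5 h0
    have hne : a j * (a 5 / r) ≠ 0 :=
      mul_ne_zero (ha.ne_zero j) (div_ne_zero (ha.ne_zero 5) hr)
    have hs : shiftA r a j = a j := by
      fin_cases j <;> first | rfl | exact absurd rfl hj0 | exact absurd rfl hj5
    have hlt : ‖a j * (a 5 / r)‖ < 1 := by
      have := ha'.norm_mul_lt_one j 5
      rwa [hs] at this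
    have h3 := gQuot_succ hr hr1 (n j + (n 5 - 1)) hne hlt
    have e2 : r * (a j * (a 5 / r)) = a j * a 5 := by field_simp
    have e3 : 1 - r ^ (n j + (n 5 - 1)) * (a j * (a 5 / r)) = 0 := by
      rw [← h0, hu, hu, zpow_add₀ hr, zpow_sub_one₀ hr]
      field_simp
    rw [e2, e3, zero_mul] at h3
    exact ha.gQuot_ne_zero hr hr1 _ hj5 h3
  have x1 := hX 1 (by decide) (by decide)
  have x2 := hX 2 (by decide) (by decide)
  have x3 := hX 3 (by decide) (by decide)
  have x4 := hX 4 (by decide) (by decide)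
  generalize u 5 / r ^ 2 = p at *
  have hX' := mul_ne_zero (mul_ne_zero (mul_ne_zero x1 x2) x3) x4
  generalize (1 - p * u 1) * (1 - p * u 2) * (1 - p * u 3) * (1 - p * u 4) = X at *
  generalize (1 - u 0 * u 1) * (1 - u 0 * u 2) * (1 - u 0 * u 3) * (1 - u 0 * u 4) = Y at *
  rw [div_eq_div_iff hP' hP]
  have h1' : X * J' * u 0 = Y * J * p := by
    field_simp at h1
    linear_combination h1
  refine mul_right_cancel₀ (mul_ne_zero hX' hU0) ?_
  linear_combination P * h1' - J * h2

lemma betaRatio_reflect {r : ℂ} (hr : r ≠ 0) (hr1 : ‖r‖ < 1) {a : Fin 6 → ℂ} (ha : BetaDom r a)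
    {n : Fin 6 → ℤ} (hn : ∑ j, n j = 0) : betaRatio r a n = betaRatio r a (-n) := by
  unfold betaRatio
  rw [betaInt_reflect hr hr1 ha hn, betaProd_reflect hr ha.ne_zero hn]
  exact mul_div_mul_left _ _
    (Finset.prod_ne_zero_iff.mpr fun j _ => zpow_ne_zero _ (ha.ne_zero j))

lemma betaRatio_comp_swap (r : ℂ) (a : Fin 6 → ℂ) (n : Fin 6 → ℤ) {i : Fin 6} (hi : i ≠ 5) :
    betaRatio r (a ∘ Equiv.swap 0 i) (n ∘ Equiv.swap 0 i) = betaRatio r a n := by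
  unfold betaRatio
  rw [betaInt_comp_perm, betaProd_comp_swap r a n hi]

/-- The parameters with the first one replaced by `b`. -/
noncomputable def moveA (a : Fin 6 → ℂ) (b : ℂ) : Fin 6 → ℂ :=
  ![b, a 1, a 2, a 3, a 4, a 0 * a 5 / b]

/-- The discrete parameters with the first one replaced by `k`. -/
def moveN (n : Fin 6 → ℤ) (k : ℤ) : Fin 6 → ℤ := ![k, n 1, n 2, n 3, n 4, n 0 + n 5 - k]

lemma BetaDom.moveA {r : ℂ} {a : Fin 6 → ℂ} (ha : BetaDom r a) {b : ℂ} (h1 : ‖a 0 * a 5‖ < ‖b‖)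
    (h2 : ‖b‖ < 1) : BetaDom r (moveA a b) := by
  have hb' : 0 < ‖b‖ := (norm_nonneg _).trans_lt h1
  have hb : b ≠ 0 := norm_pos_iff.mp hb'
  refine ⟨fun j => ?_, fun j => ?_, ?_⟩
  · fin_cases j
    · exact hb
    · exact ha.ne_zero 1
    · exact ha.ne_zero 2
    · exact ha.ne_zero 3
    · exact ha.ne_zero 4
    · exact div_ne_zero (mul_ne_zero (ha.ne_zero 0) (ha.ne_zero 5)) hb
  · fin_cases j
    · exact h2
    · exact ha.lt_one 1
    · exact ha.lt_one 2
    · exact ha.lt_one 3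
    · exact ha.lt_one 4
    · change ‖a 0 * a 5 / b‖ < 1
      rw [norm_div]
      exact (div_lt_one hb').mpr h1
  · rw [← ha.prod_eq, Fin.prod_univ_six, Fin.prod_univ_six]
    simp only [QBailey.moveA, Matrix.cons_val]
    field_simp

lemma sum_moveN (n : Fin 6 → ℤ) (k : ℤ) : ∑ j, moveN n k j = ∑ j, n j := by
  simp only [moveN, Fin.sum_univ_six, Matrix.cons_val]; ring

lemma shiftA_moveA (r : ℂ) (a : Fin 6 → ℂ) (b : ℂ) :
    shiftA r (moveA a b) = moveA a (r * b) := by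
  funext j
  fin_cases j <;> simp [shiftA, moveA, div_div, mul_comm]

lemma shiftN_moveN (n : Fin 6 → ℤ) (k : ℤ) : shiftN (moveN n k) = moveN n (k + 1) := by
  funext j
  fin_cases j <;> simp [shiftN, moveN]
  ring

/-- For fixed `k`, the ratios at `k` and at `k + 1` are interchanged by `b ↦ r b`, hence are the
same constant. The assumption `h05` makes the annulus `‖a_0 a_5‖ < ‖b‖ < 1` wide enough for that
argument. -/
lemma betaRatio_moveA {r : ℂ} (hr : r ≠ 0) (hr1 : ‖r‖ < 1) {a : Fin 6 → ℂ} (ha : BetaDom r a)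
    (h05 : ‖a 0 * a 5‖ < ‖r‖) {n : Fin 6 → ℤ} (hn : ∑ j, n j = 0) {b : ℂ}
    (h1 : ‖a 0 * a 5‖ < ‖b‖) (h2 : ‖b‖ < 1) (k : ℤ) :
    betaRatio r (moveA a b) (moveN n k) = betaRatio r a n := by
  have hρ : ‖r‖ ^ 2 ≤ ‖a 0 * a 5‖ := by
    rw [← norm_pow]; exact (ha.lt_norm_mul (by decide)).le
  have hdom : ∀ b ∈ {b : ℂ | ‖a 0 * a 5‖ < ‖b‖ ∧ ‖b‖ < 1}, BetaDom r (moveA a b) :=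
    fun b hb => ha.moveA hb.1 hb.2
  have hne : ∀ b : ℂ, ‖a 0 * a 5‖ < ‖b‖ → b ≠ 0 := fun b hb =>
    norm_pos_iff.mp ((norm_nonneg _).trans_lt hb)
  have hd : ∀ k, DifferentiableOn ℂ (fun b => betaRatio r (moveA a b) (moveN n k))
      {b : ℂ | ‖a 0 * a 5‖ < ‖b‖ ∧ ‖b‖ < 1} := by
    intro k
    have hj : ∀ j, DifferentiableOn ℂ (fun b => moveA a b j)
        {b : ℂ | ‖a 0 * a 5‖ < ‖b‖ ∧ ‖b‖ < 1} := by
      intro j b hb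
      have := hne b hb.1
      fin_cases j
      · exact differentiableWithinAt_id
      · exact differentiableWithinAt_const _
      · exact differentiableWithinAt_const _
      · exact differentiableWithinAt_const _
      · exact differentiableWithinAt_const _
      · exact (differentiableWithinAt_const _).div differentiableWithinAt_id this
    exact (differentiableOn_betaInt hr hr1 _ (isOpen_annulus _) hdom hj).div
      (differentiableOn_betaProd hr hr1 _ hdom hj)
      fun b hb => (hdom b hb).betaProd_ne_zero hr hr1 _
  have hlt : ∀ b : ℂ, ‖a 0 * a 5‖ < ‖r * b‖ → ‖a 0 * a 5‖ < ‖b‖ := fun b hb =>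
    hb.trans_le (by rw [norm_mul]; exact mul_le_of_le_one_left (norm_nonneg _) hr1.le)
  have hlt' : ∀ b : ℂ, ‖b‖ < 1 → ‖r * b‖ < 1 := fun b hb => by
    rw [norm_mul]; exact mul_lt_one_of_nonneg_of_lt_one_left (norm_nonneg _) hr1 hb.le
  have hup : ∀ k (b : ℂ), ‖a 0 * a 5‖ < ‖r * b‖ → ‖b‖ < 1 →
      betaRatio r (moveA a (r * b)) (moveN n (k + 1)) = betaRatio r (moveA a b) (moveN n k) := by
    intro k b hb1 hb2
    have := betaRatio_shift hr hr1 (hdom b ⟨hlt b hb1, hb2⟩) (n := moveN n k)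
      (by rw [shiftA_moveA]; exact hdom _ ⟨hb1, hlt' b hb2⟩) (by rw [sum_moveN, hn])
    rwa [shiftA_moveA, shiftN_moveN] at this
  -- The shift raises the discrete parameter; conjugating it with `n ↦ -n` gives the one that lowers
  -- it.
  have hdown : ∀ k (b : ℂ), ‖a 0 * a 5‖ < ‖r * b‖ → ‖b‖ < 1 →
      betaRatio r (moveA a (r * b)) (moveN n k) = betaRatio r (moveA a b) (moveN n (k + 1)) := by
    intro k b hb1 hb2
    have hs : ∀ k, ∑ j, moveN n k j = 0 := fun k => by rw [sum_moveN, hn]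
    have hs' : ∀ k, ∑ j, (-moveN n k) j = 0 := fun k => by
      simp only [Pi.neg_apply, Finset.sum_neg_distrib, hs, neg_zero]
    have := betaRatio_shift hr hr1 (hdom b ⟨hlt b hb1, hb2⟩) (n := -moveN n (k + 1))
      (by rw [shiftA_moveA]; exact hdom _ ⟨hb1, hlt' b hb2⟩) (hs' _)
    have e : shiftN (-moveN n (k + 1)) = -moveN n k := by
      funext j
      fin_cases j <;> simp [shiftN, moveN]
      ring
    rwa [shiftA_moveA, e, ← betaRatio_reflect hr hr1 (hdom _ ⟨hb1, hlt' b hb2⟩) (hs k),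
      ← betaRatio_reflect hr hr1 (hdom b ⟨hlt b hb1, hb2⟩) (hs _)] at this
  have hconst : ∀ k, ∃ c, ∀ b : ℂ, ‖a 0 * a 5‖ < ‖b‖ → ‖b‖ < 1 →
      betaRatio r (moveA a b) (moveN n k) = c ∧ betaRatio r (moveA a b) (moveN n (k + 1)) = c :=
    fun k => eq_of_eq_mul_eq_mul hr hr1 hρ h05 (hd k) (hd (k + 1)) (hup k) (hdown k)
  have ha0 : ‖a 0 * a 5‖ < ‖a 0‖ := by
    rw [norm_mul]; exact mul_lt_of_lt_one_right (norm_pos_iff.mpr (ha.ne_zero 0)) (ha.lt_one 5)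
  have hstep : ∀ k (b b' : ℂ), ‖a 0 * a 5‖ < ‖b‖ → ‖b‖ < 1 → ‖a 0 * a 5‖ < ‖b'‖ → ‖b'‖ < 1 →
      betaRatio r (moveA a b) (moveN n k) = betaRatio r (moveA a b') (moveN n (k + 1)) := by
    intro k b b' hb1 hb2 hb1' hb2'
    obtain ⟨c, hc⟩ := hconst k
    rw [(hc b hb1 hb2).1, (hc b' hb1' hb2').2]
  have hself : betaRatio r (moveA a (a 0)) (moveN n (n 0)) = betaRatio r a n := by
    congr 1
    · funext j
      have := ha.ne_zero 0
      fin_cases j <;> simp [moveA]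
      field_simp
    · funext j
      fin_cases j <;> simp [moveN]
  have hall : ∀ k, betaRatio r (moveA a (a 0)) (moveN n k) = betaRatio r a n := by
    intro k
    induction k using Int.inductionOn' (b := n 0) with
    | zero => exact hself
    | succ k _ ih => rw [← ih]; exact (hstep k _ _ ha0 (ha.lt_one 0) ha0 (ha.lt_one 0)).symm
    | pred k _ ih =>
      rw [← ih, hstep (k - 1) _ _ ha0 (ha.lt_one 0) ha0 (ha.lt_one 0), sub_add_cancel]
  rw [hstep k b (a 0) h1 h2 ha0 (ha.lt_one 0)]
  exact hall _

/-! ### The constant: pinching the contour at `±i` -/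

/-- The Poisson kernel on the unit circle in the variable `-z²`. -/
noncomputable def poissonSq (ρ θ : ℝ) : ℝ := (1 - ρ ^ 2) / normSq (1 + ρ * circleMap 0 1 θ ^ 2)

lemma conj_circleMap_one (θ : ℝ) :
    (starRingEnd ℂ) (circleMap 0 1 θ) = (circleMap 0 1 θ)⁻¹ := by
  rw [inv_def, normSq_eq_norm_sq]; simp

lemma one_add_mul_ne_zero {ρ : ℝ} (h0 : 0 ≤ ρ) (h1 : ρ < 1) {w : ℂ} (hw : ‖w‖ ≤ 1) :
    1 + ρ * w ≠ 0 := by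
  intro h
  have h2 : ‖(ρ : ℂ) * w‖ = 1 := by
    rw [show (ρ : ℂ) * w = -1 by linear_combination h]; simp
  rw [norm_mul, norm_real, Real.norm_eq_abs, abs_of_nonneg h0] at h2
  nlinarith [norm_nonneg w]

lemma poissonSq_eq {ρ : ℝ} (h0 : 0 ≤ ρ) (h1 : ρ < 1) (θ : ℝ) :
    poissonSq ρ θ = 2 * ((1 + ρ * circleMap 0 1 θ ^ 2)⁻¹).re - 1 := by
  have hw : ‖circleMap 0 1 θ ^ 2‖ = 1 := by simp
  unfold poissonSq
  generalize circleMap 0 1 θ ^ 2 = w at *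
  have hne := one_add_mul_ne_zero h0 h1 hw.le
  have hn : normSq w = 1 := by rw [normSq_eq_norm_sq, hw]; norm_num
  have hne' : normSq (1 + ρ * w) ≠ 0 := by rwa [Ne, normSq_eq_zero]
  rw [inv_re, div_eq_iff hne', sub_mul, mul_div_assoc', div_mul_cancel₀ _ hne', one_mul]
  rw [normSq_apply] at hn
  simp [normSq_apply]
  linear_combination ρ ^ 2 * hn

lemma continuous_poissonSq {ρ : ℝ} (h0 : 0 ≤ ρ) (h1 : ρ < 1) : Continuous (poissonSq ρ) := by
  unfold poissonSq
  refine continuous_const.div (continuous_normSq.comp (by fun_prop)) fun θ => ?_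
  rw [Ne, normSq_eq_zero]
  exact one_add_mul_ne_zero h0 h1 (by simp)

lemma poissonSq_nonneg {ρ : ℝ} (h0 : 0 ≤ ρ) (h1 : ρ < 1) (θ : ℝ) : 0 ≤ poissonSq ρ θ :=
  div_nonneg (by nlinarith) (normSq_nonneg _)

/-- The kernel is `2 Re (1 + ρ z²)⁻¹ - 1`, and the mean value property gives `1` for the average of
`(1 + ρ z²)⁻¹`. -/
lemma integral_poissonSq {ρ : ℝ} (h0 : 0 ≤ ρ) (h1 : ρ < 1) :
    ∫ θ in (0 : ℝ)..(2 * Real.pi), poissonSq ρ θ = 2 * Real.pi := by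
  have hc : Continuous fun θ => (1 + ρ * circleMap 0 1 θ ^ 2)⁻¹ :=
    Continuous.inv₀ (by fun_prop) fun θ => one_add_mul_ne_zero h0 h1 (by simp)
  have hd : ∀ z : ℂ, ‖z‖ ≤ 1 → DifferentiableAt ℂ (fun z : ℂ => (1 + (ρ : ℂ) * z ^ 2)⁻¹) z := fun z hz =>
    DifferentiableAt.inv (by fun_prop) (one_add_mul_ne_zero h0 h1
      (by rw [norm_pow]; exact pow_le_one₀ (norm_nonneg _) hz))
  have h := circleIntegral_sub_center_inv_smul_of_differentiable_on_off_countable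
    (R := 1) one_pos (c := (0 : ℂ)) (f := fun z : ℂ => (1 + (ρ : ℂ) * z ^ 2)⁻¹) Set.countable_empty
    (fun z hz => (hd z (by simpa using hz)).continuousAt.continuousWithinAt)
    (fun z hz => hd z (by simpa using (Metric.mem_ball.mp hz.1).le))
  have e : (∮ z in C(0, 1), (z - 0)⁻¹ • (1 + ρ * z ^ 2)⁻¹) =
      I * ∫ θ in (0 : ℝ)..(2 * Real.pi), (1 + ρ * circleMap 0 1 θ ^ 2)⁻¹ := by
    rw [circleIntegral, ← intervalIntegral.integral_const_mul]
    refine intervalIntegral.integral_congr fun θ _ => ?_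
    have : circleMap 0 1 θ ≠ 0 := circleMap_ne_center one_ne_zero
    simp only [deriv_circleMap, sub_zero, smul_eq_mul]
    field_simp
  rw [e] at h
  have h2 : ∫ θ in (0 : ℝ)..(2 * Real.pi), (1 + ρ * circleMap 0 1 θ ^ 2)⁻¹ =
      ((2 * Real.pi : ℝ) : ℂ) := by
    refine mul_left_cancel₀ I_ne_zero (h.trans ?_)
    simp; ring
  have h3 : ∫ θ in (0 : ℝ)..(2 * Real.pi), ((1 + ρ * circleMap 0 1 θ ^ 2)⁻¹).re =
      2 * Real.pi := by
    have := reCLM.intervalIntegral_comp_comm (hc.intervalIntegrable (μ := volume) 0 (2 * Real.pi))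
    simp only [reCLM_apply] at this
    rw [this, h2, ofReal_re]
  simp only [poissonSq_eq h0 h1]
  rw [intervalIntegral.integral_sub, intervalIntegral.integral_const_mul, h3]
  · simp; ring
  · exact ((continuous_re.comp hc).const_mul 2).intervalIntegrable _ _
  · exact intervalIntegrable_const

/-- The denominator is `(1 - τ²)² + 4τ² cos² θ`. Thus `cos²`, which vanishes exactly at `z = ±i`,
cancels the concentration, and the bound tends to zero as `τ → 1`. -/
lemma poissonSq_mul_cos_le {τ : ℝ} (h0 : 0 < τ) (h1 : τ < 1) (θ : ℝ) :
    poissonSq (τ ^ 2) θ * Real.cos θ ^ 2 ≤ (1 - τ ^ 4) / (4 * τ ^ 2) := by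
  have hτ : τ ^ 4 ≤ 1 := pow_le_one₀ h0.le h1.le
  have e : normSq (1 + ((τ ^ 2 : ℝ) : ℂ) * circleMap 0 1 θ ^ 2) =
      (1 - τ ^ 2) ^ 2 + 4 * τ ^ 2 * Real.cos θ ^ 2 := by
    have : circleMap 0 1 θ = ⟨Real.cos θ, Real.sin θ⟩ := by
      apply Complex.ext <;> simp [circleMap, exp_ofReal_mul_I_re, exp_ofReal_mul_I_im]
    rw [this]
    simp only [normSq_apply, pow_two, add_re, one_re, mul_re, ofReal_re, ofReal_im, add_im, one_im,
      mul_im]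
    have hs := Real.sin_sq_add_cos_sq θ
    generalize Real.cos θ = c at *
    generalize Real.sin θ = s at *
    have hs2 : s ^ 2 = 1 - c ^ 2 := by linear_combination hs
    ring_nf
    rw [show s ^ 4 = (s ^ 2) ^ 2 by ring, hs2]
    ring
  unfold poissonSq
  have hτ2 : 0 < 1 - τ ^ 2 := by nlinarith
  rw [e, show (τ ^ 2) ^ 2 = τ ^ 4 by ring, div_mul_eq_mul_div,
    div_le_div_iff₀ (by positivity) (by positivity)]
  have : (1 - τ ^ 4) * (Real.cos θ ^ 2 * (4 * τ ^ 2)) ≤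
      (1 - τ ^ 4) * ((1 - τ ^ 2) ^ 2 + 4 * τ ^ 2 * Real.cos θ ^ 2) := by
    refine mul_le_mul_of_nonneg_left ?_ (by linarith)
    nlinarith [sq_nonneg (1 - τ ^ 2)]
  linarith

lemma tendsto_integral_poissonSq {δ : ℝ} (hδ0 : 0 < δ) (hδ1 : δ < 1) {F : ℝ → ℝ → ℂ} {A : ℂ}
    (hF : ContinuousOn (fun p : ℝ × ℝ => F p.1 p.2) (Set.Icc δ 1 ×ˢ Set.Icc 0 (2 * Real.pi)))
    (hA : ∀ θ, Real.cos θ = 0 → F 1 θ = A) :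
    Tendsto (fun τ => ∫ θ in (0 : ℝ)..(2 * Real.pi), (poissonSq (τ ^ 2) θ : ℂ) * F τ θ)
      (𝓝[<] 1) (𝓝 (2 * Real.pi * A)) := by
  have hK : IsCompact (Set.Icc δ 1 ×ˢ Set.Icc 0 (2 * Real.pi)) := isCompact_Icc.prod isCompact_Icc
  have hD : ContinuousOn (fun p : ℝ × ℝ => ‖F p.1 p.2 - A‖)
      (Set.Icc δ 1 ×ˢ Set.Icc 0 (2 * Real.pi)) := (hF.sub continuousOn_const).norm
  -- On the compact set where `‖F - A‖ ≥ ε` the function `cos² θ + (1 - τ)` has a positive minimum: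
  -- it vanishes only where `τ = 1` and `cos θ = 0`, and there `F = A`.
  have hbound : ∀ ε > 0, ∃ M : ℝ, 0 ≤ M ∧ ∀ τ ∈ Set.Icc δ 1, ∀ θ ∈ Set.Icc 0 (2 * Real.pi),
      ‖F τ θ - A‖ ≤ ε + M * (Real.cos θ ^ 2 + (1 - τ)) := by
    intro ε hε
    obtain ⟨B, hB⟩ := hK.exists_bound_of_continuousOn hD
    have hB0 : ∀ τ ∈ Set.Icc δ 1, ∀ θ ∈ Set.Icc 0 (2 * Real.pi), ‖F τ θ - A‖ ≤ B :=
      fun τ hτ θ hθ => by simpa using hB (τ, θ) ⟨hτ, hθ⟩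
    obtain ⟨t, ht, htc⟩ := (continuousOn_iff_isClosed.mp hD) (Set.Ici ε) isClosed_Ici
    have hSc : IsCompact ((fun p : ℝ × ℝ => ‖F p.1 p.2 - A‖) ⁻¹' Set.Ici ε ∩
        (Set.Icc δ 1 ×ˢ Set.Icc 0 (2 * Real.pi))) := by
      rw [htc]; exact hK.inter_left ht
    rcases Set.eq_empty_or_nonempty ((fun p : ℝ × ℝ => ‖F p.1 p.2 - A‖) ⁻¹' Set.Ici ε ∩
        (Set.Icc δ 1 ×ˢ Set.Icc 0 (2 * Real.pi))) with hS | hS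
    · refine ⟨0, le_rfl, fun τ hτ θ hθ => ?_⟩
      by_contra! h
      have : (τ, θ) ∈ (∅ : Set (ℝ × ℝ)) := hS ▸ ⟨by simpa using h.le, hτ, hθ⟩
      exact this
    · obtain ⟨x, hx, hmin⟩ := hSc.exists_isMinOn hS
        (f := fun p : ℝ × ℝ => Real.cos p.2 ^ 2 + (1 - p.1)) (by fun_prop)
      have hx1 : x.1 ≤ 1 := hx.2.1.2
      have hpos : 0 < Real.cos x.2 ^ 2 + (1 - x.1) := by
        rcases hx1.lt_or_eq with h | h
        · nlinarith [sq_nonneg (Real.cos x.2)]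
        · have : Real.cos x.2 ≠ 0 := fun hc => by
            have h2 : ε ≤ ‖F x.1 x.2 - A‖ := hx.1
            rw [h, hA _ hc, sub_self, norm_zero] at h2
            linarith
          rw [h]; positivity
      have hBε : 0 ≤ B := (norm_nonneg _).trans (hB x hx.2)
      refine ⟨B / (Real.cos x.2 ^ 2 + (1 - x.1)), by positivity, fun τ hτ θ hθ => ?_⟩
      have hnn : 0 ≤ Real.cos θ ^ 2 + (1 - τ) := by
        have := hτ.2
        nlinarith [sq_nonneg (Real.cos θ)]
      rcases lt_or_ge ‖F τ θ - A‖ ε with h | h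
      · have : 0 ≤ B / (Real.cos x.2 ^ 2 + (1 - x.1)) * (Real.cos θ ^ 2 + (1 - τ)) := by positivity
        linarith
      · have h3 : Real.cos x.2 ^ 2 + (1 - x.1) ≤ Real.cos θ ^ 2 + (1 - τ) :=
          hmin (a := (τ, θ)) ⟨h, hτ, hθ⟩
        have h4 : B ≤ B / (Real.cos x.2 ^ 2 + (1 - x.1)) * (Real.cos θ ^ 2 + (1 - τ)) := by
          rw [div_mul_eq_mul_div, le_div_iff₀ hpos]
          gcongr
        have := hB0 τ hτ θ hθ
        linarith
  have hest : ∀ ε > 0, ∀ M : ℝ, 0 ≤ M → (∀ τ ∈ Set.Icc δ 1, ∀ θ ∈ Set.Icc 0 (2 * Real.pi),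
      ‖F τ θ - A‖ ≤ ε + M * (Real.cos θ ^ 2 + (1 - τ))) → ∀ τ, δ < τ → τ < 1 →
      ‖(∫ θ in (0 : ℝ)..(2 * Real.pi), (poissonSq (τ ^ 2) θ : ℂ) * F τ θ) - 2 * Real.pi * A‖ ≤
        2 * Real.pi * ε + M * (2 * Real.pi * ((1 - τ ^ 4) / (4 * τ ^ 2) + (1 - τ))) := by
    intro ε hε M hM hb τ hτδ hτ1
    have hτ0 : 0 < τ := hδ0.trans hτδ
    have hρ0 : 0 ≤ τ ^ 2 := by positivity
    have hρ1 : τ ^ 2 < 1 := pow_lt_one₀ hτ0.le hτ1 two_ne_zero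
    have hPc := continuous_poissonSq hρ0 hρ1
    have hFc : ContinuousOn (F τ) (Set.Icc 0 (2 * Real.pi)) :=
      hF.comp (f := fun θ => (τ, θ)) (by fun_prop) fun θ hθ => ⟨⟨hτδ.le, hτ1.le⟩, hθ⟩
    have hu : Set.uIcc 0 (2 * Real.pi) = Set.Icc 0 (2 * Real.pi) :=
      Set.uIcc_of_le Real.two_pi_pos.le
    have hPi : IntervalIntegrable (fun θ => (poissonSq (τ ^ 2) θ : ℂ)) volume 0 (2 * Real.pi) :=
      (continuous_ofReal.comp hPc).intervalIntegrable _ _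
    have hPFi : IntervalIntegrable (fun θ => (poissonSq (τ ^ 2) θ : ℂ) * F τ θ) volume 0
        (2 * Real.pi) := by
      refine ContinuousOn.intervalIntegrable ?_
      rw [hu]
      exact (continuous_ofReal.comp hPc).continuousOn.mul hFc
    have e1 : 2 * Real.pi * A = ∫ θ in (0 : ℝ)..(2 * Real.pi), (poissonSq (τ ^ 2) θ : ℂ) * A := by
      rw [intervalIntegral.integral_mul_const, intervalIntegral.integral_ofReal,
        integral_poissonSq hρ0 hρ1]
      push_cast; ring
    rw [e1, ← intervalIntegral.integral_sub hPFi (hPi.mul_const A)]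
    refine (intervalIntegral.norm_integral_le_of_norm_le Real.two_pi_pos.le
      (g := fun θ => ε * poissonSq (τ ^ 2) θ + M * ((1 - τ ^ 4) / (4 * τ ^ 2)) +
        M * (1 - τ) * poissonSq (τ ^ 2) θ) (.of_forall fun θ hθ => ?_) ?_).trans (le_of_eq ?_)
    · rw [← mul_sub, norm_mul, norm_real, Real.norm_eq_abs,
        abs_of_nonneg (poissonSq_nonneg hρ0 hρ1 θ)]
      have h1 := hb τ ⟨hτδ.le, hτ1.le⟩ θ ⟨hθ.1.le, hθ.2⟩
      have h2 := poissonSq_mul_cos_le hτ0 hτ1 θ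
      have h3 := poissonSq_nonneg hρ0 hρ1 θ
      calc _ ≤ poissonSq (τ ^ 2) θ * (ε + M * (Real.cos θ ^ 2 + (1 - τ))) := by gcongr
        _ = ε * poissonSq (τ ^ 2) θ + M * (poissonSq (τ ^ 2) θ * Real.cos θ ^ 2) +
            M * (1 - τ) * poissonSq (τ ^ 2) θ := by ring
        _ ≤ _ := by gcongr
    · exact Continuous.intervalIntegrable (by fun_prop) _ _
    · have i1 : IntervalIntegrable (fun θ => ε * poissonSq (τ ^ 2) θ) volume 0 (2 * Real.pi) :=
        (hPc.const_mul _).intervalIntegrable _ _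
      have i2 : IntervalIntegrable (fun θ => M * (1 - τ) * poissonSq (τ ^ 2) θ) volume 0
        (2 * Real.pi) := (hPc.const_mul _).intervalIntegrable _ _
      rw [intervalIntegral.integral_add (i1.add intervalIntegrable_const) i2,
        intervalIntegral.integral_add i1 intervalIntegrable_const,
        intervalIntegral.integral_const]
      simp only [intervalIntegral.integral_const_mul, integral_poissonSq hρ0 hρ1, sub_zero,
        smul_eq_mul]
      ring
  rw [Metric.tendsto_nhds]
  intro ε hε
  obtain ⟨M, hM, hb⟩ := hbound (ε / (4 * Real.pi)) (by positivity)
  have hlim : Tendsto (fun τ : ℝ => M * (2 * Real.pi * ((1 - τ ^ 4) / (4 * τ ^ 2) + (1 - τ))))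
      (𝓝[<] 1) (𝓝 0) := by
    have : ContinuousAt (fun τ : ℝ => M * (2 * Real.pi * ((1 - τ ^ 4) / (4 * τ ^ 2) + (1 - τ)))) 1 := by
      fun_prop (disch := norm_num)
    have h2 := this.tendsto.mono_left (nhdsWithin_le_nhds (s := Set.Iio 1))
    simpa using h2
  filter_upwards [hlim.eventually (gt_mem_nhds (half_pos hε)), self_mem_nhdsWithin,
    mem_nhdsWithin_of_mem_nhds (Ioi_mem_nhds hδ1)] with τ h1 h2 h3
  rw [dist_eq_norm]
  have := hest _ (by positivity) M hM hb τ h3 h2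
  have e : 2 * Real.pi * (ε / (4 * Real.pi)) = ε / 2 := by field_simp; norm_num
  linarith

/-- The factor of `gQuot r 0 b` that is regular at `b = 1`. -/
noncomputable def hQuot (r b : ℂ) : ℂ := qPoch (r ^ 2 / b) (r ^ 2) / qPoch (r ^ 2 * b) (r ^ 2)

/-- Isolates the factor `1 - b` responsible for the blow-up as `τ → 1`. -/
lemma gQuot_zero {r : ℂ} (hr1 : ‖r‖ < 1) (b : ℂ) : gQuot r 0 b = hQuot r b / (1 - b) := by
  unfold gQuot gMon hQuot
  rw [if_pos le_rfl, abs_zero, zpow_zero, one_mul, one_mul, add_zero,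
    qPoch_eq_mul (norm_sq_lt_one hr1) b, div_div, mul_comm (1 - b), mul_comm b]
  norm_cast

lemma continuousAt_hQuot {r : ℂ} (hr1 : ‖r‖ < 1) {b : ℂ} (hb : b ≠ 0) (hb1 : ‖b‖ ≤ 1) :
    ContinuousAt (hQuot r) b := by
  have hq := norm_sq_lt_one hr1
  have hc := continuous_qPoch hq
  unfold hQuot
  refine ContinuousAt.div ?_ ?_ (qPoch_ne_zero_of_norm_lt hq ?_)
  · exact hc.continuousAt.comp (f := fun b => r ^ 2 / b) (by fun_prop (disch := assumption))
  · exact (hc.comp (by fun_prop : Continuous fun b => r ^ 2 * b)).continuousAt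
  · rw [norm_mul]
    exact (mul_le_of_le_one_right (norm_nonneg _) hb1).trans_lt hq

lemma hQuot_one {r : ℂ} (hr1 : ‖r‖ < 1) : hQuot r 1 = 1 := by
  have hq := norm_sq_lt_one hr1
  unfold hQuot
  rw [div_one, mul_one, div_self (qPoch_ne_zero_of_norm_lt hq hq)]

lemma hQuot_neg_one {r : ℂ} (hr1 : ‖r‖ < 1) : hQuot r (-1) = 1 := by
  have hq := norm_sq_lt_one hr1
  unfold hQuot
  rw [div_neg, div_one, mul_neg, mul_one, div_self (qPoch_ne_zero_of_norm_lt hq (by rwa [norm_neg]))]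

/-- Parameters for which the contour is pinched at `±i` as `τ → 1`. -/
noncomputable def pinchA (r : ℂ) (e τ : ℝ) : Fin 6 → ℂ :=
  ![I * τ, -I * τ, e, e, e, r ^ 2 / (τ ^ 2 * e ^ 3)]

/-- The size condition on the reference parameter of `pinchA`. -/
structure PinchParam (r : ℂ) (e : ℝ) : Prop where
  pos : 0 < e
  lt_one : e < 1
  norm_le : ‖r‖ ≤ e ^ 4

lemma PinchParam.norm_le_self {r : ℂ} {e : ℝ} (he : PinchParam r e) : ‖r‖ < e := by
  have := he.pos
  refine he.norm_le.trans_lt ?_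
  nlinarith [pow_lt_one₀ he.pos.le he.lt_one three_ne_zero]

lemma PinchParam.norm_sq_lt {r : ℂ} {e : ℝ} (he : PinchParam r e) {τ : ℝ} (h : e ≤ τ) :
    ‖r‖ ^ 2 < τ ^ 2 * e ^ 3 := by
  have h0 := he.pos
  have h1 := he.norm_le_self
  calc ‖r‖ ^ 2 = ‖r‖ * ‖r‖ := sq _
    _ ≤ ‖r‖ * e ^ 4 := by gcongr; exact he.norm_le
    _ < e * e ^ 4 := by gcongr
    _ = e ^ 2 * e ^ 3 := by ring
    _ ≤ _ := by gcongr

lemma norm_pinchA {r : ℂ} {e τ : ℝ} (he : 0 ≤ e) (hτ : 0 ≤ τ) (j : Fin 6) :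
    ‖pinchA r e τ j‖ = ![τ, τ, e, e, e, ‖r‖ ^ 2 / (τ ^ 2 * e ^ 3)] j := by
  fin_cases j <;> simp [pinchA, abs_of_nonneg, he, hτ]

lemma betaDom_pinchA {r : ℂ} (hr : r ≠ 0) {e τ : ℝ} (he : PinchParam r e) (h : e ≤ τ)
    (hτ : τ < 1) : BetaDom r (pinchA r e τ) := by
  have he0 := he.pos
  have hτ0 : 0 < τ := he0.trans_le h
  have hlt := he.norm_sq_lt h
  have hr' := norm_pos_iff.mpr hr
  refine ⟨fun j => norm_pos_iff.mp ?_, fun j => ?_, ?_⟩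
  · rw [norm_pinchA he0.le hτ0.le]
    fin_cases j <;> simp <;> positivity
  · rw [norm_pinchA he0.le hτ0.le]
    fin_cases j <;> simp [he.lt_one, hτ]
    rwa [div_lt_one (by positivity)]
  · have h1 : (τ : ℂ) ≠ 0 := by exact_mod_cast hτ0.ne'
    have h2 : (e : ℂ) ≠ 0 := by exact_mod_cast he0.ne'
    simp only [pinchA, Fin.prod_univ_six, Matrix.cons_val]
    field_simp
    rw [I_sq]; ring

lemma le_norm_pinchA {r : ℂ} {e τ : ℝ} (he : PinchParam r e) (h : e ≤ τ)
    (hτ : τ ≤ 1) (j : Fin 6) : ‖r‖ ^ 2 ≤ ‖pinchA r e τ j‖ := by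
  have he0 := he.pos
  have hτ0 : 0 < τ := he0.trans_le h
  have h1 : ‖r‖ ^ 2 ≤ e := by nlinarith [he.norm_le_self, he.lt_one, norm_nonneg r]
  rw [norm_pinchA he0.le hτ0.le]
  have h5 : ‖r‖ ^ 2 ≤ ‖r‖ ^ 2 / (τ ^ 2 * e ^ 3) := by
    refine le_div_self (by positivity) (by positivity) ?_
    exact mul_le_one₀ (pow_le_one₀ hτ0.le hτ) (by positivity) (pow_le_one₀ he0.le he.lt_one.le)
  fin_cases j <;> simp [h1, h1.trans h, h5]

lemma norm_zpow_abs_le {r : ℂ} (hr1 : ‖r‖ < 1) {m : ℤ} (hm : m ≠ 0) : ‖r ^ |m|‖ ≤ ‖r‖ := by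
  obtain ⟨n, hn⟩ := Int.eq_ofNat_of_zero_le (abs_nonneg m)
  have hn0 : n ≠ 0 := fun h => hm (abs_eq_zero.mp (by rw [hn, h]; rfl))
  rw [hn]
  simpa using pow_le_of_le_one (norm_nonneg r) hr1.le hn0

/-- Only the term `m = 0` of the beta integral is unbounded as the contour is pinched. -/
lemma exists_norm_betaInt_pinchA_sub_le {r : ℂ} (hr : r ≠ 0) (hr1 : ‖r‖ < 1) {e : ℝ}
    (he : PinchParam r e) : ∃ C : ℝ, ∀ τ : ℝ, e ≤ τ → τ < 1 →
      ‖betaInt r (pinchA r e τ) 0 - ∫ θ in (0 : ℝ)..(2 * Real.pi),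
        betaTerm r (pinchA r e τ) 0 0 (circleMap 0 1 θ)‖ ≤ C := by
  have hr' := norm_pos_iff.mpr hr
  -- With `n = 0` and `m ≠ 0` every parameter is multiplied by `r^|m|`, so `ρ₁ = ‖r‖` is admissible
  -- uniformly in `τ`; `ρ₀ = ‖r‖²` is the bound of `le_norm_pinchA`.
  obtain ⟨C, hC, hb⟩ := exists_norm_betaTerm_le hr hr1 0 (ρ₀ := ‖r‖ ^ 2) (by positivity) hr1
  have hs := summable_pow_natAbs (x := ‖r‖ ^ 2) (by positivity)
    (pow_lt_one₀ hr'.le hr1 two_ne_zero)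
  refine ⟨∑' m : ℤ, C * |2 * Real.pi - 0| * (‖r‖ ^ 2) ^ m.natAbs, fun τ h1 h2 => ?_⟩
  have hd := betaDom_pinchA hr he h1 h2
  have h := hasSum_ite_sub_hasSum (hasSum_integral_sumMeas (integrable_betaTerm hr hr1 hd 0)) 0
  refine h.norm_le_of_bounded (hs.mul_left (C * |2 * Real.pi - 0|)).hasSum fun m => ?_
  split_ifs with hm
  · rw [norm_zero]; positivity
  · refine (intervalIntegral.norm_integral_le_of_norm_le_const
      (C := C * (‖r‖ ^ 2) ^ m.natAbs) fun θ _ => ?_).trans (le_of_eq (by ring))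
    have hz : ∀ k : ℤ, |k| = |m| → ∀ j, ‖r ^ |k| * pinchA r e τ j‖ ≤ ‖r‖ := fun k hk j => by
      rw [norm_mul, hk]
      exact (mul_le_of_le_one_right (norm_nonneg _) (hd.lt_one j).le).trans (norm_zpow_abs_le hr1 hm)
    exact hb _ m _ (by simp) (le_norm_pinchA he h1 h2.le) (fun j => (hd.lt_one j).le) hd.prod_eq
      (fun j => hz _ (by simp) j) fun j => hz _ (by simp) j

/-- The regular part of the integrand of the pinched beta integral. -/
noncomputable def pinchF (r : ℂ) (e τ θ : ℝ) : ℂ :=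
  (1 - circleMap 0 1 θ ^ 2) * (1 - 1 / circleMap 0 1 θ ^ 2) / (1 + τ ^ 2) *
    (hQuot r (I * τ * circleMap 0 1 θ) * hQuot r (I * τ / circleMap 0 1 θ) *
      (hQuot r (-I * τ * circleMap 0 1 θ) * hQuot r (-I * τ / circleMap 0 1 θ))) *
    ((gQuot r 0 (e * circleMap 0 1 θ) * gQuot r 0 (e / circleMap 0 1 θ)) ^ 3 *
      (gQuot r 0 (r ^ 2 / (τ ^ 2 * e ^ 3) * circleMap 0 1 θ) *
        gQuot r 0 (r ^ 2 / (τ ^ 2 * e ^ 3) / circleMap 0 1 θ)))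

lemma ofReal_normSq_one_add (ρ θ : ℝ) :
    (normSq (1 + ρ * circleMap 0 1 θ ^ 2) : ℂ) =
      (1 + ρ * circleMap 0 1 θ ^ 2) * (1 + ρ / circleMap 0 1 θ ^ 2) := by
  rw [← mul_conj]
  simp [conj_circleMap_one, div_eq_mul_inv]

/-- The four singular factors `1 ∓ iτ z` and `1 ∓ iτ / z` multiply to `|1 + τ² z²|²`, the
denominator of the Poisson kernel. Its numerator `1 - τ⁴` explains the factor `1 + τ²` in `pinchF`.
-/
lemma betaTerm_pinchA {r : ℂ} (hr1 : ‖r‖ < 1) {e τ : ℝ} (h0 : 0 < τ) (h1 : τ < 1) (θ : ℝ) :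
    (1 - (τ : ℂ) ^ 2) * betaTerm r (pinchA r e τ) 0 0 (circleMap 0 1 θ) =
      poissonSq (τ ^ 2) θ * pinchF r e τ θ := by
  have hz : circleMap 0 1 θ ≠ 0 := circleMap_ne_center one_ne_zero
  have hn : ∀ w : ℂ, ‖w‖ < 1 → 1 - w ≠ 0 := fun w hw h => by
    rw [← sub_eq_zero.mp h, norm_one] at hw; exact lt_irrefl _ hw
  have hτn : ‖I * (τ : ℂ)‖ < 1 := by simpa [abs_of_pos h0] using h1
  have w1 := hn (I * τ * circleMap 0 1 θ) (by simpa using hτn)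
  have w2 := hn (I * τ / circleMap 0 1 θ) (by simpa using hτn)
  have w3 := hn (-I * τ * circleMap 0 1 θ) (by simpa using hτn)
  have w4 := hn (-I * τ / circleMap 0 1 θ) (by simpa using hτn)
  have hτ2 : (1 + (τ : ℂ) ^ 2) ≠ 0 := by
    have : (0 : ℝ) < 1 + τ ^ 2 := by positivity
    exact_mod_cast this.ne'
  have e1 : (1 + ((τ ^ 2 : ℝ) : ℂ) * circleMap 0 1 θ ^ 2) =
      (1 - I * τ * circleMap 0 1 θ) * (1 - -I * τ * circleMap 0 1 θ) := by
    push_cast; linear_combination ((τ : ℂ) ^ 2 * circleMap 0 1 θ ^ 2) * I_sq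
  have e2 : (1 + ((τ ^ 2 : ℝ) : ℂ) / circleMap 0 1 θ ^ 2) =
      (1 - I * τ / circleMap 0 1 θ) * (1 - -I * τ / circleMap 0 1 θ) := by
    push_cast; linear_combination ((τ : ℂ) ^ 2 / circleMap 0 1 θ ^ 2) * I_sq
  have e3 : ((poissonSq (τ ^ 2) θ : ℝ) : ℂ) = (1 - (τ : ℂ) ^ 2) * (1 + (τ : ℂ) ^ 2) /
      ((1 - I * τ * circleMap 0 1 θ) * (1 - -I * τ * circleMap 0 1 θ) *
        ((1 - I * τ / circleMap 0 1 θ) * (1 - -I * τ / circleMap 0 1 θ))) := by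
    rw [poissonSq, ofReal_div, ofReal_normSq_one_add, e1, e2]
    congr 1
    push_cast; ring
  rw [e3]
  unfold betaTerm pinchF density
  simp only [pinchA, Fin.prod_univ_six, Matrix.cons_val, Pi.zero_apply, add_zero, sub_zero,
    zpow_zero, mul_zero, mul_one, one_mul, div_one]
  rw [gQuot_zero hr1 (I * τ * circleMap 0 1 θ), gQuot_zero hr1 (I * τ / circleMap 0 1 θ),
    gQuot_zero hr1 (-I * τ * circleMap 0 1 θ), gQuot_zero hr1 (-I * τ / circleMap 0 1 θ)]
  generalize hQuot r (I * τ * circleMap 0 1 θ) = H1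
  generalize hQuot r (I * τ / circleMap 0 1 θ) = H2
  generalize hQuot r (-I * τ * circleMap 0 1 θ) = H3
  generalize hQuot r (-I * τ / circleMap 0 1 θ) = H4
  generalize (1 - I * τ * circleMap 0 1 θ) = W1 at *
  generalize (1 - I * τ / circleMap 0 1 θ) = W2 at *
  generalize (1 - -I * τ * circleMap 0 1 θ) = W3 at *
  generalize (1 - -I * τ / circleMap 0 1 θ) = W4 at *
  generalize gQuot r 0 (e * circleMap 0 1 θ) = G1
  generalize gQuot r 0 (e / circleMap 0 1 θ) = G2
  generalize gQuot r 0 _ = G3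
  generalize gQuot r 0 _ = G4
  generalize 1 - circleMap 0 1 θ ^ 2 = X
  generalize 1 - 1 / circleMap 0 1 θ ^ 2 = Y
  generalize 1 - (τ : ℂ) ^ 2 = D
  generalize 1 + (τ : ℂ) ^ 2 = S at *
  calc _ = S * S⁻¹ * (D * (X * Y * (H1 / W1 * (H2 / W2) * (H3 / W3 * (H4 / W4)) * (G1 * G2) *
        (G1 * G2) * (G1 * G2) * (G3 * G4)))) := by rw [mul_inv_cancel₀ hτ2, one_mul]
    _ = _ := by ring

lemma continuousOn_pinchF {r : ℂ} (hr : r ≠ 0) (hr1 : ‖r‖ < 1) {e : ℝ} (he : PinchParam r e) :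
    ContinuousOn (fun p : ℝ × ℝ => pinchF r e p.1 p.2)
      (Set.Icc e 1 ×ˢ Set.Icc 0 (2 * Real.pi)) := by
  rintro ⟨τ, θ⟩ ⟨⟨h1, h2⟩, -⟩
  have he0 := he.pos
  have hτ0 : 0 < τ := he0.trans_le h1
  have hz : ‖circleMap 0 1 θ‖ = 1 := by simp
  have hz0 : circleMap 0 1 θ ≠ 0 := circleMap_ne_center one_ne_zero
  have hτc : (τ : ℂ) ≠ 0 := by exact_mod_cast hτ0.ne'
  have hec : (e : ℂ) ≠ 0 := by exact_mod_cast he0.ne'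
  have hτn : ‖(τ : ℂ)‖ ≤ 1 := by simpa [abs_of_pos hτ0] using h2
  have hen : ‖(e : ℂ)‖ < 1 := by simpa [abs_of_pos he0] using he.lt_one
  have hz2 : circleMap 0 1 θ ^ 2 ≠ 0 := pow_ne_zero 2 hz0
  have hr5 : ‖r ^ 2 / ((τ : ℂ) ^ 2 * e ^ 3)‖ < 1 := by
    have := he.norm_sq_lt h1
    rw [norm_div, norm_mul, norm_pow, norm_pow, norm_pow, norm_real, norm_real,
      Real.norm_of_nonneg hτ0.le, Real.norm_of_nonneg he0.le, div_lt_one (by positivity)]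
    exact this
  have hτe : (τ : ℂ) ^ 2 * e ^ 3 ≠ 0 := by positivity
  have hτ2 : (1 + (τ : ℂ) ^ 2) ≠ 0 := by
    have : (0 : ℝ) < 1 + τ ^ 2 := by positivity
    exact_mod_cast this.ne'
  have hcz : ContinuousAt (fun p : ℝ × ℝ => circleMap 0 1 p.2) (τ, θ) := by fun_prop
  have hcτ : ContinuousAt (fun p : ℝ × ℝ => (p.1 : ℂ)) (τ, θ) := by fun_prop
  have hc5 : ContinuousAt (fun p : ℝ × ℝ => r ^ 2 / ((p.1 : ℂ) ^ 2 * e ^ 3)) (τ, θ) := by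
    fun_prop (disch := assumption)
  have hH : ∀ f : ℝ × ℝ → ℂ, ContinuousAt f (τ, θ) → f (τ, θ) ≠ 0 → ‖f (τ, θ)‖ ≤ 1 →
      ContinuousAt (fun p => hQuot r (f p)) (τ, θ) := fun f hf h0 hn =>
    (continuousAt_hQuot hr1 h0 hn).comp hf
  have hG : ∀ f : ℝ × ℝ → ℂ, ContinuousAt f (τ, θ) → f (τ, θ) ≠ 0 → ‖f (τ, θ)‖ < 1 →
      ContinuousAt (fun p => gQuot r 0 (f p)) (τ, θ) := fun f hf h0 hn =>
    (differentiableAt_gQuot hr hr1 0 h0 (by simpa using hn)).continuousAt.comp hf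
  have hIτ : I * (τ : ℂ) ≠ 0 := mul_ne_zero I_ne_zero hτc
  have hIτ' : -I * (τ : ℂ) ≠ 0 := mul_ne_zero (neg_ne_zero.mpr I_ne_zero) hτc
  have hr50 : r ^ 2 / ((τ : ℂ) ^ 2 * e ^ 3) ≠ 0 := div_ne_zero (pow_ne_zero 2 hr) hτe
  have d1 : ContinuousAt (fun p : ℝ × ℝ => (1 - circleMap 0 1 p.2 ^ 2) *
      (1 - 1 / circleMap 0 1 p.2 ^ 2) / (1 + (p.1 : ℂ) ^ 2)) (τ, θ) :=
    ContinuousAt.div ((continuousAt_const.sub (hcz.pow 2)).mul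
      (continuousAt_const.sub (continuousAt_const.div (hcz.pow 2) hz2)))
      (continuousAt_const.add (hcτ.pow 2)) hτ2
  have c1 := hH (fun p => I * p.1 * circleMap 0 1 p.2) ((continuousAt_const.mul hcτ).mul hcz)
    (mul_ne_zero hIτ hz0) (by simpa using hτn)
  have c2 := hH (fun p => I * p.1 / circleMap 0 1 p.2) ((continuousAt_const.mul hcτ).div hcz hz0)
    (div_ne_zero hIτ hz0) (by simpa using hτn)
  have c3 := hH (fun p => -I * p.1 * circleMap 0 1 p.2) ((continuousAt_const.mul hcτ).mul hcz)
    (mul_ne_zero hIτ' hz0) (by simpa using hτn)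
  have c4 := hH (fun p => -I * p.1 / circleMap 0 1 p.2) ((continuousAt_const.mul hcτ).div hcz hz0)
    (div_ne_zero hIτ' hz0) (by simpa using hτn)
  have g1 := hG (fun p => e * circleMap 0 1 p.2) (continuousAt_const.mul hcz)
    (mul_ne_zero hec hz0) (by simpa [hz] using hen)
  have g2 := hG (fun p => e / circleMap 0 1 p.2) (continuousAt_const.div hcz hz0)
    (div_ne_zero hec hz0) (by simpa [hz] using hen)
  have g3 := hG (fun p => r ^ 2 / ((p.1 : ℂ) ^ 2 * e ^ 3) * circleMap 0 1 p.2) (hc5.mul hcz)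
    (mul_ne_zero hr50 hz0) (by simpa only [norm_mul, hz, mul_one] using hr5)
  have g4 := hG (fun p => r ^ 2 / ((p.1 : ℂ) ^ 2 * e ^ 3) / circleMap 0 1 p.2) (hc5.div hcz hz0)
    (div_ne_zero hr50 hz0) (by rw [norm_div, hz, div_one]; exact hr5)
  exact ((d1.fun_mul ((c1.fun_mul c2).fun_mul (c3.fun_mul c4))).fun_mul
    (((g1.fun_mul g2).fun_pow 3).fun_mul (g3.fun_mul g4))).continuousWithinAt

/-- The common factor of the pinched beta integral and of its closed form. -/
noncomputable def pinchLim (r : ℂ) (e : ℝ) (τ : ℂ) : ℂ :=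
  (gQuot r 0 (I * τ * e) * gQuot r 0 (-I * τ * e)) ^ 3 *
    (gQuot r 0 (I * τ * (r ^ 2 / (τ ^ 2 * e ^ 3))) * gQuot r 0 (-I * τ * (r ^ 2 / (τ ^ 2 * e ^ 3))))

/-- At `z = ±i` the density part is `2 · 2 / 2`, the `hQuot` factors are taken at `±1` and equal
`1`, and the remaining quotients are only permuted by `z ↦ -z`. -/
lemma pinchF_one {r : ℂ} (hr1 : ‖r‖ < 1) {e θ : ℝ} (h : Real.cos θ = 0) :
    pinchF r e 1 θ = 2 * pinchLim r e 1 := by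
  have hz : circleMap 0 1 θ = I ∨ circleMap 0 1 θ = -I := by
    have hs : Real.sin θ = 1 ∨ Real.sin θ = -1 := by
      rw [← sq_eq_one_iff]; nlinarith [Real.sin_sq_add_cos_sq θ]
    have e1 : circleMap 0 1 θ = ⟨Real.cos θ, Real.sin θ⟩ := by
      apply Complex.ext <;> simp [circleMap, exp_ofReal_mul_I_re, exp_ofReal_mul_I_im]
    rw [e1]
    rcases hs with hs | hs
    · left; apply Complex.ext <;> simp [h, hs]
    · right; apply Complex.ext <;> simp [h, hs]
  have hH := hQuot_one hr1
  have hH' := hQuot_neg_one hr1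
  unfold pinchF pinchLim
  rcases hz with hz | hz <;> rw [hz]
  · simp only [ofReal_one, mul_one, I_sq, I_mul_I, neg_mul, div_self I_ne_zero, neg_neg,
      neg_div, hH, hH', one_pow, one_mul, div_I]
    rw [mul_comm (e : ℂ) I, mul_comm _ I]
    norm_num
  · simp only [ofReal_one, mul_one, neg_sq, I_sq, I_mul_I, neg_mul, mul_neg, div_self I_ne_zero,
      neg_neg, neg_div, div_neg, hH, hH', one_pow, one_mul, div_I]
    rw [mul_comm (e : ℂ) I, mul_comm _ I]
    norm_num
    ring

/-- The only singular pair is `(0, 1)`, with `a_0 a_1 = τ²`. The pairs joining `{0, 1}` to the other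
four slots form `pinchLim`. -/
lemma betaProd_pinchA {r : ℂ} (hr1 : ‖r‖ < 1) {e τ : ℝ} (he : 0 < e) (h0 : 0 < τ) (h1 : τ < 1) :
    (1 - (τ : ℂ) ^ 2) * betaProd r (pinchA r e τ) 0 =
      hQuot r ((τ : ℂ) ^ 2) * pinchLim r e τ *
        (gQuot r 0 ((e : ℂ) ^ 2) * gQuot r 0 (r ^ 2 / ((τ : ℂ) ^ 2 * e ^ 2))) ^ 3 := by
  have hτ : (1 - (τ : ℂ) ^ 2) ≠ 0 := by
    have : (0 : ℝ) < 1 - τ ^ 2 := by nlinarith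
    exact_mod_cast this.ne'
  have hec : (e : ℂ) ≠ 0 := by exact_mod_cast he.ne'
  have e1 : I * (τ : ℂ) * (-I * τ) = (τ : ℂ) ^ 2 := by linear_combination -(τ : ℂ) ^ 2 * I_sq
  have e2 : (e : ℂ) * (r ^ 2 / ((τ : ℂ) ^ 2 * e ^ 3)) = r ^ 2 / ((τ : ℂ) ^ 2 * e ^ 2) := by
    rcases eq_or_ne (τ : ℂ) 0 with h | h
    · simp [h]
    · field_simp
  unfold betaProd pinchLim
  simp only [pinchA, Fin.prod_univ_six, Matrix.cons_val, Pi.zero_apply, add_zero, neg_zero,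
    zpow_zero, mul_one, one_mul, e1, e2]
  rw [gQuot_zero hr1 ((τ : ℂ) ^ 2), ← sq (e : ℂ)]
  field_simp

lemma continuousAt_pinchLim {r : ℂ} (hr : r ≠ 0) (hr1 : ‖r‖ < 1) {e : ℝ} (he : PinchParam r e) :
    ContinuousAt (fun τ : ℝ => pinchLim r e τ) 1 ∧ pinchLim r e 1 ≠ 0 := by
  have he0 := he.pos
  have hr' := norm_pos_iff.mpr hr
  have hec : (e : ℂ) ≠ 0 := by exact_mod_cast he0.ne'
  have hen : ‖(e : ℂ)‖ = e := by simp [abs_of_pos he0]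
  have hlt := he.norm_sq_lt he.lt_one.le
  have h5 : ‖r ^ 2 / ((1 : ℂ) ^ 2 * e ^ 3)‖ = ‖r‖ ^ 2 / e ^ 3 := by simp [abs_of_pos he0]
  have h51 : ‖r‖ ^ 2 / e ^ 3 < 1 := by
    rw [div_lt_one (by positivity)]; simpa using hlt
  have h52 : ‖r‖ ^ 2 < ‖r‖ ^ 2 / e ^ 3 := by
    rw [lt_div_iff₀ (by positivity)]
    exact mul_lt_of_lt_one_right (by positivity) (pow_lt_one₀ he0.le he.lt_one three_ne_zero)
  have he2 : ‖r‖ ^ 2 < e := by nlinarith [he.norm_le_self, he.lt_one, norm_nonneg r]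
  have hI1 : ∀ w : ℂ, ‖I * 1 * w‖ = ‖w‖ := by simp
  have hI2 : ∀ w : ℂ, ‖-I * 1 * w‖ = ‖w‖ := by simp
  have hw5 : r ^ 2 / ((1 : ℂ) ^ 2 * e ^ 3) ≠ 0 := by
    rw [← norm_pos_iff, h5]; positivity
  constructor
  · have hG : ∀ f : ℝ → ℂ, ContinuousAt f 1 → f 1 ≠ 0 → ‖f 1‖ < 1 →
        ContinuousAt (fun p => gQuot r 0 (f p)) 1 := fun f hf h0 hn =>
      (differentiableAt_gQuot hr hr1 0 h0 (by simpa using hn)).continuousAt.comp hf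
    have hc : ContinuousAt (fun τ : ℝ => (τ : ℂ)) 1 := by fun_prop
    have hc5 : ContinuousAt (fun τ : ℝ => r ^ 2 / ((τ : ℂ) ^ 2 * e ^ 3)) 1 := by
      refine ContinuousAt.div (by fun_prop) (by fun_prop) ?_
      simpa using hec
    unfold pinchLim
    refine (((hG _ ?_ ?_ ?_).fun_mul (hG _ ?_ ?_ ?_)).fun_pow 3).fun_mul
      ((hG _ ?_ ?_ ?_).fun_mul (hG _ ?_ ?_ ?_))
    · exact (continuousAt_const.fun_mul hc).fun_mul continuousAt_const
    · simpa using hec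
    · simpa [abs_of_pos he0] using he.lt_one
    · exact (continuousAt_const.fun_mul hc).fun_mul continuousAt_const
    · simpa using hec
    · simpa [abs_of_pos he0] using he.lt_one
    · exact (continuousAt_const.fun_mul hc).fun_mul hc5
    · rw [← norm_pos_iff, ofReal_one, hI1, h5]; positivity
    · rw [ofReal_one, hI1, h5]; exact h51
    · exact (continuousAt_const.fun_mul hc).fun_mul hc5
    · rw [← norm_pos_iff, ofReal_one, hI2, h5]; positivity
    · rw [ofReal_one, hI2, h5]; exact h51
  · have hG : ∀ w : ℂ, ‖r‖ ^ 2 < ‖w‖ → ‖w‖ < 1 → gQuot r 0 w ≠ 0 := fun w h1 h2 =>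
      gQuot_ne_zero hr hr1 0 (by rwa [norm_pow]) h2
    unfold pinchLim
    refine mul_ne_zero (pow_ne_zero _ (mul_ne_zero (hG _ ?_ ?_) (hG _ ?_ ?_)))
      (mul_ne_zero (hG _ ?_ ?_) (hG _ ?_ ?_))
    all_goals simp only [hI1, hI2, h5, hen, h51, h52, he2, he.lt_one]

lemma tendsto_betaRatio_pinchA {r : ℂ} (hr : r ≠ 0) (hr1 : ‖r‖ < 1) {e : ℝ}
    (he : PinchParam r e) :
    Tendsto (fun τ : ℝ => betaRatio r (pinchA r e τ) 0) (𝓝[<] 1) (𝓝 (4 * Real.pi)) := by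
  have he0 := he.pos
  have hec : (e : ℂ) ≠ 0 := by exact_mod_cast he0.ne'
  obtain ⟨hLc, hL0⟩ := continuousAt_pinchLim hr hr1 he
  have hT := tendsto_integral_poissonSq he0 he.lt_one (continuousOn_pinchF hr hr1 he)
    fun θ hθ => pinchF_one hr1 hθ
  obtain ⟨C, hC⟩ := exists_norm_betaInt_pinchA_sub_le hr hr1 he
  have hev : ∀ᶠ τ : ℝ in 𝓝[<] 1, e ≤ τ ∧ τ < 1 := by
    filter_upwards [self_mem_nhdsWithin,
      mem_nhdsWithin_of_mem_nhds (Ioi_mem_nhds he.lt_one)] with τ h1 h2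
    exact ⟨le_of_lt h2, h1⟩
  have hsub : Tendsto (fun τ : ℝ => 1 - (τ : ℂ) ^ 2) (𝓝[<] 1) (𝓝 0) := by
    have : ContinuousAt (fun τ : ℝ => 1 - (τ : ℂ) ^ 2) 1 := by fun_prop
    simpa using this.tendsto.mono_left (nhdsWithin_le_nhds (s := Set.Iio 1))
  have h1 : Tendsto (fun τ : ℝ => (1 - (τ : ℂ) ^ 2) * betaInt r (pinchA r e τ) 0) (𝓝[<] 1)
      -- The terms `m ≠ 0` are bounded, so the factor `1 - τ²` kills them; the term `m = 0` is the
      -- Poisson integral of `pinchF`.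
      (𝓝 (2 * Real.pi * (2 * pinchLim r e 1))) := by
    have h2 : Tendsto (fun τ : ℝ => (1 - (τ : ℂ) ^ 2) * (betaInt r (pinchA r e τ) 0 -
        ∫ θ in (0 : ℝ)..(2 * Real.pi), betaTerm r (pinchA r e τ) 0 0 (circleMap 0 1 θ)))
        (𝓝[<] 1) (𝓝 0) := by
      refine hsub.zero_mul_isBoundedUnder_le (isBoundedUnder_of_eventually_le (a := C) ?_)
      filter_upwards [hev] with τ hτ using hC τ hτ.1 hτ.2
    rw [← zero_add (2 * Real.pi * (2 * pinchLim r e 1) : ℂ)]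
    refine (h2.add hT).congr' ?_
    filter_upwards [hev] with τ hτ
    simp only [← betaTerm_pinchA hr1 (he0.trans_le hτ.1) hτ.2]
    rw [intervalIntegral.integral_const_mul]
    ring
  have h2 : Tendsto (fun τ : ℝ => (1 - (τ : ℂ) ^ 2) * betaProd r (pinchA r e τ) 0) (𝓝[<] 1)
      (𝓝 (pinchLim r e 1)) := by
    have hre : ‖r ^ 2‖ < e ^ 2 := by
      rw [norm_pow]; exact pow_lt_pow_left₀ he.norm_le_self (norm_nonneg _) two_ne_zero
    have he2 : ‖(e : ℂ) ^ 2‖ = e ^ 2 := by simp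
    have he21 : e ^ 2 < 1 := pow_lt_one₀ he0.le he.lt_one two_ne_zero
    -- At `τ = 1` the two arguments multiply to `q`, so the inversion formula with index `0` makes
    -- the remaining six quotients cancel.
    have hG : gQuot r 0 ((e : ℂ) ^ 2) * gQuot r 0 (r ^ 2 / ((1 : ℂ) ^ 2 * e ^ 2)) = 1 := by
      have := gQuot_mul_gQuot_div hr hr1 0 (a := (e : ℂ) ^ 2) (by rwa [he2]) (by rwa [he2])
      simpa using this
    have hcG : ContinuousAt (fun τ : ℝ => gQuot r 0 (r ^ 2 / ((τ : ℂ) ^ 2 * e ^ 2))) 1 := by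
      have hn : (((1 : ℝ) : ℂ)) ^ 2 * (e : ℂ) ^ 2 ≠ 0 := by simpa using hec
      refine (differentiableAt_gQuot hr hr1 0 (div_ne_zero (pow_ne_zero 2 hr) hn) ?_).continuousAt.comp
        (f := fun τ : ℝ => r ^ 2 / ((τ : ℂ) ^ 2 * e ^ 2)) ?_
      · rw [abs_zero, zpow_zero, one_mul, norm_div, ofReal_one, one_pow, one_mul, he2,
          div_lt_one (by positivity)]
        exact hre
      · exact ContinuousAt.div (by fun_prop) (by fun_prop) hn
    have hcH : ContinuousAt (fun τ : ℝ => hQuot r ((τ : ℂ) ^ 2)) 1 :=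
      (continuousAt_hQuot hr1 (by simp) (by simp)).comp (f := fun τ : ℝ => (τ : ℂ) ^ 2)
        (by fun_prop)
    have hall := ((hcH.fun_mul hLc).fun_mul ((continuousAt_const.fun_mul hcG).fun_pow 3) :
      ContinuousAt (fun τ : ℝ => hQuot r ((τ : ℂ) ^ 2) * pinchLim r e τ *
        (gQuot r 0 ((e : ℂ) ^ 2) * gQuot r 0 (r ^ 2 / ((τ : ℂ) ^ 2 * e ^ 2))) ^ 3) 1)
    have := hall.tendsto.mono_left (nhdsWithin_le_nhds (s := Set.Iio 1))
    rw [ofReal_one, hG, one_pow, one_pow, hQuot_one hr1, one_mul, mul_one] at this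
    refine this.congr' ?_
    filter_upwards [hev] with τ hτ
    exact (betaProd_pinchA hr1 he0 (he0.trans_le hτ.1) hτ.2).symm
  have h3 := h1.div h2 hL0
  rw [show 2 * Real.pi * (2 * pinchLim r e 1) / pinchLim r e 1 = (4 * Real.pi : ℂ) by
    field_simp; ring] at h3
  refine h3.congr' ?_
  filter_upwards [hev] with τ hτ
  have hτ : (1 - (τ : ℂ) ^ 2) ≠ 0 := by
    have h0 := he0.trans_le hτ.1
    have : (0 : ℝ) < 1 - τ ^ 2 := by nlinarith [hτ.2]
    exact_mod_cast this.ne'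
  simp only [Pi.div_apply, betaRatio]
  exact mul_div_mul_left _ _ hτ

/-! ### The beta evaluation for all parameters -/

/-- Completes five parameters to a balanced sextuple. -/
noncomputable def fullA (r : ℂ) (x : Fin 5 → ℂ × ℤ) : Fin 6 → ℂ :=
  ![(x 0).1, (x 1).1, (x 2).1, (x 3).1, (x 4).1,
    r ^ 2 / ((x 0).1 * (x 1).1 * (x 2).1 * (x 3).1 * (x 4).1)]

/-- Completes five discrete parameters to a balanced sextuple. -/
def fullN (x : Fin 5 → ℂ × ℤ) : Fin 6 → ℤ :=
  ![(x 0).2, (x 1).2, (x 2).2, (x 3).2, (x 4).2,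
    -((x 0).2 + (x 1).2 + (x 2).2 + (x 3).2 + (x 4).2)]

lemma sum_fullN (x : Fin 5 → ℂ × ℤ) : ∑ j, fullN x j = 0 := by
  simp only [fullN, Fin.sum_univ_six, Matrix.cons_val]; ring

lemma fullA_castSucc {r : ℂ} {a : Fin 6 → ℂ} (ha : BetaDom r a) (n : Fin 6 → ℤ) :
    fullA r (fun j => (a j.castSucc, n j.castSucc)) = a := by
  have h := ha.prod_eq
  have hne := ha.ne_zero
  rw [Fin.prod_univ_six] at h
  funext j
  fin_cases j
  any_goals rfl
  have : a 0 * a 1 * a 2 * a 3 * a 4 ≠ 0 := by simp [hne]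
  simp [fullA, ← h]
  exact mul_div_cancel_left₀ _ this

lemma fullN_castSucc (a : Fin 6 → ℂ) {n : Fin 6 → ℤ} (hn : ∑ j, n j = 0) :
    fullN (fun j => (a j.castSucc, n j.castSucc)) = n := by
  rw [Fin.sum_univ_six] at hn
  funext j
  fin_cases j
  any_goals rfl
  simp [fullN]
  linarith

/-- Any four of the free parameters have a product of modulus above `δ⁴ ≥ ‖r‖`. Hence the fifth
times the dependent one has modulus below `‖r‖²/‖r‖`, as `betaRatio_moveA` demands. -/
lemma betaDom_fullA {r : ℂ} (hr : r ≠ 0) {δ : ℝ} (hδ : PinchParam r δ) {x : Fin 5 → ℂ × ℤ}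
    (hx : ∀ j, δ < ‖(x j).1‖ ∧ ‖(x j).1‖ < 1) : BetaDom r (fullA r x) ∧
      ∀ i : Fin 5, ‖fullA r x i.castSucc * fullA r x 5‖ < ‖r‖ := by
  have h0 := hδ.pos
  have hr' := norm_pos_iff.mpr hr
  have hpos : ∀ j, 0 < ‖(x j).1‖ := fun j => h0.trans (hx j).1
  have hne : ∀ j, (x j).1 ≠ 0 := fun j => norm_pos_iff.mp (hpos j)
  have h4 : ∀ i j k l : Fin 5, ‖r‖ < ‖(x i).1‖ * ‖(x j).1‖ * ‖(x k).1‖ * ‖(x l).1‖ := by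
    intro i j k l
    calc ‖r‖ ≤ δ ^ 4 := hδ.norm_le
      _ = δ * δ * δ * δ := by ring
      _ < _ := by gcongr <;> exact (hx _).1
  have h5 : ∀ i : Fin 5, ‖fullA r x i.castSucc * fullA r x 5‖ < ‖r‖ := by
    have key : ∀ i j k l : Fin 5,
        ‖r‖ ^ 2 / (‖(x i).1‖ * ‖(x j).1‖ * ‖(x k).1‖ * ‖(x l).1‖) < ‖r‖ := by
      intro i j k l
      have := h4 i j k l
      rw [div_lt_iff₀ (hr'.trans this), sq]
      gcongr
    have e : ∀ i : Fin 5, fullA r x i.castSucc = (x i).1 := by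
      intro i; fin_cases i <;> rfl
    have e5 : fullA r x 5 = r ^ 2 / ((x 0).1 * (x 1).1 * (x 2).1 * (x 3).1 * (x 4).1) := rfl
    have := hpos 0; have := hpos 1; have := hpos 2; have := hpos 3; have := hpos 4
    intro i
    rw [e, e5]
    simp only [norm_mul, norm_div, norm_pow]
    fin_cases i
    · convert key 1 2 3 4 using 1
      simp; field_simp
    · convert key 0 2 3 4 using 1
      simp; field_simp
    · convert key 0 1 3 4 using 1
      simp; field_simp
    · convert key 0 1 2 4 using 1
      simp; field_simp
    · convert key 0 1 2 3 using 1
      simp; field_simp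
  refine ⟨⟨fun j => ?_, fun j => ?_, ?_⟩, h5⟩
  · fin_cases j <;> simp [fullA, hne, hr]
  · have h6 : ‖fullA r x 5‖ < 1 := by
      have h7 := h5 0
      have e : fullA r x (Fin.castSucc 0) = (x 0).1 := rfl
      rw [norm_mul, e] at h7
      have h8 : ‖r‖ < ‖(x 0).1‖ := hδ.norm_le_self.trans (hx 0).1
      by_contra! h9
      nlinarith [hpos 0]
    fin_cases j
    · exact (hx 0).2
    · exact (hx 1).2
    · exact (hx 2).2
    · exact (hx 3).2
    · exact (hx 4).2
    · exact h6
  · simp only [fullA, Fin.prod_univ_six, Matrix.cons_val]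
    refine mul_div_cancel₀ _ ?_
    simp [hne]

lemma betaRatio_update {r : ℂ} (hr : r ≠ 0) (hr1 : ‖r‖ < 1) {δ : ℝ} (hδ : PinchParam r δ)
    {x : Fin 5 → ℂ × ℤ} (hx : ∀ j, δ < ‖(x j).1‖ ∧ ‖(x j).1‖ < 1) (i : Fin 5) {v : ℂ × ℤ}
    (hv : δ < ‖v.1‖ ∧ ‖v.1‖ < 1) :
    betaRatio r (fullA r (Function.update x i v)) (fullN (Function.update x i v)) =
      betaRatio r (fullA r x) (fullN x) := by
  obtain ⟨hd, h5⟩ := betaDom_fullA hr hδ hx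
  have hne : ∀ j, (x j).1 ≠ 0 := fun j => norm_pos_iff.mp (hδ.pos.trans (hx j).1)
  have hv0 : v.1 ≠ 0 := norm_pos_iff.mp (hδ.pos.trans hv.1)
  have hi : i.castSucc ≠ 5 := (Fin.castSucc_lt_last i).ne
  have e0 : (Equiv.swap 0 i.castSucc) 0 = i.castSucc := Equiv.swap_apply_left _ _
  have e5 : (Equiv.swap 0 i.castSucc) 5 = 5 :=
    Equiv.swap_apply_of_ne_of_ne (by decide) hi.symm
  have hm := betaRatio_moveA hr hr1 (hd.comp_perm (Equiv.swap 0 i.castSucc))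
    (n := fullN x ∘ Equiv.swap 0 i.castSucc)
    (by simp only [Function.comp_apply, e0, e5]; exact h5 i)
    ((Equiv.sum_comp (Equiv.swap 0 i.castSucc) (fullN x)).trans (sum_fullN x)) (b := v.1)
    (by simp only [Function.comp_apply, e0, e5]
        exact ((h5 i).trans hδ.norm_le_self).trans hv.1) hv.2 v.2
  rw [betaRatio_comp_swap r _ _ hi, ← betaRatio_comp_swap r (moveA _ _) _ hi] at hm
  rw [← hm]
  have h0 := hne 0; have h1 := hne 1; have h2 := hne 2; have h3 := hne 3; have h4 := hne 4
  congr 1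
  · funext j
    fin_cases i <;> fin_cases j <;> simp [fullA, moveA, Equiv.swap_apply_def] <;> field_simp
  · funext j
    fin_cases i <;> fin_cases j <;> simp [fullN, moveN, Equiv.swap_apply_def] <;> ring

/-- The region is a product of annuli, so all hybrids of `x` and `y` stay in it and the five slots
can be exchanged one at a time. -/
lemma betaRatio_fullA_eq {r : ℂ} (hr : r ≠ 0) (hr1 : ‖r‖ < 1) {δ : ℝ} (hδ : PinchParam r δ)
    {x y : Fin 5 → ℂ × ℤ} (hx : ∀ j, δ < ‖(x j).1‖ ∧ ‖(x j).1‖ < 1)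
    (hy : ∀ j, δ < ‖(y j).1‖ ∧ ‖(y j).1‖ < 1) :
    betaRatio r (fullA r y) (fullN y) = betaRatio r (fullA r x) (fullN x) := by
  have h : ∀ s : Finset (Fin 5), betaRatio r (fullA r (s.piecewise y x)) (fullN (s.piecewise y x)) =
      betaRatio r (fullA r x) (fullN x) := by
    intro s
    induction s using Finset.induction_on with
    | empty => simp
    | insert i s hi ih =>
      rw [Finset.piecewise_insert, betaRatio_update hr hr1 hδ (fun j => ?_) i (hy i), ih]
      rw [Finset.piecewise]
      split_ifs
      · exact hy j
      · exact hx j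
  simpa using h Finset.univ

lemma betaRatio_fullA {r : ℂ} (hr : r ≠ 0) (hr1 : ‖r‖ < 1) {δ : ℝ} (hδ : PinchParam r δ)
    {x : Fin 5 → ℂ × ℤ} (hx : ∀ j, δ < ‖(x j).1‖ ∧ ‖(x j).1‖ < 1) :
    betaRatio r (fullA r x) (fullN x) = 4 * Real.pi := by
  -- Taking `e` strictly above `δ` puts the pinched parameters, with `e < τ < 1`, inside the open
  -- region for `δ`.
  obtain ⟨e, he1, he2⟩ := exists_between hδ.lt_one
  have he0 : 0 < e := hδ.pos.trans he1
  have he : PinchParam r e := ⟨he0, he2, hδ.norm_le.trans (pow_le_pow_left₀ hδ.pos.le he1.le 4)⟩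
  refine tendsto_nhds_unique ?_ (tendsto_betaRatio_pinchA hr hr1 he)
  refine tendsto_const_nhds.congr' ?_
  filter_upwards [self_mem_nhdsWithin,
    mem_nhdsWithin_of_mem_nhds (Ioi_mem_nhds he2)] with τ h1 h2
  have hτ0 : 0 < τ := he0.trans h2
  have hτe : δ < τ := he1.trans h2
  have n1 : ‖I * (τ : ℂ)‖ = τ := by simp [abs_of_pos hτ0]
  have n2 : ‖-I * (τ : ℂ)‖ = τ := by simp [abs_of_pos hτ0]
  have n3 : ‖(e : ℂ)‖ = e := by simp [abs_of_pos he0]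
  obtain ⟨y, hy⟩ : ∃ y : Fin 5 → ℂ × ℤ,
      y = ![(I * τ, 0), (-I * τ, 0), ((e : ℂ), 0), ((e : ℂ), 0), ((e : ℂ), 0)] := ⟨_, rfl⟩
  have hA : fullA r y = pinchA r e τ := by
    have e5 : r ^ 2 / (I * (τ : ℂ) * (-I * τ) * e * e * e) = r ^ 2 / ((τ : ℂ) ^ 2 * e ^ 3) := by
      congr 1
      linear_combination (-(τ : ℂ) ^ 2 * e ^ 3) * I_sq
    simp only [fullA, pinchA, hy, Matrix.cons_val, e5]
  have hN : fullN y = 0 := by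
    simp only [fullN, hy, Matrix.cons_val]
    funext j
    fin_cases j <;> rfl
  rw [← betaRatio_fullA_eq hr hr1 hδ hx (y := y), hA, hN]
  intro j
  rw [hy]
  fin_cases j
  · exact ⟨n1.symm ▸ hτe, n1.symm ▸ h1⟩
  · exact ⟨n2.symm ▸ hτe, n2.symm ▸ h1⟩
  all_goals exact ⟨n3.symm ▸ he1, n3.symm ▸ he2⟩

/-- The beta integral on an arbitrary line (in logarithmic coordinates) is determined by its values
close to a point of the line. -/
lemma betaInt_eq_of_eventually {r : ℂ} (hr : r ≠ 0) (hr1 : ‖r‖ < 1) (n : Fin 6 → ℤ)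
    {α β : Fin 6 → ℂ} (hαβ : ∀ c : ℂ, ∏ j, exp (α j * c + β j) = r ^ 2)
    (h0 : ∀ j, (β j).re < 0) (h1 : ∀ j, (α j + β j).re < 0)
    (hev : ∀ᶠ c in 𝓝 (0 : ℂ), BetaDom r (fun j => exp (α j * c + β j)) →
      betaInt r (fun j => exp (α j * c + β j)) n =
        4 * Real.pi * betaProd r (fun j => exp (α j * c + β j)) n) :
    betaInt r (fun j => exp (α j + β j)) n =
      4 * Real.pi * betaProd r (fun j => exp (α j + β j)) n := by
  -- In logarithmic coordinates the conditions `‖a_j‖ < 1` are half-planes. Their intersection is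
  -- convex, hence connected, and contains both `0` and `1`, so the identity theorem applies.
  set V : Set ℂ := ⋂ j, {c : ℂ | (α j * c).re < -(β j).re} with hV
  have hVo : IsOpen V := isOpen_iInter_of_finite fun j =>
    isOpen_lt (by fun_prop) continuous_const
  have hVc : Convex ℝ V := convex_iInter fun j =>
    convex_halfSpace_lt ⟨fun x y => by simp [mul_add], fun c x => by simp; ring⟩ _
  have hdom : ∀ c ∈ V, BetaDom r (fun j => exp (α j * c + β j)) := fun c hc =>
    ⟨fun j => exp_ne_zero _, fun j => by
      rw [norm_exp, Real.exp_lt_one_iff, add_re]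
      have : (α j * c).re < -(β j).re := Set.mem_iInter.mp hc j
      linarith, hαβ c⟩
  have h0V : (0 : ℂ) ∈ V := Set.mem_iInter.mpr fun j => by simpa using h0 j
  have h1V : (1 : ℂ) ∈ V := Set.mem_iInter.mpr fun j => by
    have := h1 j
    rw [add_re] at this
    simp only [Set.mem_ofPred_eq, mul_one]
    linarith
  have hda : ∀ j, DifferentiableOn ℂ (fun c => exp (α j * c + β j)) V := fun j => by fun_prop
  have hd : DifferentiableOn ℂ (fun c => betaInt r (fun j => exp (α j * c + β j)) n -
      4 * Real.pi * betaProd r (fun j => exp (α j * c + β j)) n) V :=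
    (differentiableOn_betaInt hr hr1 n hVo hdom hda).sub
      ((differentiableOn_betaProd hr hr1 n hdom hda).const_mul _)
  have hz := (hd.analyticOnNhd hVo).eqOn_zero_of_preconnected_of_eventuallyEq_zero
    hVc.isPreconnected h0V (by
      filter_upwards [hev, hVo.mem_nhds h0V] with c h2 h3
      exact sub_eq_zero.mpr (h2 (hdom c h3)))
  simpa using sub_eq_zero.mp (hz h1V)

/-- The sum-integral analogue of the elliptic beta integral. -/
theorem betaInt_eq {r : ℂ} (hr : r ≠ 0) (hr1 : ‖r‖ < 1) {a : Fin 6 → ℂ} (ha : BetaDom r a)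
    {n : Fin 6 → ℤ} (hn : ∑ j, n j = 0) : betaInt r a n = 4 * Real.pi * betaProd r a n := by
  have hr' := norm_pos_iff.mpr hr
  obtain ⟨δ, hδ⟩ : ∃ δ, PinchParam r δ := by
    have hc : ContinuousAt (fun x : ℝ => x ^ 4) 1 := by fun_prop
    have hev : ∀ᶠ x : ℝ in 𝓝[<] 1, ‖r‖ < x ^ 4 :=
      (hc.tendsto.mono_left nhdsWithin_le_nhds).eventually (lt_mem_nhds (by simpa using hr1))
    obtain ⟨x, h1, h2, h3⟩ := (hev.and (Filter.inter_mem self_mem_nhdsWithin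
      (mem_nhdsWithin_of_mem_nhds (Ioi_mem_nhds (zero_lt_one' ℝ))))).exists
    exact ⟨x, h3, h2, h1.le⟩
  obtain ⟨e, he1, he2⟩ := exists_between hδ.lt_one
  have he0 : 0 < e := hδ.pos.trans he1
  have hlog : Real.log e < 0 := Real.log_neg he0 he2
  set L : ℂ := ((Real.log e : ℝ) : ℂ) with hL
  set S : ℂ := log (a 0) + log (a 1) + log (a 2) + log (a 3) + log (a 4) with hS
  have hexp : exp L = e := by rw [hL, ← ofReal_exp, Real.exp_log he0]
  -- The line runs from five parameters equal to `e` at `c = 0` to the given ones at `c = 1`. The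
  -- last coordinate is forced by the product; at `c = 1` its exponent is `2 log r - S`, which may
  -- differ from `log (a 5)` by a period, so `a 5` is recovered from the product below.
  set α : Fin 6 → ℂ := ![log (a 0) - L, log (a 1) - L, log (a 2) - L, log (a 3) - L,
    log (a 4) - L, 5 * L - S] with hα
  set β : Fin 6 → ℂ := ![L, L, L, L, L, 2 * log r - 5 * L] with hβ
  have hαβ : ∀ c : ℂ, ∏ j, exp (α j * c + β j) = r ^ 2 := by
    intro c
    rw [← exp_sum]
    have : ∑ j, (α j * c + β j) = 2 * log r := by
      simp only [hα, hβ, hS, Fin.sum_univ_six, Matrix.cons_val]; ring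
    rw [this, two_mul, exp_add, exp_log hr, sq]
  have he1' : (fun j => exp (α j + β j)) = a := by
    have h6 := hαβ 1
    have hp := ha.prod_eq
    have e : ∀ j : Fin 5, exp (α j.castSucc + β j.castSucc) = a j.castSucc := by
      intro j
      have : α j.castSucc + β j.castSucc = log (a j.castSucc) := by
        fin_cases j <;> simp [hα, hβ]
      rw [this, exp_log (ha.ne_zero _)]
    simp only [mul_one] at h6
    rw [← hp, Fin.prod_univ_castSucc, Fin.prod_univ_castSucc a] at h6
    simp only [e] at h6
    funext j
    refine Fin.lastCases ?_ e j
    exact mul_left_cancel₀ (Finset.prod_ne_zero_iff.mpr fun i _ => ha.ne_zero _) h6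
  have hβre : ∀ j, (β j).re < 0 := by
    have h5 : ‖r‖ ^ 2 < e ^ 5 := by
      have h1 : ‖r‖ ≤ e ^ 4 := hδ.norm_le.trans (pow_le_pow_left₀ hδ.pos.le he1.le 4)
      have h2 : ‖r‖ < e := hδ.norm_le_self.trans he1
      calc ‖r‖ ^ 2 = ‖r‖ * ‖r‖ := sq _
        _ ≤ ‖r‖ * e ^ 4 := by gcongr
        _ < e * e ^ 4 := by gcongr
        _ = e ^ 5 := by ring
    have h6 : 2 * Real.log ‖r‖ - 5 * Real.log e < 0 := by
      have := Real.log_lt_log (by positivity) h5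
      rw [Real.log_pow, Real.log_pow] at this
      push_cast at this
      linarith
    intro j
    fin_cases j
    any_goals exact hlog
    simpa [hβ, hL, log_re] using h6
  rw [← he1']
  refine betaInt_eq_of_eventually hr hr1 n hαβ hβre (fun j => ?_) ?_
  · have : ‖exp (α j + β j)‖ < 1 := by
      rw [congrFun he1' j]; exact ha.lt_one j
    rwa [norm_exp, Real.exp_lt_one_iff] at this
  · have hclose : ∀ j : Fin 5, ∀ᶠ c in 𝓝 (0 : ℂ),
        δ < ‖exp (α j.castSucc * c + β j.castSucc)‖ := by
      intro j
      have hc : ContinuousAt (fun c : ℂ => ‖exp (α j.castSucc * c + β j.castSucc)‖) 0 := by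
        fun_prop
      refine hc.tendsto.eventually (lt_mem_nhds ?_)
      have hb : β j.castSucc = L := by fin_cases j <;> rfl
      rw [mul_zero, zero_add, hb, hexp, norm_real, Real.norm_of_nonneg he0.le]
      exact he1
    filter_upwards [eventually_all.mpr hclose] with c hc hdom
    have := betaRatio_fullA hr hr1 hδ
      (x := fun j => (exp (α j.castSucc * c + β j.castSucc), n j.castSucc))
      fun j => ⟨hc j, hdom.lt_one _⟩
    rw [fullA_castSucc hdom n, fullN_castSucc (fun j => exp (α j * c + β j)) hn, betaRatio,
      div_eq_iff (hdom.betaProd_ne_zero hr hr1 n)] at this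
    exact this

/-! ### From the operators to integrals of regularized kernels -/

instance : SFinite sumMeas := by unfold sumMeas; infer_instance

lemma ae_sumMeas {P : ℤ × ℝ → Prop}
    (h : ∀ m, ∀ᵐ θ ∂(volume.restrict (Set.Ioc 0 (2 * Real.pi))), P (m, θ)) :
    ∀ᵐ p ∂sumMeas, P p := by
  have hsub : {p | ¬ P p} ⊆ ⋃ m : ℤ, ({m} : Set ℤ) ×ˢ {θ | ¬ P (m, θ)} := fun p hp =>
    Set.mem_iUnion.mpr ⟨p.1, rfl, hp⟩
  refine measure_mono_null hsub (measure_iUnion_null fun m => ?_)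
  rw [sumMeas, Measure.prod_prod, ae_iff.mp (h m), mul_zero]

lemma aestronglyMeasurable_sumMeas {f : ℤ × ℝ → ℂ}
    (h : ∀ m, AEStronglyMeasurable (fun θ => f (m, θ))
      (volume.restrict (Set.Ioc 0 (2 * Real.pi)))) : AEStronglyMeasurable f sumMeas :=
  ⟨fun p => (h p.1).mk _ p.2,
    (measurable_int_prod fun m => (h m).stronglyMeasurable_mk.measurable).stronglyMeasurable,
    ae_sumMeas fun m => (h m).ae_eq_mk⟩

/-- The criterion for integrability over a product measure, with counting measure in the first
factor; it makes Fubini available for the operators. -/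
lemma absConv_iff {r : ℂ} {f : ℤ → ℂ → ℂ} :
    AbsConv r f ↔ Integrable (fun p : ℤ × ℝ => density r p.1 (circleMap 0 1 p.2) *
      f p.1 (circleMap 0 1 p.2)) sumMeas := by
  have hle : (0 : ℝ) ≤ 2 * Real.pi := Real.two_pi_pos.le
  have hslice : (∀ n : ℤ, CircleIntegrable (fun z => density r n z * f n z) 0 1) ↔
      ∀ n : ℤ, Integrable (fun θ => density r n (circleMap 0 1 θ) * f n (circleMap 0 1 θ))
        (volume.restrict (Set.Ioc 0 (2 * Real.pi))) :=
    forall_congr' fun n => intervalIntegrable_iff_integrableOn_Ioc_of_le hle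
  have hsum : ∀ n : ℤ, ∫ θ in (0 : ℝ)..(2 * Real.pi),
      ‖density r n (circleMap 0 1 θ) * f n (circleMap 0 1 θ)‖ =
      ∫ θ, ‖density r n (circleMap 0 1 θ) * f n (circleMap 0 1 θ)‖
        ∂(volume.restrict (Set.Ioc 0 (2 * Real.pi))) := fun n =>
    intervalIntegral.integral_of_le hle
  have hnn : ∀ n : ℤ, ‖∫ θ, ‖density r n (circleMap 0 1 θ) * f n (circleMap 0 1 θ)‖
        ∂(volume.restrict (Set.Ioc 0 (2 * Real.pi)))‖ =
      ∫ θ, ‖density r n (circleMap 0 1 θ) * f n (circleMap 0 1 θ)‖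
        ∂(volume.restrict (Set.Ioc 0 (2 * Real.pi))) := fun n =>
    Real.norm_of_nonneg (integral_nonneg fun _ => norm_nonneg _)
  unfold AbsConv
  rw [hslice]
  simp only [hsum]
  constructor
  · rintro ⟨h1, h2⟩
    refine (integrable_prod_iff (aestronglyMeasurable_sumMeas fun m =>
      (h1 m).aestronglyMeasurable)).mpr ⟨.of_forall h1, ?_⟩
    rw [integrable_count_iff]
    simpa only [hnn] using h2
  · intro h
    obtain ⟨h1, h2⟩ := (integrable_prod_iff h.aestronglyMeasurable).mp h
    refine ⟨fun n => (Measure.ae_count_iff.mp h1) n, ?_⟩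
    rw [integrable_count_iff] at h2
    simpa only [hnn] using h2

lemma sumInt_eq {r : ℂ} {f : ℤ → ℂ → ℂ} (h : AbsConv r f) :
    sumInt r f = (4 * Real.pi : ℂ)⁻¹ * ∫ p : ℤ × ℝ, density r p.1 (circleMap 0 1 p.2) *
      f p.1 (circleMap 0 1 p.2) ∂sumMeas := by
  rw [← (hasSum_integral_sumMeas (absConv_iff.mp h)).tsum_eq, ← tsum_mul_left]
  unfold sumInt circleIntegral
  refine tsum_congr fun m => ?_
  rw [← intervalIntegral.integral_const_mul]
  refine intervalIntegral.integral_congr fun θ _ => ?_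
  have hz : circleMap 0 1 θ ≠ 0 := circleMap_ne_center one_ne_zero
  have hpi : (Real.pi : ℂ) ≠ 0 := by exact_mod_cast Real.pi_ne_zero
  simp only [deriv_circleMap, smul_eq_mul]
  field_simp

/-- `r ^ κ * u` avoids `1` for all integers `κ`. -/
def IsGeneric (r u : ℂ) : Prop := ∀ κ : ℤ, r ^ κ * u ≠ 1

lemma IsGeneric.qPoch_ne_zero {r u : ℂ} (hr : r ≠ 0) (hr1 : ‖r‖ < 1) (h : IsGeneric r u) (κ : ℤ) :
    qPoch (r ^ κ * u) (r ^ 2) ≠ 0 := by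
  refine QBailey.qPoch_ne_zero (norm_sq_lt_one hr1) fun j hj => ?_
  refine h (κ + (2 * j : ℕ)) ?_
  rw [zpow_add₀ hr, zpow_natCast, pow_mul]
  linear_combination -hj

/-- Only countably many points of the circle violate the conditions, and their angles form a null
set. This discards the points where division by zero could spoil the comparison with `gQuot`. -/
lemma ae_isGeneric {r : ℂ} (u : ℂ) :
    ∀ᵐ p ∂sumMeas, IsGeneric r (u * circleMap 0 1 p.2) ∧ IsGeneric r (u / circleMap 0 1 p.2) := by
  set S : Set ℂ := Set.range (fun κ : ℤ => (r ^ κ * u)⁻¹) ∪ Set.range fun κ : ℤ => r ^ κ * u with hS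
  have hc : S.Countable := (Set.countable_range _).union (Set.countable_range _)
  refine ae_sumMeas fun m => ae_restrict_of_ae ?_
  filter_upwards [(hc.preimage_circleMap 0 one_ne_zero).ae_notMem volume] with θ hθ
  have hz : circleMap 0 1 θ ≠ 0 := circleMap_ne_center one_ne_zero
  refine ⟨fun κ h => hθ (Or.inl ⟨κ, ?_⟩), fun κ h => hθ (Or.inr ⟨κ, ?_⟩)⟩
  · exact (eq_inv_of_mul_eq_one_right (by rw [mul_assoc]; exact h)).symm
  · rw [mul_div_assoc', div_eq_one_iff_eq hz] at h
    exact h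

/-- The kernel of the sum-integral operator with its removable singularities removed. -/
noncomputable def regK (r t : ℂ) (N : ℤ) (c x : ℂ) (m : ℤ) (z : ℂ) (n : ℤ) : ℂ :=
  1 / (z ^ (2 * n) * x ^ (2 * m) * c) *
    (gQuot r (m + N + n) (t * x * z) * gQuot r (m + N - n) (t * x / z) *
      gQuot r (-m + N + n) (t * z / x) * gQuot r (-m + N - n) (t / (x * z)))

/-- The function `funD` with its removable singularities removed. -/
noncomputable def regD (r t : ℂ) (N : ℤ) (w : ℂ) (n : ℤ) (z : ℂ) (m : ℤ) : ℂ :=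
  (r ^ 2) ^ N / (z ^ (2 * m) * w ^ (2 * n) * t ^ (2 * N)) *
    (gQuot r (n - N + m) (r * (w * z / t)) * gQuot r (n - N - m) (r * (w / (t * z))) *
      gQuot r (-n - N + m) (r * (z / (t * w))) * gQuot r (-n - N - m) (r * (1 / (t * w * z))))

lemma kernel_eq_regK {r : ℂ} (hr : r ≠ 0) (hr1 : ‖r‖ < 1) {t x z : ℂ} (ht : t ≠ 0) (hx : x ≠ 0)
    (hz : z ≠ 0) (N : ℤ) (c : ℂ) (m n : ℤ) (h1 : ‖t * x * z‖ < 1) (h2 : ‖t * x / z‖ < 1)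
    (h3 : ‖t * z / x‖ < 1) (h4 : ‖t / (x * z)‖ < 1) (g1 : IsGeneric r (t * x * z))
    (g2 : IsGeneric r (t * x / z)) (g3 : IsGeneric r (t * z / x)) (g4 : IsGeneric r (t / (x * z))) :
    kernel r t N c x m z n = regK r t N c x m z n := by
  unfold kernel regK qPoch4
  rw [gQuot_eq hr hr1 (by simp [ht, hx, hz]) h1 (g1.qPoch_ne_zero hr hr1 _),
    gQuot_eq hr hr1 (by simp [ht, hx, hz]) h2 (g2.qPoch_ne_zero hr hr1 _),
    gQuot_eq hr hr1 (by simp [ht, hx, hz]) h3 (g3.qPoch_ne_zero hr hr1 _),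
    gQuot_eq hr hr1 (by simp [ht, hx, hz]) h4 (g4.qPoch_ne_zero hr hr1 _),
    show r ^ (2 + (m + N + n)) / (t * x * z) = r ^ (2 + (m + N + n)) * (1 / (t * x * z)) by ring,
    show ∀ u : ℂ, u / (t * x / z) = u * (z / (t * x)) from fun u => by field_simp,
    show ∀ u : ℂ, u / (t * z / x) = u * (x / (t * z)) from fun u => by field_simp,
    show ∀ u : ℂ, u / (t / (x * z)) = u * (x * z / t) from fun u => by field_simp]
  simp only [div_mul_div_comm]

lemma funD_eq_regD {r : ℂ} (hr : r ≠ 0) (hr1 : ‖r‖ < 1) {t w z : ℂ} (ht : t ≠ 0) (hw : w ≠ 0)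
    (hz : z ≠ 0) (N n m : ℤ) (h1 : ‖r * (w * z / t)‖ < 1) (h2 : ‖r * (w / (t * z))‖ < 1)
    (h3 : ‖r * (z / (t * w))‖ < 1) (h4 : ‖r * (1 / (t * w * z))‖ < 1)
    (hD : denomD r t N w n z m ≠ 0) : funD r t N w n z m = regD r t N w n z m := by
  have hD' := hD
  unfold denomD qPoch4 at hD'
  obtain ⟨hD', d4⟩ := mul_ne_zero_iff.mp hD'
  obtain ⟨hD', d3⟩ := mul_ne_zero_iff.mp hD'
  obtain ⟨d1, d2⟩ := mul_ne_zero_iff.mp hD'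
  rw [mul_assoc] at d1 d2 d3 d4
  unfold funD regD denomD qPoch4
  rw [gQuot_eq hr hr1 (by simp [hr, ht, hw, hz]) h1 d1,
    gQuot_eq hr hr1 (by simp [hr, ht, hw, hz]) h2 d2,
    gQuot_eq hr hr1 (by simp [hr, ht, hw, hz]) h3 d3,
    gQuot_eq hr hr1 (by simp [hr, ht, hw, hz]) h4 d4,
    show ∀ u : ℂ, u / (r * (w * z / t)) = u * r⁻¹ * (t / (z * w)) from fun u => by field_simp,
    show ∀ u : ℂ, u / (r * (w / (t * z))) = u * r⁻¹ * (t * z / w) from fun u => by field_simp,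
    show ∀ u : ℂ, u / (r * (z / (t * w))) = u * r⁻¹ * (t * w / z) from fun u => by field_simp,
    show ∀ u : ℂ, u / (r * (1 / (t * w * z))) = u * r⁻¹ * (t * w * z) from fun u => by field_simp]
  simp only [div_mul_div_comm, ← mul_assoc]

lemma denomD_ne_zero {r : ℂ} (hr : r ≠ 0) (hr1 : ‖r‖ < 1) {t w z : ℂ} (N n m : ℤ)
    (g1 : IsGeneric r (r * (w * z / t))) (g2 : IsGeneric r (r * (w / (t * z))))
    (g3 : IsGeneric r (r * (z / (t * w)))) (g4 : IsGeneric r (r * (1 / (t * w * z)))) :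
    denomD r t N w n z m ≠ 0 := by
  unfold denomD qPoch4
  refine mul_ne_zero (mul_ne_zero (mul_ne_zero ?_ ?_) ?_) ?_ <;> rw [mul_assoc]
  · exact g1.qPoch_ne_zero hr hr1 _
  · exact g2.qPoch_ne_zero hr hr1 _
  · exact g3.qPoch_ne_zero hr hr1 _
  · exact g4.qPoch_ne_zero hr hr1 _

lemma ae_kernel_eq_regK {r : ℂ} (hr : r ≠ 0) (hr1 : ‖r‖ < 1) {t x : ℂ} (ht : t ≠ 0) (hx : x ≠ 0)
    (h1 : ‖t * x‖ < 1) (h2 : ‖t / x‖ < 1) (N : ℤ) (c : ℂ) (m : ℤ) :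
    ∀ᵐ p ∂sumMeas, kernel r t N c x m (circleMap 0 1 p.2) p.1 =
      regK r t N c x m (circleMap 0 1 p.2) p.1 := by
  filter_upwards [ae_isGeneric (r := r) (t * x), ae_isGeneric (r := r) (t / x)] with p hp1 hp2
  have hz : circleMap 0 1 p.2 ≠ 0 := circleMap_ne_center one_ne_zero
  have e3 : t * circleMap 0 1 p.2 / x = t / x * circleMap 0 1 p.2 := by ring
  have e4 : t / (x * circleMap 0 1 p.2) = t / x / circleMap 0 1 p.2 := by rw [div_div]
  refine kernel_eq_regK hr hr1 ht hx hz N c m p.1 (by simpa using h1) (by simpa using h1) ?_ ?_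
    hp1.1 hp1.2 (e3 ▸ hp2.1) (e4 ▸ hp2.2)
  · rw [e3]; simpa using h2
  · rw [e4]; simpa using h2

lemma ae_funD_eq_regD {r : ℂ} (hr : r ≠ 0) (hr1 : ‖r‖ < 1) {t w : ℂ} (ht : t ≠ 0) (hw : w ≠ 0)
    (h1 : ‖r * w / t‖ < 1) (h2 : ‖r / (t * w)‖ < 1) (N n : ℤ) :
    ∀ᵐ p ∂sumMeas, funD r t N w n (circleMap 0 1 p.2) p.1 =
      regD r t N w n (circleMap 0 1 p.2) p.1 := by
  filter_upwards [ae_isGeneric (r := r) (r * w / t), ae_isGeneric (r := r) (r / (t * w))]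
    with p hp1 hp2
  have hz : circleMap 0 1 p.2 ≠ 0 := circleMap_ne_center one_ne_zero
  have e1 : r * (w * circleMap 0 1 p.2 / t) = r * w / t * circleMap 0 1 p.2 := by ring
  have e2 : r * (w / (t * circleMap 0 1 p.2)) = r * w / t / circleMap 0 1 p.2 := by
    rw [div_div, mul_div_assoc]
  have e3 : r * (circleMap 0 1 p.2 / (t * w)) = r / (t * w) * circleMap 0 1 p.2 := by ring
  have e4 : r * (1 / (t * w * circleMap 0 1 p.2)) = r / (t * w) / circleMap 0 1 p.2 := by
    rw [div_div]; ring
  refine funD_eq_regD hr hr1 ht hw hz N n p.1 ?_ ?_ ?_ ?_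
    (denomD_ne_zero hr hr1 N n p.1 (e1 ▸ hp1.1) (e2 ▸ hp1.2) (e3 ▸ hp2.1) (e4 ▸ hp2.2))
  · rw [e1]; simpa using h1
  · rw [e2]; simpa using h1
  · rw [e3]; simpa using h2
  · rw [e4]; simpa using h2

lemma prefactor_eq {r : ℂ} (hr : r ≠ 0) (hr1 : ‖r‖ < 1) {t : ℂ} (N : ℤ) (h1 : ‖r ^ 2‖ < ‖t ^ 2‖)
    (h2 : ‖t ^ 2‖ < 1) : prefactor r t N = (gQuot r (2 * N) (t ^ 2))⁻¹ := by
  have ht : t ≠ 0 := by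
    rintro rfl
    rw [zero_pow two_ne_zero, norm_zero] at h1
    exact absurd h1 (not_lt.mpr (norm_nonneg _))
  have hq := norm_sq_lt_one hr1
  have hq0 : 0 < ‖r ^ 2‖ := norm_pos_iff.mpr (pow_ne_zero 2 hr)
  have e1 : r ^ (2 * N) = (r ^ 2) ^ N := by rw [zpow_mul]; norm_cast
  -- A zero would force `‖q‖^i ‖t²‖ = 1` for an integer `i`, but `‖q‖ < ‖t²‖ < 1` makes this number
  -- less than `1` for `i ≥ 0` and greater than `1` for `i ≤ -1`.
  have hne : qPoch (r ^ (2 * N) * t ^ 2) (r ^ 2) ≠ 0 := by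
    refine qPoch_ne_zero hq fun j hj => ?_
    have h3 : ‖r ^ 2‖ ^ (N + j) * ‖t ^ 2‖ = 1 := by
      rw [← norm_zpow, ← norm_mul, zpow_add₀ (pow_ne_zero 2 hr), zpow_natCast, ← e1]
      rw [show r ^ (2 * N) * (r ^ 2) ^ j * t ^ 2 = 1 by linear_combination -hj, norm_one]
    rcases le_or_gt 0 (N + (j : ℤ)) with h | h
    · have := zpow_le_zpow_right_of_le_one₀ hq0 hq.le h
      rw [zpow_zero] at this
      nlinarith [norm_nonneg (t ^ 2)]
    · have h4 : ‖r ^ 2‖ ^ (-1 : ℤ) ≤ ‖r ^ 2‖ ^ (N + (j : ℤ)) :=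
        zpow_le_zpow_right_of_le_one₀ hq0 hq.le (by omega)
      rw [zpow_neg_one] at h4
      have h5 : 1 < ‖r ^ 2‖⁻¹ * ‖t ^ 2‖ := by
        rw [inv_mul_eq_div, one_lt_div hq0]; exact h1
      nlinarith [norm_nonneg (t ^ 2)]
  rw [gQuot_eq hr hr1 (pow_ne_zero 2 ht) h2 hne, inv_div, prefactor, e1, zpow_add₀ hr, e1,
    zpow_add₀ (pow_ne_zero 2 hr), zpow_one]
  norm_cast
  rw [mul_one_div]

/-! ### The star-triangle relation as a beta evaluation -/

/-- The conditions on the parameters of the star-triangle relation. -/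
structure StarDom (r s t y ω : ℂ) : Prop where
  s_ne : s ≠ 0
  t_ne : t ≠ 0
  y_ne : y ≠ 0
  ω_ne : ω ≠ 0
  t_lt : ‖t‖ < 1
  sω_lt : ‖s * ω‖ < 1
  sω_lt' : ‖s / ω‖ < 1
  y_lt : ‖r * y / (s * t)‖ < 1
  y_lt' : ‖r / (s * t * y)‖ < 1

/-- The parameters of the beta integral in the star-triangle relation. -/
noncomputable def starA (r s t y ω x : ℂ) : Fin 6 → ℂ :=
  ![s * ω, s / ω, r * y / (s * t), r / (s * t * y), t * x, t / x]

/-- The discrete parameters of the beta integral in the star-triangle relation. -/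
def starN (ns nt l k j : ℤ) : Fin 6 → ℤ :=
  ![k + ns, -k + ns, l - (ns + nt), -l - (ns + nt), j + nt, -j + nt]

lemma sum_starN (ns nt l k j : ℤ) : ∑ i, starN ns nt l k j i = 0 := by
  simp only [starN, Fin.sum_univ_six, Matrix.cons_val]; ring

lemma StarDom.betaDom {r s t y ω x : ℂ} (hr : r ≠ 0) (h : StarDom r s t y ω) (hx : ‖x‖ = 1) :
    BetaDom r (starA r s t y ω x) := by
  obtain ⟨hs, ht, hy, hω, h1, h2, h3, h4, h5⟩ := h
  have hx0 : x ≠ 0 := norm_pos_iff.mp (by rw [hx]; exact one_pos)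
  have h6 : ‖t * x‖ < 1 := by simpa [hx] using h1
  have h7 : ‖t / x‖ < 1 := by simpa [hx] using h1
  refine ⟨fun j => ?_, fun j => ?_, ?_⟩
  · fin_cases j <;> simp [starA, hs, ht, hy, hω, hr, hx0]
  · fin_cases j
    exacts [h2, h3, h4, h5, h6, h7]
  · simp only [starA, Fin.prod_univ_six, Matrix.cons_val]
    field_simp

/-- The products of the pairs `(0, 1)`, `(4, 5)` and `(2, 3)` are `s²`, `t²` and `q/(st)²`, and
every pair product lies strictly between `‖q‖` and `1` in modulus. -/
lemma StarDom.norm_sq {r s t y ω : ℂ} (hr : r ≠ 0) (h : StarDom r s t y ω) :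
    (‖r ^ 2‖ < ‖s ^ 2‖ ∧ ‖s ^ 2‖ < 1) ∧ (‖r ^ 2‖ < ‖t ^ 2‖ ∧ ‖t ^ 2‖ < 1) ∧
      (‖r ^ 2‖ < ‖(s * t) ^ 2‖ ∧ ‖(s * t) ^ 2‖ < 1) := by
  have hd := h.betaDom hr (x := 1) norm_one
  obtain ⟨hs, ht, hy, hω, -⟩ := h
  have hst := mul_ne_zero hs ht
  have e1 : starA r s t y ω 1 0 * starA r s t y ω 1 1 = s ^ 2 := by simp [starA]; field_simp
  have e2 : starA r s t y ω 1 4 * starA r s t y ω 1 5 = t ^ 2 := by simp [starA]; ring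
  have e3 : starA r s t y ω 1 2 * starA r s t y ω 1 3 = r ^ 2 / (s * t) ^ 2 := by
    simp [starA]; field_simp
  have hr0 : 0 < ‖r ^ 2‖ := norm_pos_iff.mpr (pow_ne_zero 2 hr)
  have hst0 : 0 < ‖(s * t) ^ 2‖ := norm_pos_iff.mpr (pow_ne_zero 2 hst)
  have l3 := hd.lt_norm_mul (show (2 : Fin 6) ≠ 3 by decide)
  have u3 := hd.norm_mul_lt_one 2 3
  rw [e3, norm_div] at l3 u3
  refine ⟨⟨e1 ▸ hd.lt_norm_mul (by decide), e1 ▸ hd.norm_mul_lt_one _ _⟩,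
    ⟨e2 ▸ hd.lt_norm_mul (by decide), e2 ▸ hd.norm_mul_lt_one _ _⟩, ?_, ?_⟩
  · rwa [div_lt_one hst0] at u3
  · rw [lt_div_iff₀ hst0] at l3
    exact lt_of_mul_lt_mul_left (by rwa [mul_one]) hr0.le

/-- The monomial factor between the integrand of the star-triangle relation and that of the beta
integral. -/
noncomputable def starM (r s t y ω x : ℂ) (ns nt l k j : ℤ) : ℂ :=
  (r ^ 2) ^ (ns + nt) / (ω ^ (2 * k) * s ^ (2 * ns) * y ^ (2 * l) * (s * t) ^ (2 * (ns + nt)) *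
    x ^ (2 * j) * t ^ (2 * nt))

/-- Each of the three kernels supplies four quotients, that is two of the six parameters, and one
factor `z^(-2m)`. -/
lemma star_integrand {r s t y ω x z : ℂ} (hz : z ≠ 0) (ns nt l k j m : ℤ) :
    density r m z * (regK r s ns (s ^ (2 * ns)) ω k z m * regD r (s * t) (ns + nt) y l z m) *
      regK r t nt (t ^ (2 * nt)) z m x j =
      starM r s t y ω x ns nt l k j * betaTerm r (starA r s t y ω x) (starN ns nt l k j) m z := by
  have ez : z ^ (-6 * m) = (z ^ (2 * m))⁻¹ * (z ^ (2 * m))⁻¹ * (z ^ (2 * m))⁻¹ := by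
    rw [← zpow_neg, ← zpow_add₀ hz, ← zpow_add₀ hz]
    congr 1; ring
  unfold regK regD betaTerm starM
  simp only [Fin.prod_univ_six, starA, starN, Matrix.cons_val]
  rw [ez,
    show gQuot r (-k + ns + m) (s * z / ω) = gQuot r (-k + ns + m) (s / ω * z) by congr 1; ring,
    show gQuot r (-k + ns - m) (s / (ω * z)) = gQuot r (-k + ns - m) (s / ω / z) by
      rw [div_div],
    show gQuot r (l - (ns + nt) + m) (r * (y * z / (s * t))) =
      gQuot r (l - (ns + nt) + m) (r * y / (s * t) * z) by congr 1; ring,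
    show gQuot r (l - (ns + nt) - m) (r * (y / (s * t * z))) =
      gQuot r (l - (ns + nt) - m) (r * y / (s * t) / z) by rw [div_div, mul_div_assoc],
    show gQuot r (-l - (ns + nt) + m) (r * (z / (s * t * y))) =
      gQuot r (-l - (ns + nt) + m) (r / (s * t * y) * z) by congr 1; ring,
    show gQuot r (-l - (ns + nt) - m) (r * (1 / (s * t * y * z))) =
      gQuot r (-l - (ns + nt) - m) (r / (s * t * y) / z) by rw [div_div, mul_one_div],
    show gQuot r (m + nt + j) (t * z * x) = gQuot r (j + nt + m) (t * x * z) by congr 1 <;> ring,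
    show gQuot r (m + nt - j) (t * z / x) = gQuot r (-j + nt + m) (t / x * z) by congr 1 <;> ring,
    show gQuot r (-m + nt + j) (t * x / z) = gQuot r (j + nt - m) (t * x / z) by congr 1; ring,
    show gQuot r (-m + nt - j) (t / (z * x)) = gQuot r (-j + nt - m) (t / x / z) by
      rw [div_div, mul_comm z x]; congr 1; ring]
  generalize gQuot r _ (s * ω * z) = G1
  generalize gQuot r _ (s * ω / z) = G2
  generalize gQuot r _ (s / ω * z) = G3
  generalize gQuot r _ (s / ω / z) = G4
  generalize gQuot r _ (r * y / (s * t) * z) = G5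
  generalize gQuot r _ (r * y / (s * t) / z) = G6
  generalize gQuot r _ (r / (s * t * y) * z) = G7
  generalize gQuot r _ (r / (s * t * y) / z) = G8
  generalize gQuot r _ (t * x * z) = G9
  generalize gQuot r _ (t * x / z) = G10
  generalize gQuot r _ (t / x * z) = G11
  generalize gQuot r _ (t / x / z) = G12
  generalize z ^ (2 * m) = Z
  generalize ω ^ (2 * k) = E1
  generalize s ^ (2 * ns) = E2
  generalize y ^ (2 * l) = E3
  generalize (s * t) ^ (2 * (ns + nt)) = E4
  generalize x ^ (2 * j) = E5
  generalize t ^ (2 * nt) = E6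
  ring

/-- Pure bookkeeping of powers. The last factor on the left comes from inverting the quotient at
`q/(st)²`; its even exponent removes the sign. -/
lemma star_monomial {r s t y ω x : ℂ} (hr : r ≠ 0) (hs : s ≠ 0) (ht : t ≠ 0) (hy : y ≠ 0)
    (hω : ω ≠ 0) (hx : x ≠ 0) (ns nt l k j : ℤ) :
    starM r s t y ω x ns nt l k j * (∏ i, starA r s t y ω x i ^ (-starN ns nt l k j i)) *
        (-(s * t) ^ 2 / r) ^ (2 * (ns + nt)) =
      (r ^ 2) ^ nt / (ω ^ (2 * k) * y ^ (2 * l) * t ^ (2 * nt)) *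
        (1 / (x ^ (2 * j) * ω ^ (2 * k) * (s ^ (2 * ns) * t ^ (2 * nt)))) *
        ((r ^ 2) ^ ns / (x ^ (2 * j) * y ^ (2 * l) * s ^ (2 * ns))) := by
  unfold starM
  rw [neg_div, Even.neg_zpow (even_two_mul _)]
  simp only [Fin.prod_univ_six, starA, starN, Matrix.cons_val, pow_two, two_mul, neg_add,
    sub_eq_add_neg, zpow_add₀ hr, zpow_add₀ hs, zpow_add₀ ht, zpow_add₀ hy, zpow_add₀ hω,
    zpow_add₀ hx, mul_zpow, div_zpow, zpow_neg]
  have h1 : r ^ ns ≠ 0 := zpow_ne_zero _ hr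
  have h2 : r ^ nt ≠ 0 := zpow_ne_zero _ hr
  have h3 : r ^ l ≠ 0 := zpow_ne_zero _ hr
  have h4 : s ^ ns ≠ 0 := zpow_ne_zero _ hs
  have h5 : s ^ nt ≠ 0 := zpow_ne_zero _ hs
  have h6 : s ^ l ≠ 0 := zpow_ne_zero _ hs
  have h7 : s ^ k ≠ 0 := zpow_ne_zero _ hs
  have h8 : t ^ ns ≠ 0 := zpow_ne_zero _ ht
  have h9 : t ^ nt ≠ 0 := zpow_ne_zero _ ht
  have h10 : t ^ l ≠ 0 := zpow_ne_zero _ ht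
  have h11 : t ^ j ≠ 0 := zpow_ne_zero _ ht
  have h12 : y ^ ns ≠ 0 := zpow_ne_zero _ hy
  have h13 : y ^ nt ≠ 0 := zpow_ne_zero _ hy
  have h14 : y ^ l ≠ 0 := zpow_ne_zero _ hy
  have h15 : ω ^ k ≠ 0 := zpow_ne_zero _ hω
  have h16 : ω ^ ns ≠ 0 := zpow_ne_zero _ hω
  have h17 : x ^ j ≠ 0 := zpow_ne_zero _ hx
  have h18 : x ^ nt ≠ 0 := zpow_ne_zero _ hx
  generalize r ^ ns = a1 at *
  generalize r ^ nt = a2 at *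
  generalize r ^ l = a3 at *
  generalize s ^ ns = a4 at *
  generalize s ^ nt = a5 at *
  generalize s ^ l = a6 at *
  generalize s ^ k = a7 at *
  generalize t ^ ns = a8 at *
  generalize t ^ nt = a9 at *
  generalize t ^ l = a10 at *
  generalize t ^ j = a11 at *
  generalize y ^ ns = a12 at *
  generalize y ^ nt = a13 at *
  generalize y ^ l = a14 at *
  generalize ω ^ k = a15 at *
  generalize ω ^ ns = a16 at *
  generalize x ^ j = a17 at *
  generalize x ^ nt = a18 at *
  field_simp

/-- The closed form of the beta integral in the star-triangle relation. -/
lemma star_betaProd {r s t y ω x : ℂ} (hr : r ≠ 0) (hr1 : ‖r‖ < 1) (h : StarDom r s t y ω)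
    (hx : ‖x‖ = 1) (ns nt l k j : ℤ) :
    prefactor r s ns * prefactor r t nt * (starM r s t y ω x ns nt l k j *
        betaProd r (starA r s t y ω x) (starN ns nt l k j)) =
      prefactor r (s * t) (ns + nt) * (regD r t nt y l ω k *
        (regK r (s * t) (ns + nt) (s ^ (2 * ns) * t ^ (2 * nt)) ω k x j *
          regD r s ns y l x j)) := by
  obtain ⟨⟨s1, s2⟩, ⟨t1, t2⟩, ⟨st1, st2⟩⟩ := h.norm_sq hr
  obtain ⟨hs, ht, hy, hω, -⟩ := h
  have hx0 : x ≠ 0 := norm_pos_iff.mp (by rw [hx]; exact one_pos)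
  have hm := star_monomial hr hs ht hy hω hx0 ns nt l k j
  have q1 := gQuot_ne_zero hr hr1 (2 * ns) s1 s2
  have q2 := gQuot_ne_zero hr hr1 (2 * nt) t1 t2
  have q3 := gQuot_ne_zero hr hr1 (2 * (ns + nt)) st1 st2
  have hG := gQuot_mul_gQuot_div hr hr1 (2 * (ns + nt)) st1 st2
  rw [prefactor_eq hr hr1 ns s1 s2, prefactor_eq hr hr1 nt t1 t2,
    prefactor_eq hr hr1 (ns + nt) st1 st2]
  unfold betaProd regD regK
  generalize (∏ i, starA r s t y ω x i ^ (-starN ns nt l k j i)) = P at *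
  generalize starM r s t y ω x ns nt l k j = M at *
  simp only [starA, starN, Matrix.cons_val]
  rw [show gQuot r (k + ns + (-k + ns)) (s * ω * (s / ω)) = gQuot r (2 * ns) (s ^ 2) by
      congr 1
      · ring
      · field_simp,
    show gQuot r (j + nt + (-j + nt)) (t * x * (t / x)) = gQuot r (2 * nt) (t ^ 2) by
      congr 1
      · ring
      · field_simp,
    show gQuot r (l - (ns + nt) + (-l - (ns + nt))) (r * y / (s * t) * (r / (s * t * y))) =
      gQuot r (-(2 * (ns + nt))) (r ^ 2 / (s * t) ^ 2) by
      congr 1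
      · ring
      · field_simp,
    show gQuot r (k + ns + (l - (ns + nt))) (s * ω * (r * y / (s * t))) =
      gQuot r (l - nt + k) (r * (y * ω / t)) by
      congr 1
      · ring
      · field_simp,
    show gQuot r (k + ns + (-l - (ns + nt))) (s * ω * (r / (s * t * y))) =
      gQuot r (-l - nt + k) (r * (ω / (t * y))) by
      congr 1
      · ring
      · field_simp,
    show gQuot r (-k + ns + (l - (ns + nt))) (s / ω * (r * y / (s * t))) =
      gQuot r (l - nt - k) (r * (y / (t * ω))) by
      congr 1
      · ring
      · field_simp,
    show gQuot r (-k + ns + (-l - (ns + nt))) (s / ω * (r / (s * t * y))) =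
      gQuot r (-l - nt - k) (r * (1 / (t * y * ω))) by
      congr 1
      · ring
      · field_simp,
    show gQuot r (k + ns + (j + nt)) (s * ω * (t * x)) =
      gQuot r (k + (ns + nt) + j) (s * t * ω * x) by congr 1 <;> ring,
    show gQuot r (k + ns + (-j + nt)) (s * ω * (t / x)) =
      gQuot r (k + (ns + nt) - j) (s * t * ω / x) by congr 1 <;> ring,
    show gQuot r (-k + ns + (j + nt)) (s / ω * (t * x)) =
      gQuot r (-k + (ns + nt) + j) (s * t * x / ω) by congr 1 <;> ring,
    show gQuot r (-k + ns + (-j + nt)) (s / ω * (t / x)) =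
      gQuot r (-k + (ns + nt) - j) (s * t / (ω * x)) by
      congr 1
      · ring
      · field_simp,
    show gQuot r (l - (ns + nt) + (j + nt)) (r * y / (s * t) * (t * x)) =
      gQuot r (l - ns + j) (r * (y * x / s)) by
      congr 1
      · ring
      · field_simp,
    show gQuot r (l - (ns + nt) + (-j + nt)) (r * y / (s * t) * (t / x)) =
      gQuot r (l - ns - j) (r * (y / (s * x))) by
      congr 1
      · ring
      · field_simp,
    show gQuot r (-l - (ns + nt) + (j + nt)) (r / (s * t * y) * (t * x)) =
      gQuot r (-l - ns + j) (r * (x / (s * y))) by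
      congr 1
      · ring
      · field_simp,
    show gQuot r (-l - (ns + nt) + (-j + nt)) (r / (s * t * y) * (t / x)) =
      gQuot r (-l - ns - j) (r * (1 / (s * y * x))) by
      congr 1
      · ring
      · field_simp]
  generalize gQuot r (2 * ns) (s ^ 2) = Q1 at *
  generalize gQuot r (2 * nt) (t ^ 2) = Q2 at *
  generalize gQuot r (2 * (ns + nt)) ((s * t) ^ 2) = Q3 at *
  generalize gQuot r (-(2 * (ns + nt))) (r ^ 2 / (s * t) ^ 2) = Q4 at *
  -- The pair `(2, 3)` is the inversion of the quotient at `(st)²`, which produces the prefactor of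
  -- the composite operator. The pairs `(0, 1)` and `(4, 5)` cancel the prefactors for `s` and `t`;
  -- the other twelve pairs are the three kernels on the right.
  have hQ4 : Q4 = Q3⁻¹ * (-(s * t) ^ 2 / r) ^ (2 * (ns + nt)) := by
    rw [← hG, inv_mul_cancel_left₀ q3]
  rw [hQ4]
  generalize (-(s * t) ^ 2 / r) ^ (2 * (ns + nt)) = W at *
  generalize gQuot r _ (r * (y * ω / t)) = G1
  generalize gQuot r _ (r * (ω / (t * y))) = G2
  generalize gQuot r _ (r * (y / (t * ω))) = G3
  generalize gQuot r _ (r * (1 / (t * y * ω))) = G4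
  generalize gQuot r _ (s * t * ω * x) = G5
  generalize gQuot r _ (s * t * ω / x) = G6
  generalize gQuot r _ (s * t * x / ω) = G7
  generalize gQuot r _ (s * t / (ω * x)) = G8
  generalize gQuot r _ (r * (y * x / s)) = G9
  generalize gQuot r _ (r * (y / (s * x))) = G10
  generalize gQuot r _ (r * (x / (s * y))) = G11
  generalize gQuot r _ (r * (1 / (s * y * x))) = G12
  generalize (r ^ 2) ^ nt / (ω ^ (2 * k) * y ^ (2 * l) * t ^ (2 * nt)) = M1 at *
  generalize 1 / (x ^ (2 * j) * ω ^ (2 * k) * (s ^ (2 * ns) * t ^ (2 * nt))) = M2 at *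
  generalize (r ^ 2) ^ ns / (x ^ (2 * j) * y ^ (2 * l) * s ^ (2 * ns)) = M3 at *
  calc _ = (Q1⁻¹ * Q1) * (Q2⁻¹ * Q2) * Q3⁻¹ * (M * P * W) * (G1 * G2 * G3 * G4) *
        (G5 * G6 * G7 * G8) * (G9 * G10 * G11 * G12) := by ring
    _ = Q3⁻¹ * (M1 * M2 * M3) * (G1 * G2 * G3 * G4) *
        (G5 * G6 * G7 * G8) * (G9 * G10 * G11 * G12) := by
        rw [inv_mul_cancel₀ q1, inv_mul_cancel₀ q2, hm, one_mul, one_mul]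
    _ = _ := by ring

lemma star_integral {r s t y ω x : ℂ} (hr : r ≠ 0) (hr1 : ‖r‖ < 1) (h : StarDom r s t y ω)
    (hx : ‖x‖ = 1) (ns nt l k j : ℤ) :
    prefactor r s ns * prefactor r t nt * ∫ p : ℤ × ℝ, density r p.1 (circleMap 0 1 p.2) *
        (regK r s ns (s ^ (2 * ns)) ω k (circleMap 0 1 p.2) p.1 *
          regD r (s * t) (ns + nt) y l (circleMap 0 1 p.2) p.1) *
        regK r t nt (t ^ (2 * nt)) (circleMap 0 1 p.2) p.1 x j ∂sumMeas =
      4 * Real.pi * (prefactor r (s * t) (ns + nt) * (regD r t nt y l ω k *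
        (regK r (s * t) (ns + nt) (s ^ (2 * ns) * t ^ (2 * nt)) ω k x j *
          regD r s ns y l x j))) := by
  simp_rw [star_integrand (circleMap_ne_center one_ne_zero)]
  rw [integral_const_mul, ← star_betaProd hr hr1 h hx]
  have := betaInt_eq hr hr1 (h.betaDom hr hx) (sum_starN ns nt l k j)
  rw [betaInt] at this
  rw [this]
  ring

/-! ### Measurability and domination of the kernels -/

lemma measurable_gQuot {r : ℂ} (hr1 : ‖r‖ < 1) {X : Type*} [MeasurableSpace X] {f : X → ℤ}
    {g : X → ℂ} (hf : Measurable f) (hg : Measurable g) :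
    Measurable fun x => gQuot r (f x) (g x) := by
  have hc := (continuous_qPoch (norm_sq_lt_one hr1)).measurable
  have h : Measurable fun p : ℤ × ℂ => gQuot r p.1 p.2 := by
    refine measurable_from_prod_countable_right fun k => ?_
    change Measurable (gQuot r k)
    unfold gQuot gMon
    refine Measurable.mul ?_ ((hc.comp (by fun_prop)).div (hc.comp (by fun_prop)))
    split_ifs
    · exact measurable_const
    · exact (measurable_neg.div_const r).pow_const k
  exact h.comp (hf.prodMk hg)

lemma measurable_regK {r : ℂ} (hr1 : ‖r‖ < 1) (t : ℂ) (N : ℤ) (c : ℂ) {X : Type*}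
    [MeasurableSpace X] {x z : X → ℂ} {m n : X → ℤ} (hx : Measurable x) (hm : Measurable m)
    (hz : Measurable z) (hn : Measurable n) :
    Measurable fun p => regK r t N c (x p) (m p) (z p) (n p) := by
  unfold regK
  refine Measurable.mul (measurable_const.div (((hz.pow (hn.const_mul 2)).mul
    (hx.pow (hm.const_mul 2))).mul_const c)) ?_
  refine ((Measurable.mul ?_ ?_).mul ?_).mul ?_ <;>
    exact measurable_gQuot hr1 (by fun_prop) (by fun_prop)

lemma measurable_regD {r : ℂ} (hr1 : ‖r‖ < 1) (t : ℂ) (N : ℤ) (w : ℂ) (n : ℤ) {X : Type*}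
    [MeasurableSpace X] {z : X → ℂ} {m : X → ℤ} (hz : Measurable z) (hm : Measurable m) :
    Measurable fun p => regD r t N w n (z p) (m p) := by
  unfold regD
  refine Measurable.mul (measurable_const.div (((hz.pow (hm.const_mul 2)).mul_const _).mul_const
    _)) ?_
  refine ((Measurable.mul ?_ ?_).mul ?_).mul ?_ <;>
    exact measurable_gQuot hr1 (by fun_prop) (by fun_prop)

lemma measurable_density (r : ℂ) {X : Type*} [MeasurableSpace X] {z : X → ℂ} {m : X → ℤ}
    (hz : Measurable z) (hm : Measurable m) : Measurable fun p => density r (m p) (z p) := by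
  have h : Measurable fun p => (r ^ 2) ^ m p := measurable_const.pow hm
  unfold density
  exact ((measurable_const.sub (h.mul (hz.pow_const 2))).mul
    (measurable_const.sub (h.div (hz.pow_const 2)))).div h

lemma measurable_circleMap_snd : Measurable fun p : ℤ × ℝ => circleMap 0 1 p.2 :=
  (continuous_circleMap 0 1).measurable.comp measurable_snd

lemma exists_norm_pair_le {r : ℂ} (hr : r ≠ 0) (hr1 : ‖r‖ < 1) {b : ℂ} (hb : b ≠ 0)
    (hb1 : ‖b‖ < 1) (n : ℤ) : ∃ C : ℝ, 0 < C ∧ ∀ (m : ℤ) (z : ℂ), ‖z‖ = 1 →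
      ‖gQuot r (n + m) (b * z)‖ * ‖gQuot r (n - m) (b / z)‖ ≤ C * (‖r‖ / ‖b‖) ^ m.natAbs := by
  have hr' := norm_pos_iff.mpr hr
  have hx := norm_pos_iff.mpr hb
  obtain ⟨C, hC, hCb⟩ := exists_norm_gQuot_le hr hr1 hx hb1
  obtain ⟨K, hK1, hK2, hK3⟩ : ∃ K : ℝ, 1 ≤ K ∧ ‖b‖ / ‖r‖ ≤ K ∧ ‖r‖ / ‖b‖ ≤ K :=
    ⟨max 1 (max (‖b‖ / ‖r‖) (‖r‖ / ‖b‖)), by simp, by simp, by simp⟩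
  refine ⟨C * C * K ^ (2 * n.natAbs), by positivity, fun m z hz => ?_⟩
  have hle : ∀ (k : ℤ) (w : ℂ), ‖w‖ = ‖b‖ → ‖gQuot r k w‖ ≤ C * gSize r k ‖b‖ := fun k w hw => by
    rw [← hw]
    refine hCb k w hw.ge ?_
    rw [norm_mul, ← hw]
    exact mul_le_of_le_one_left (norm_nonneg _) (norm_zpow_abs_le_one hr1 k)
  have g1 := hle (n + m) (b * z) (by simp [hz])
  have g2 := hle (n - m) (b / z) (by simp [hz])
  calc _ ≤ (C * gSize r (n + m) ‖b‖) * (C * gSize r (n - m) ‖b‖) :=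
        mul_le_mul g1 g2 (norm_nonneg _) ((norm_nonneg _).trans g1)
    _ = C * C * (gSize r (n + m) ‖b‖ * gSize r (n - m) ‖b‖) := by ring
    _ ≤ C * C * (K ^ (2 * n.natAbs) * (‖r‖ / ‖b‖) ^ m.natAbs) := by
        exact mul_le_mul_of_nonneg_left (gSize_mul_le hr hx hK1 hK2 hK3 n m) (by positivity)
    _ = _ := by ring

lemma exists_norm_regK_le {r : ℂ} (hr : r ≠ 0) (hr1 : ‖r‖ < 1) {t x : ℂ} (ht : t ≠ 0)
    (hx : x ≠ 0) (h1 : ‖t * x‖ < 1) (h2 : ‖t / x‖ < 1) (N : ℤ) (c : ℂ) (m : ℤ) :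
    ∃ C : ℝ, 0 ≤ C ∧ ∀ (n : ℤ) (z : ℂ), ‖z‖ = 1 → ‖regK r t N c x m z n‖ ≤
      C * ((‖r‖ ^ 2 / (‖t * x‖ * ‖t / x‖)) ^ n.natAbs) := by
  obtain ⟨C1, hC1, hb1⟩ := exists_norm_pair_le hr hr1 (mul_ne_zero ht hx) h1 (m + N)
  obtain ⟨C2, hC2, hb2⟩ := exists_norm_pair_le hr hr1 (div_ne_zero ht hx) h2 (-m + N)
  refine ⟨‖1 / (x ^ (2 * m) * c)‖ * (C1 * C2), by positivity, fun n z hz => ?_⟩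
  have hw : ‖1 / (z ^ (2 * n) * x ^ (2 * m) * c)‖ = ‖1 / (x ^ (2 * m) * c)‖ := by simp [hz]
  have g1 := hb1 n z hz
  have g2 := hb2 n z hz
  unfold regK
  rw [show t * z / x = t / x * z by ring, show t / (x * z) = t / x / z by rw [div_div],
    norm_mul, hw, norm_mul (_ * _ * _), norm_mul (_ * _), norm_mul]
  calc _ = ‖1 / (x ^ (2 * m) * c)‖ * ((‖gQuot r (m + N + n) (t * x * z)‖ *
        ‖gQuot r (m + N - n) (t * x / z)‖) * (‖gQuot r (-m + N + n) (t / x * z)‖ *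
          ‖gQuot r (-m + N - n) (t / x / z)‖)) := by ring
    _ ≤ ‖1 / (x ^ (2 * m) * c)‖ * ((C1 * (‖r‖ / ‖t * x‖) ^ n.natAbs) *
        (C2 * (‖r‖ / ‖t / x‖) ^ n.natAbs)) := by gcongr
    _ = ‖1 / (x ^ (2 * m) * c)‖ * (C1 * C2) *
        ((‖r‖ / ‖t * x‖) * (‖r‖ / ‖t / x‖)) ^ n.natAbs := by rw [mul_pow]; ring
    _ = _ := by rw [div_mul_div_comm, ← sq]

lemma exists_norm_regD_le {r : ℂ} (hr : r ≠ 0) (hr1 : ‖r‖ < 1) {t w : ℂ} (ht : t ≠ 0)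
    (hw : w ≠ 0) (h1 : ‖r * w / t‖ < 1) (h2 : ‖r / (t * w)‖ < 1) (N n : ℤ) :
    ∃ C : ℝ, 0 ≤ C ∧ ∀ (m : ℤ) (z : ℂ), ‖z‖ = 1 → ‖regD r t N w n z m‖ ≤
      C * ((‖t‖ ^ 2) ^ m.natAbs) := by
  have hr' := norm_pos_iff.mpr hr
  have ht' := norm_pos_iff.mpr ht
  have hw' := norm_pos_iff.mpr hw
  obtain ⟨C1, hC1, hb1⟩ := exists_norm_pair_le hr hr1 (div_ne_zero (mul_ne_zero hr hw) ht) h1 (n - N)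
  obtain ⟨C2, hC2, hb2⟩ := exists_norm_pair_le hr hr1 (div_ne_zero hr (mul_ne_zero ht hw)) h2
    (-n - N)
  refine ⟨‖(r ^ 2) ^ N / (w ^ (2 * n) * t ^ (2 * N))‖ * (C1 * C2), by positivity,
    fun m z hz => ?_⟩
  have hww : ‖(r ^ 2) ^ N / (z ^ (2 * m) * w ^ (2 * n) * t ^ (2 * N))‖ =
      ‖(r ^ 2) ^ N / (w ^ (2 * n) * t ^ (2 * N))‖ := by simp [hz]
  have g1 := hb1 m z hz
  have g2 := hb2 m z hz
  unfold regD
  rw [show r * (w * z / t) = r * w / t * z by ring,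
    show r * (w / (t * z)) = r * w / t / z by rw [div_div, mul_div_assoc],
    show r * (z / (t * w)) = r / (t * w) * z by ring,
    show r * (1 / (t * w * z)) = r / (t * w) / z by rw [div_div, mul_one_div]]
  rw [norm_mul, hww, norm_mul, norm_mul, norm_mul]
  have e : ‖r‖ / ‖r * w / t‖ * (‖r‖ / ‖r / (t * w)‖) = ‖t‖ ^ 2 := by
    simp only [norm_mul, norm_div]
    field_simp
  calc _ = ‖(r ^ 2) ^ N / (w ^ (2 * n) * t ^ (2 * N))‖ *
        ((‖gQuot r (n - N + m) (r * w / t * z)‖ * ‖gQuot r (n - N - m) (r * w / t / z)‖) *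
          (‖gQuot r (-n - N + m) (r / (t * w) * z)‖ *
            ‖gQuot r (-n - N - m) (r / (t * w) / z)‖)) := by ring
    _ ≤ ‖(r ^ 2) ^ N / (w ^ (2 * n) * t ^ (2 * N))‖ *
        ((C1 * (‖r‖ / ‖r * w / t‖) ^ m.natAbs) * (C2 * (‖r‖ / ‖r / (t * w)‖) ^ m.natAbs)) := by
        gcongr
    _ = ‖(r ^ 2) ^ N / (w ^ (2 * n) * t ^ (2 * N))‖ * (C1 * C2) *
        (‖r‖ / ‖r * w / t‖ * (‖r‖ / ‖r / (t * w)‖)) ^ m.natAbs := by rw [mul_pow]; ring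
    _ = _ := by rw [e]

/-- The part of the integrand of the star-triangle relation without the inner kernel. -/
noncomputable def outerTerm (r s t y ω : ℂ) (ns nt l k : ℤ) (p : ℤ × ℝ) : ℂ :=
  density r p.1 (circleMap 0 1 p.2) *
    (regK r s ns (s ^ (2 * ns)) ω k (circleMap 0 1 p.2) p.1 *
      regD r (s * t) (ns + nt) y l (circleMap 0 1 p.2) p.1)

/-- The rates of density, kernel and `regD` are `‖r‖⁻²`, `‖r‖²/‖s‖²` and `‖st‖²`; their product is
`‖t‖² < 1`. -/
lemma integrable_outerTerm {r s t y ω : ℂ} (hr : r ≠ 0) (hr1 : ‖r‖ < 1) (h : StarDom r s t y ω)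
    (ns nt l k : ℤ) : Integrable (outerTerm r s t y ω ns nt l k) sumMeas := by
  have hr' := norm_pos_iff.mpr hr
  have hs' := norm_pos_iff.mpr h.s_ne
  have hω' := norm_pos_iff.mpr h.ω_ne
  have hz := measurable_circleMap_snd
  obtain ⟨C1, hC1, hb1⟩ := exists_norm_regK_le hr hr1 h.s_ne h.ω_ne h.sω_lt h.sω_lt' ns
    (s ^ (2 * ns)) k
  obtain ⟨C2, hC2, hb2⟩ := exists_norm_regD_le hr hr1 (mul_ne_zero h.s_ne h.t_ne) h.y_ne h.y_lt
    h.y_lt' (ns + nt) l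
  refine (integrable_pow_natAbs (x := ‖t‖ ^ 2) (by positivity)
    (pow_lt_one₀ (norm_nonneg t) h.t_lt two_ne_zero) (4 * (C1 * C2))).mono' ?_
    (.of_forall fun p => ?_)
  · exact ((measurable_density r hz measurable_fst).mul
      ((measurable_regK hr1 s ns _ measurable_const measurable_const hz measurable_fst).mul
        (measurable_regD hr1 _ _ y l hz measurable_fst))).aestronglyMeasurable
  · have hn : ‖circleMap 0 1 p.2‖ = 1 := by simp
    unfold outerTerm
    rw [norm_mul, norm_mul]
    calc _ ≤ (4 * (‖r‖ ^ 2)⁻¹ ^ p.1.natAbs) *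
          ((C1 * (‖r‖ ^ 2 / (‖s * ω‖ * ‖s / ω‖)) ^ p.1.natAbs) *
            (C2 * (‖s * t‖ ^ 2) ^ p.1.natAbs)) := by
          gcongr
          · exact norm_density_le hr hr1 _ hn
          · exact hb1 _ _ hn
          · exact hb2 _ _ hn
      _ = 4 * (C1 * C2) * ((‖r‖ ^ 2)⁻¹ * ((‖r‖ ^ 2 / (‖s * ω‖ * ‖s / ω‖)) *
          ‖s * t‖ ^ 2)) ^ p.1.natAbs := by rw [mul_pow, mul_pow]; ring
      _ = _ := by
          congr 2
          simp only [norm_mul, norm_div]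
          field_simp

/-- Allows division by the kernel: measurability of the family `α`, weighted by the density, is
recovered from that of the integrand. -/
lemma regK_ne_zero {r t c x z : ℂ} (hr : r ≠ 0) (hr1 : ‖r‖ < 1) (h1 : ‖r ^ 2‖ < ‖t‖)
    (h2 : ‖t‖ < 1) (hc : c ≠ 0) (hx : ‖x‖ = 1) (hz : ‖z‖ = 1) (N m n : ℤ) :
    regK r t N c x m z n ≠ 0 := by
  have hx0 : x ≠ 0 := norm_pos_iff.mp (by rw [hx]; exact one_pos)
  have hz0 : z ≠ 0 := norm_pos_iff.mp (by rw [hz]; exact one_pos)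
  have hg : ∀ (k : ℤ) (w : ℂ), ‖w‖ = ‖t‖ → gQuot r k w ≠ 0 := fun k w hw =>
    gQuot_ne_zero hr hr1 k (hw ▸ h1) (hw ▸ h2)
  unfold regK
  refine mul_ne_zero (one_div_ne_zero (mul_ne_zero (mul_ne_zero (zpow_ne_zero _ hz0)
    (zpow_ne_zero _ hx0)) hc)) ?_
  refine mul_ne_zero (mul_ne_zero (mul_ne_zero (hg _ _ ?_) (hg _ _ ?_)) (hg _ _ ?_)) (hg _ _ ?_) <;>
    simp [hx, hz]

/-- The kernels at different points of the unit circle are comparable. -/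
lemma exists_norm_regK_le_regK {r t c : ℂ} (hr : r ≠ 0) (hr1 : ‖r‖ < 1) (h1 : ‖r‖ < ‖t‖)
    (h2 : ‖t‖ < 1) (N : ℤ) : ∃ C : ℝ, 0 ≤ C ∧ ∀ (m n : ℤ) (x z : ℂ), ‖x‖ = 1 → ‖z‖ = 1 →
      ‖regK r t N c x m z n‖ ≤ C * ‖regK r t N c 1 0 z n‖ := by
  have hr' := norm_pos_iff.mpr hr
  have ht' := hr'.trans h1
  have hrt : ‖r ^ 2‖ < ‖t‖ := by
    rw [norm_pow]; nlinarith
  obtain ⟨C, hC, hCb⟩ := exists_norm_gQuot_le hr hr1 ht' h2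
  obtain ⟨d, hd, hdb⟩ := exists_le_norm_gQuot hr hr1 hrt h2
  have hup : ∀ (k : ℤ) (w : ℂ), ‖w‖ = ‖t‖ → ‖gQuot r k w‖ ≤ C * gSize r k ‖t‖ := fun k w hw => by
    rw [← hw]
    refine hCb k w hw.ge ?_
    rw [norm_mul, ← hw]
    exact mul_le_of_le_one_left (norm_nonneg _) (norm_zpow_abs_le_one hr1 k)
  have hlo : ∀ (k : ℤ) (w : ℂ), ‖w‖ = ‖t‖ → d * gSize r k ‖t‖ ≤ ‖gQuot r k w‖ := fun k w hw => by
    rw [← hw]; exact hdb k w hw.ge hw.le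
  have hX : 1 ≤ ‖t‖ / ‖r‖ := (one_le_div hr').mpr h1.le
  have hX0 : 0 < ‖t‖ / ‖r‖ := by positivity
  have hpos : ∀ k : ℤ, 0 < gSize r k ‖t‖ := fun k => by rw [gSize_eq]; positivity
  -- Concavity of `k ↦ min k 0`, with base `‖t‖/‖r‖ ≥ 1`: the size is largest at `m = 0`, so the
  -- kernel at `(0, 1)` dominates.
  have hG : ∀ a m : ℤ, gSize r (a + m) ‖t‖ * gSize r (a - m) ‖t‖ ≤
      gSize r a ‖t‖ * gSize r a ‖t‖ := fun a m => by
    simp only [gSize_eq]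
    rw [← zpow_add₀ hX0.ne', ← zpow_add₀ hX0.ne']
    exact zpow_le_zpow_right₀ hX (by omega)
  refine ⟨(C / d) ^ 4, by positivity, fun m n x z hx hz => ?_⟩
  have e1 : ‖1 / (z ^ (2 * n) * x ^ (2 * m) * c)‖ = ‖c‖⁻¹ := by simp [hx, hz]
  have e2 : ‖1 / (z ^ (2 * n) * 1 ^ (2 * (0 : ℤ)) * c)‖ = ‖c‖⁻¹ := by simp [hz]
  have n1 := hup (m + N + n) (t * x * z) (by simp [hx, hz])
  have n2 := hup (m + N - n) (t * x / z) (by simp [hx, hz])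
  have n3 := hup (-m + N + n) (t * z / x) (by simp [hx, hz])
  have n4 := hup (-m + N - n) (t / (x * z)) (by simp [hx, hz])
  have m1 := hlo (0 + N + n) (t * 1 * z) (by simp [hz])
  have m2 := hlo (0 + N - n) (t * 1 / z) (by simp [hz])
  have m3 := hlo (-0 + N + n) (t * z / 1) (by simp [hz])
  have m4 := hlo (-0 + N - n) (t / (1 * z)) (by simp [hz])
  have k1 := hG (N + n) m
  have k2 := hG (N - n) m
  rw [show N + n + m = m + N + n by ring, show N + n - m = -m + N + n by ring] at k1
  rw [show N - n + m = m + N - n by ring, show N - n - m = -m + N - n by ring] at k2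
  rw [neg_zero] at m3 m4
  rw [zero_add] at m1 m2 m3 m4
  unfold regK
  rw [norm_mul, e1, norm_mul (1 / (z ^ (2 * n) * 1 ^ (2 * (0 : ℤ)) * c)), e2, neg_zero, zero_add]
  rw [norm_mul (_ * _ * _), norm_mul (_ * _), norm_mul, norm_mul (_ * _ * _), norm_mul (_ * _),
    norm_mul (gQuot _ _ _)]
  have hp1 := hpos (m + N + n)
  have hp2 := hpos (m + N - n)
  have hp3 := hpos (-m + N + n)
  have hp4 := hpos (-m + N - n)
  have hp5 := hpos (N + n)
  have hp6 := hpos (N - n)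
  calc _ ≤ ‖c‖⁻¹ * ((C * gSize r (m + N + n) ‖t‖) * (C * gSize r (m + N - n) ‖t‖) *
        (C * gSize r (-m + N + n) ‖t‖) * (C * gSize r (-m + N - n) ‖t‖)) := by gcongr
    _ = ‖c‖⁻¹ * (C ^ 4 * ((gSize r (m + N + n) ‖t‖ * gSize r (-m + N + n) ‖t‖) *
        (gSize r (m + N - n) ‖t‖ * gSize r (-m + N - n) ‖t‖))) := by ring
    _ ≤ ‖c‖⁻¹ * (C ^ 4 * ((gSize r (N + n) ‖t‖ * gSize r (N + n) ‖t‖) *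
        (gSize r (N - n) ‖t‖ * gSize r (N - n) ‖t‖))) := by gcongr
    _ = (C / d) ^ 4 * (‖c‖⁻¹ * ((d * gSize r (N + n) ‖t‖) * (d * gSize r (N - n) ‖t‖) *
        (d * gSize r (N + n) ‖t‖) * (d * gSize r (N - n) ‖t‖))) := by field_simp
    _ ≤ _ := by gcongr

lemma integrable_regK {r : ℂ} (hr : r ≠ 0) (hr1 : ‖r‖ < 1) {t x : ℂ} (ht : t ≠ 0) (hx : x ≠ 0)
    (h1 : ‖t * x‖ < 1) (h2 : ‖t / x‖ < 1) (N : ℤ) (c : ℂ) (m : ℤ) {β : ℤ × ℝ → ℂ} :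
    Integrable (fun p : ℤ × ℝ => density r p.1 (circleMap 0 1 p.2) *
      (kernel r t N c x m (circleMap 0 1 p.2) p.1 * β p)) sumMeas ↔
    Integrable (fun p : ℤ × ℝ => density r p.1 (circleMap 0 1 p.2) *
      (regK r t N c x m (circleMap 0 1 p.2) p.1 * β p)) sumMeas := by
  refine integrable_congr ?_
  filter_upwards [ae_kernel_eq_regK hr hr1 ht hx h1 h2 N c m] with p hp
  rw [hp]

lemma integral_kernel {r : ℂ} (hr : r ≠ 0) (hr1 : ‖r‖ < 1) {t x : ℂ} (ht : t ≠ 0) (hx : x ≠ 0)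
    (h1 : ‖t * x‖ < 1) (h2 : ‖t / x‖ < 1) (N : ℤ) (c : ℂ) (m : ℤ) (β : ℤ × ℝ → ℂ) :
    ∫ p : ℤ × ℝ, density r p.1 (circleMap 0 1 p.2) *
      (kernel r t N c x m (circleMap 0 1 p.2) p.1 * β p) ∂sumMeas =
    ∫ p : ℤ × ℝ, density r p.1 (circleMap 0 1 p.2) *
      (regK r t N c x m (circleMap 0 1 p.2) p.1 * β p) ∂sumMeas := by
  refine integral_congr_ae ?_
  filter_upwards [ae_kernel_eq_regK hr hr1 ht hx h1 h2 N c m] with p hp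
  rw [hp]

/-! ### Exchange of the sum-integrals and the Bailey lemma -/

/-- The star-triangle relation, with the factor in front regularized. -/
theorem star_triangle {r s t y ω : ℂ} (hr : r ≠ 0) (hr1 : ‖r‖ < 1) (h : StarDom r s t y ω)
    (ns nt l k : ℤ) {α : ℤ → ℂ → ℂ}
    (hα : ∀ (m : ℤ) (z : ℂ), ‖z‖ = 1 → AbsConv r (integrandM r t nt α m z)) :
    AbsConv r (integrandM r s ns
        (fun m z => funD r (s * t) (ns + nt) y l z m * opM r t nt α m z) k ω) ∧
      AbsConv r (integrandMM r s t ns nt (fun j x => funD r s ns y l x j * α j x) k ω) ∧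
      opM r s ns (fun m z => funD r (s * t) (ns + nt) y l z m * opM r t nt α m z) k ω =
        regD r t nt y l ω k *
          opMM r s t ns nt (fun j x => funD r s ns y l x j * α j x) k ω := by
  obtain ⟨⟨s1, s2⟩, ⟨t1, t2⟩, ⟨st1, st2⟩⟩ := h.norm_sq hr
  have hs := h.s_ne
  have ht := h.t_ne
  have hy := h.y_ne
  have hω := h.ω_ne
  have hst := mul_ne_zero hs ht
  have hz1 : ∀ p : ℤ × ℝ, ‖circleMap 0 1 p.2‖ = 1 := fun p => by simp
  have hrt : ‖r‖ < ‖t‖ := by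
    rw [norm_pow, norm_pow] at t1
    exact lt_of_pow_lt_pow_left₀ 2 (norm_nonneg _) t1
  have hr2t : ‖r ^ 2‖ < ‖t‖ := by
    rw [norm_pow]; nlinarith [norm_nonneg r]
  have hc : t ^ (2 * nt) ≠ 0 := zpow_ne_zero _ ht
  have hpi : (Real.pi : ℂ) ≠ 0 := by exact_mod_cast Real.pi_ne_zero
  have hps : prefactor r s ns ≠ 0 := by
    rw [prefactor_eq hr hr1 ns s1 s2]; exact inv_ne_zero (gQuot_ne_zero hr hr1 _ s1 s2)
  have hpt : prefactor r t nt ≠ 0 := by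
    rw [prefactor_eq hr hr1 nt t1 t2]; exact inv_ne_zero (gQuot_ne_zero hr hr1 _ t1 t2)
  have hpst : prefactor r (s * t) (ns + nt) ≠ 0 := by
    rw [prefactor_eq hr hr1 _ st1 st2]; exact inv_ne_zero (gQuot_ne_zero hr hr1 _ st1 st2)
  -- the inner operator
  set a : ℤ × ℝ → ℂ := fun q =>
    density r q.1 (circleMap 0 1 q.2) * α q.1 (circleMap 0 1 q.2) with ha
  set K : ℤ × ℝ → ℤ × ℝ → ℂ := fun p q =>
    regK r t nt (t ^ (2 * nt)) (circleMap 0 1 p.2) p.1 (circleMap 0 1 q.2) q.1 with hK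
  set K₁ : ℤ × ℝ → ℂ := fun q => regK r t nt (t ^ (2 * nt)) 1 0 (circleMap 0 1 q.2) q.1 with hK₁
  set B := outerTerm r s t y ω ns nt l k with hB
  have hopM : ∀ p : ℤ × ℝ, opM r t nt α p.1 (circleMap 0 1 p.2) =
      prefactor r t nt * ((4 * Real.pi : ℂ)⁻¹ * ∫ q, K p q * a q ∂sumMeas) := by
    intro p
    have h1 : ‖t * circleMap 0 1 p.2‖ < 1 := by simpa using h.t_lt
    have h2 : ‖t / circleMap 0 1 p.2‖ < 1 := by simpa using h.t_lt
    have hi := integral_kernel hr hr1 ht (circleMap_ne_center one_ne_zero) h1 h2 nt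
      (t ^ (2 * nt)) p.1 fun q => α q.1 (circleMap 0 1 q.2)
    rw [opM, sumInt_eq (hα _ _ (hz1 p))]
    simp only [integrandM]
    rw [hi]
    congr 2
    refine integral_congr_ae (.of_forall fun q => ?_)
    simp only [hK, ha]
    ring
  have hA : Integrable (fun q => K₁ q * a q) sumMeas := by
    have h1 : ‖t * 1‖ < 1 := by simpa using h.t_lt
    have h2 : ‖t / 1‖ < 1 := by simpa using h.t_lt
    have := absConv_iff.mp (hα 0 1 norm_one)
    simp only [integrandM] at this
    rw [integrable_regK hr hr1 ht one_ne_zero h1 h2 nt _ 0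
      (β := fun q => α q.1 (circleMap 0 1 q.2))] at this
    refine this.congr (.of_forall fun q => ?_)
    simp only [hK₁, ha]
    ring
  have hBi : Integrable B sumMeas := integrable_outerTerm hr hr1 h ns nt l k
  have hK₁0 : ∀ q, K₁ q ≠ 0 := fun q =>
    regK_ne_zero hr hr1 hr2t h.t_lt hc norm_one (hz1 q) nt 0 q.1
  -- Comparability of the kernels bounds the double integrand by a multiple of `‖B p‖ ‖K₁ q * a q‖`,
  -- a product of integrable functions of separate variables.
  have hΦ : Integrable (fun w : (ℤ × ℝ) × (ℤ × ℝ) => B w.1 * (K w.1 w.2 * a w.2))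
      (sumMeas.prod sumMeas) := by
    obtain ⟨C, hC, hCb⟩ := exists_norm_regK_le_regK (c := t ^ (2 * nt)) hr hr1 hrt h.t_lt nt
    have ham : AEStronglyMeasurable a sumMeas := by
      have hm : Measurable K₁ := measurable_regK hr1 t nt _ measurable_const measurable_const
        measurable_circleMap_snd measurable_fst
      refine (hA.aestronglyMeasurable.mul hm.inv.aestronglyMeasurable).congr
        (.of_forall fun q => ?_)
      have := hK₁0 q
      simp only [Pi.mul_apply, Pi.inv_apply]
      field_simp
    have hKm : Measurable fun w : (ℤ × ℝ) × (ℤ × ℝ) => K w.1 w.2 :=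
      measurable_regK hr1 t nt _ (measurable_circleMap_snd.comp measurable_fst)
        (measurable_fst.comp measurable_fst) (measurable_circleMap_snd.comp measurable_snd)
        (measurable_fst.comp measurable_snd)
    refine ((hBi.mul_prod hA).norm.const_mul C).mono'
      (hBi.aestronglyMeasurable.comp_fst.mul (hKm.aestronglyMeasurable.mul ham.comp_snd))
      (.of_forall fun w => ?_)
    simp only [norm_mul]
    have := hCb w.1.1 w.2.1 _ _ (hz1 w.1) (hz1 w.2)
    calc _ ≤ ‖B w.1‖ * ((C * ‖K₁ w.2‖) * ‖a w.2‖) := by gcongr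
      _ = _ := by ring
  -- the inner integrals
  have hI1 : ∀ p, ∫ q, B p * (K p q * a q) ∂sumMeas = B p * ∫ q, K p q * a q ∂sumMeas := fun p =>
    integral_const_mul _ _
  set c : ℂ := 4 * Real.pi * prefactor r (s * t) (ns + nt) /
    (prefactor r s ns * prefactor r t nt) * regD r t nt y l ω k with hcdef
  set E : ℤ × ℝ → ℂ := fun q => density r q.1 (circleMap 0 1 q.2) *
    (regK r (s * t) (ns + nt) (s ^ (2 * ns) * t ^ (2 * nt)) ω k (circleMap 0 1 q.2) q.1 *
      (regD r s ns y l (circleMap 0 1 q.2) q.1 * α q.1 (circleMap 0 1 q.2))) with hE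
  have hI2 : ∀ q, ∫ p, B p * (K p q * a q) ∂sumMeas = c * E q := by
    intro q
    have h1 := star_integral hr hr1 h (hz1 q) ns nt l k q.1
    have h2 : ∫ p, B p * (K p q * a q) ∂sumMeas = (∫ p, B p * K p q ∂sumMeas) * a q := by
      rw [← integral_mul_const]
      simp only [mul_assoc]
    have h3 : ∫ p, B p * K p q ∂sumMeas = 4 * Real.pi * (prefactor r (s * t) (ns + nt) *
        (regD r t nt y l ω k * (regK r (s * t) (ns + nt) (s ^ (2 * ns) * t ^ (2 * nt)) ω k
          (circleMap 0 1 q.2) q.1 * regD r s ns y l (circleMap 0 1 q.2) q.1))) /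
            (prefactor r s ns * prefactor r t nt) := by
      rw [eq_div_iff (mul_ne_zero hps hpt), mul_comm]
      exact h1
    rw [h2, h3, hcdef]
    simp only [hE, ha]
    ring
  -- If it vanished, `star_betaProd` at `x = 1`, `j = 0` would make the nonvanishing closed form
  -- zero.
  have hDt : regD r t nt y l ω k ≠ 0 := by
    have hd := h.betaDom hr (x := 1) norm_one
    have h0 := star_betaProd hr hr1 h (x := 1) norm_one ns nt l k 0
    intro h1
    rw [h1, zero_mul, mul_zero] at h0
    refine mul_ne_zero (mul_ne_zero hps hpt) (mul_ne_zero ?_ (hd.betaProd_ne_zero hr hr1 _)) h0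
    unfold starM
    have z : ∀ (w : ℂ) (i : ℤ), w ≠ 0 → w ^ i ≠ 0 := fun w i hw => zpow_ne_zero i hw
    refine div_ne_zero (z _ _ (pow_ne_zero 2 hr)) ?_
    repeat' apply mul_ne_zero
    all_goals apply z
    all_goals first | assumption | exact one_ne_zero
  have hc0 : c ≠ 0 := mul_ne_zero (div_ne_zero (mul_ne_zero (mul_ne_zero (by norm_num) hpi) hpst)
    (mul_ne_zero hps hpt)) hDt
  have hsub := ae_funD_eq_regD hr hr1 hst hy h.y_lt h.y_lt' (ns + nt) l
  have hfub : ∫ p, B p * ∫ q, K p q * a q ∂sumMeas ∂sumMeas = c * ∫ q, E q ∂sumMeas := by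
    rw [← integral_const_mul]
    simp only [← hI1, ← hI2]
    exact integral_integral_swap hΦ
  -- Absolute convergence of the right-hand side is read off from Fubini: integrating out `p` gives
  -- `c * E`, and `c ≠ 0`.
  have hEi : Integrable E sumMeas := by
    have := (hΦ.integral_prod_right).const_mul c⁻¹
    refine this.congr (.of_forall fun q => ?_)
    simp only [hI2]
    rw [inv_mul_cancel_left₀ hc0]
  -- absolute convergence of the left-hand side
  have hL : (fun p : ℤ × ℝ => density r p.1 (circleMap 0 1 p.2) *
      (regK r s ns (s ^ (2 * ns)) ω k (circleMap 0 1 p.2) p.1 *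
        (funD r (s * t) (ns + nt) y l (circleMap 0 1 p.2) p.1 *
          opM r t nt α p.1 (circleMap 0 1 p.2)))) =ᵐ[sumMeas]
      fun p => prefactor r t nt * (4 * Real.pi : ℂ)⁻¹ * (B p * ∫ q, K p q * a q ∂sumMeas) := by
    filter_upwards [hsub] with p hp
    rw [hp, hopM, hB, outerTerm]
    ring
  have hLi : AbsConv r (integrandM r s ns
      (fun m z => funD r (s * t) (ns + nt) y l z m * opM r t nt α m z) k ω) := by
    rw [absConv_iff]
    simp only [integrandM]
    rw [integrable_regK hr hr1 hs hω h.sω_lt h.sω_lt' ns _ k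
      (β := fun p => funD r (s * t) (ns + nt) y l (circleMap 0 1 p.2) p.1 *
        opM r t nt α p.1 (circleMap 0 1 p.2)), integrable_congr hL]
    refine Integrable.const_mul ?_ _
    simp only [← hI1]
    exact hΦ.integral_prod_left
  have hstω : ‖s * t * ω‖ < 1 := by
    rw [show s * t * ω = s * ω * t by ring, norm_mul]
    exact mul_lt_one_of_nonneg_of_lt_one_left (norm_nonneg _) h.sω_lt h.t_lt.le
  have hstω' : ‖s * t / ω‖ < 1 := by
    rw [show s * t / ω = s / ω * t by ring, norm_mul]
    exact mul_lt_one_of_nonneg_of_lt_one_left (norm_nonneg _) h.sω_lt' h.t_lt.le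
  have hys : ‖r * y / s‖ < 1 := by
    rw [show r * y / s = r * y / (s * t) * t by field_simp, norm_mul]
    exact mul_lt_one_of_nonneg_of_lt_one_left (norm_nonneg _) h.y_lt h.t_lt.le
  have hys' : ‖r / (s * y)‖ < 1 := by
    rw [show r / (s * y) = r / (s * t * y) * t by field_simp, norm_mul]
    exact mul_lt_one_of_nonneg_of_lt_one_left (norm_nonneg _) h.y_lt' h.t_lt.le
  have hR : (fun q : ℤ × ℝ => density r q.1 (circleMap 0 1 q.2) *
      (regK r (s * t) (ns + nt) (s ^ (2 * ns) * t ^ (2 * nt)) ω k (circleMap 0 1 q.2) q.1 *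
        (funD r s ns y l (circleMap 0 1 q.2) q.1 * α q.1 (circleMap 0 1 q.2)))) =ᵐ[sumMeas] E := by
    filter_upwards [ae_funD_eq_regD hr hr1 hs hy hys hys' ns l] with q hq
    rw [hq]
  have hRi : AbsConv r (integrandMM r s t ns nt (fun j x => funD r s ns y l x j * α j x) k ω) := by
    rw [absConv_iff]
    simp only [integrandMM]
    rw [integrable_regK hr hr1 hst hω hstω hstω' (ns + nt) _ k
      (β := fun q => funD r s ns y l (circleMap 0 1 q.2) q.1 * α q.1 (circleMap 0 1 q.2)),
      integrable_congr hR]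
    exact hEi
  refine ⟨hLi, hRi, ?_⟩
  rw [opM, opMM, sumInt_eq hLi, sumInt_eq hRi]
  simp only [integrandM, integrandMM]
  rw [integral_kernel hr hr1 hs hω h.sω_lt h.sω_lt' ns _ k
      (fun p => funD r (s * t) (ns + nt) y l (circleMap 0 1 p.2) p.1 *
        opM r t nt α p.1 (circleMap 0 1 p.2)), integral_congr_ae hL,
    integral_kernel hr hr1 hst hω hstω hstω' (ns + nt) _ k
      (fun q => funD r s ns y l (circleMap 0 1 q.2) q.1 * α q.1 (circleMap 0 1 q.2)),
    integral_congr_ae hR, integral_const_mul, hfub, hcdef]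
  field_simp

/-- The functions `D` with inverse parameters are inverse to each other. -/
lemma funD_inv_mul_regD {r t w z : ℂ} (hr : r ≠ 0) (hr1 : ‖r‖ < 1) (ht : t ≠ 0) (hw : w ≠ 0)
    (hz : z ≠ 0) (N n m : ℤ)
    (h1 : ‖r ^ 2‖ < ‖r * (w * z / t)‖ ∧ ‖r * (w * z / t)‖ < 1)
    (h2 : ‖r ^ 2‖ < ‖r * (w / (t * z))‖ ∧ ‖r * (w / (t * z))‖ < 1)
    (h3 : ‖r ^ 2‖ < ‖r * (z / (t * w))‖ ∧ ‖r * (z / (t * w))‖ < 1)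
    (h4 : ‖r ^ 2‖ < ‖r * (1 / (t * w * z))‖ ∧ ‖r * (1 / (t * w * z))‖ < 1)
    (hD : denomD r t⁻¹ (-N) w n z m ≠ 0) :
    funD r t⁻¹ (-N) w n z m * regD r t N w n z m = 1 := by
  have hlt : ∀ b c : ℂ, ‖r ^ 2‖ < ‖b‖ ∧ ‖b‖ < 1 → c = r ^ 2 / b → ‖c‖ < 1 := by
    rintro b _ ⟨hb, -⟩ rfl
    rwa [norm_div, div_lt_one ((norm_nonneg _).trans_lt hb)]
  have e1 : r * (w * z / t⁻¹) = r ^ 2 / (r * (1 / (t * w * z))) := by field_simp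
  have e2 : r * (w / (t⁻¹ * z)) = r ^ 2 / (r * (z / (t * w))) := by field_simp
  have e3 : r * (z / (t⁻¹ * w)) = r ^ 2 / (r * (w / (t * z))) := by field_simp
  have e4 : r * (1 / (t⁻¹ * w * z)) = r ^ 2 / (r * (w * z / t)) := by field_simp
  rw [funD_eq_regD hr hr1 (inv_ne_zero ht) hw hz (-N) n m (hlt _ _ h4 e1) (hlt _ _ h3 e2)
    (hlt _ _ h2 e3) (hlt _ _ h1 e4) hD]
  have g1 := gQuot_mul_gQuot_div hr hr1 (n - N + m) h1.1 h1.2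
  have g2 := gQuot_mul_gQuot_div hr hr1 (n - N - m) h2.1 h2.2
  have g3 := gQuot_mul_gQuot_div hr hr1 (-n - N + m) h3.1 h3.2
  have g4 := gQuot_mul_gQuot_div hr hr1 (-n - N - m) h4.1 h4.2
  rw [← e4, show -(n - N + m) = -n - -N - m by ring] at g1
  rw [← e3, show -(n - N - m) = -n - -N + m by ring] at g2
  rw [← e2, show -(-n - N + m) = n - -N - m by ring] at g3
  rw [← e1, show -(-n - N - m) = n - -N + m by ring] at g4
  have hm : (r ^ 2) ^ (-N) / (z ^ (2 * m) * w ^ (2 * n) * t⁻¹ ^ (2 * -N)) *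
      ((r ^ 2) ^ N / (z ^ (2 * m) * w ^ (2 * n) * t ^ (2 * N))) *
      ((-(r * (w * z / t)) / r) ^ (n - N + m) * (-(r * (w / (t * z))) / r) ^ (n - N - m) *
        (-(r * (z / (t * w))) / r) ^ (-n - N + m) *
        (-(r * (1 / (t * w * z))) / r) ^ (-n - N - m)) = 1 := by
    have n1 : (-1 : ℂ) ≠ 0 := by norm_num
    have c1 : -(r * (w * z / t)) / r = -1 * (w * z / t) := by field_simp
    have c2 : -(r * (w / (t * z))) / r = -1 * (w / (t * z)) := by field_simp
    have c3 : -(r * (z / (t * w))) / r = -1 * (z / (t * w)) := by field_simp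
    have c4 : -(r * (1 / (t * w * z))) / r = -1 * (1 / (t * w * z)) := by field_simp
    rw [c1, c2, c3, c4]
    simp only [pow_two, two_mul, sub_eq_add_neg, inv_zpow, zpow_add₀ ht, zpow_add₀ hw, zpow_add₀ hz, zpow_add₀ n1, mul_zpow, div_zpow, zpow_neg,
      one_zpow, mul_inv, inv_inv]
    -- All other powers cancel; what is left are signs `(-1)^i` with even multiplicity, handled
    -- through `((-1)^i)² = 1`.
    have u : ∀ i : ℤ, ((-1 : ℂ) ^ i)⁻¹ = (-1) ^ i := fun i => by
      rw [← inv_zpow]; norm_num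
    have u2 : ∀ i : ℤ, (-1 : ℂ) ^ i * (-1) ^ i = 1 := fun i => by
      rw [← mul_zpow]; norm_num
    have a1 := u2 n
    have a2 := u2 N
    have a3 := u2 m
    simp only [u]
    have h5 : r ^ N ≠ 0 := zpow_ne_zero _ hr
    have h6 : t ^ N ≠ 0 := zpow_ne_zero _ ht
    have h7 : t ^ n ≠ 0 := zpow_ne_zero _ ht
    have h8 : t ^ m ≠ 0 := zpow_ne_zero _ ht
    have h9 : w ^ N ≠ 0 := zpow_ne_zero _ hw
    have h10 : w ^ n ≠ 0 := zpow_ne_zero _ hw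
    have h11 : w ^ m ≠ 0 := zpow_ne_zero _ hw
    have h12 : z ^ N ≠ 0 := zpow_ne_zero _ hz
    have h13 : z ^ n ≠ 0 := zpow_ne_zero _ hz
    have h14 : z ^ m ≠ 0 := zpow_ne_zero _ hz
    generalize r ^ N = b1 at *
    generalize t ^ N = b2 at *
    generalize t ^ n = b3 at *
    generalize t ^ m = b4 at *
    generalize w ^ N = b5 at *
    generalize w ^ n = b6 at *
    generalize w ^ m = b7 at *
    generalize z ^ N = b8 at *
    generalize z ^ n = b9 at *
    generalize z ^ m = b10 at *
    generalize (-1 : ℂ) ^ N = ε1 at *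
    generalize (-1 : ℂ) ^ n = ε2 at *
    generalize (-1 : ℂ) ^ m = ε3 at *
    field_simp
    linear_combination (ε1 ^ 2 + 1) * ε2 ^ 4 * ε3 ^ 4 * a2 + (ε2 ^ 2 + 1) * ε3 ^ 4 * a1 +
      (ε3 ^ 2 + 1) * a3
  refine Eq.trans ?_ hm
  unfold regD
  rw [← g1, ← g2, ← g3, ← g4]
  ring

/-- Needed because a Bailey pair prescribes `β` on the unit circle only. -/
lemma opM_congr {r t : ℂ} {N : ℤ} {α β : ℤ → ℂ → ℂ} (h : ∀ m z, ‖z‖ = 1 → α m z = β m z)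
    (m : ℤ) (x : ℂ) : opM r t N α m x = opM r t N β m x := by
  unfold opM sumInt circleIntegral integrandM
  congr 1
  refine tsum_congr fun n => intervalIntegral.integral_congr fun θ _ => ?_
  simp only
  rw [h n (circleMap 0 1 θ) (by simp)]

/-- The strict inequalities already force all four parameters to be nonzero. -/
lemma starDom_of_lt {r s t y ω : ℂ} (ht : ‖t‖ < 1) (hy : ‖r * y‖ < ‖s * t‖)
    (hy' : ‖r‖ < ‖s * t * y‖) (h1 : ‖s * ω‖ < 1) (h2 : ‖s‖ < ‖ω‖) : StarDom r s t y ω := by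
  have hst0 : 0 < ‖s * t‖ := (norm_nonneg _).trans_lt hy
  have hsty0 : 0 < ‖s * t * y‖ := (norm_nonneg _).trans_lt hy'
  have hω0 : 0 < ‖ω‖ := (norm_nonneg _).trans_lt h2
  obtain ⟨hs, ht0⟩ := mul_ne_zero_iff.mp (norm_pos_iff.mp hst0)
  refine ⟨hs, ht0, right_ne_zero_of_mul (norm_pos_iff.mp hsty0), norm_pos_iff.mp hω0, ht, h1,
    ?_, ?_, ?_⟩
  · rwa [norm_div, div_lt_one hω0]
  · rwa [norm_div, div_lt_one hst0]
  · rwa [norm_div, div_lt_one hsty0]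

/-- The bounds on the arguments of the factor in front of the star-triangle relation. -/
lemma StarDom.bounds {r s t y ω : ℂ} (hr : r ≠ 0) (h : StarDom r s t y ω) :
    (‖r ^ 2‖ < ‖r * (y * ω / t)‖ ∧ ‖r * (y * ω / t)‖ < 1) ∧
    (‖r ^ 2‖ < ‖r * (y / (t * ω))‖ ∧ ‖r * (y / (t * ω))‖ < 1) ∧
    (‖r ^ 2‖ < ‖r * (ω / (t * y))‖ ∧ ‖r * (ω / (t * y))‖ < 1) ∧
    (‖r ^ 2‖ < ‖r * (1 / (t * y * ω))‖ ∧ ‖r * (1 / (t * y * ω))‖ < 1) := by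
  have hd := h.betaDom hr (x := 1) norm_one
  obtain ⟨hs, ht, hy, hω, -⟩ := h
  have e1 : starA r s t y ω 1 0 * starA r s t y ω 1 2 = r * (y * ω / t) := by
    simp [starA]; field_simp
  have e2 : starA r s t y ω 1 1 * starA r s t y ω 1 2 = r * (y / (t * ω)) := by
    simp [starA]; field_simp
  have e3 : starA r s t y ω 1 0 * starA r s t y ω 1 3 = r * (ω / (t * y)) := by
    simp [starA]; field_simp
  have e4 : starA r s t y ω 1 1 * starA r s t y ω 1 3 = r * (1 / (t * y * ω)) := by
    simp [starA]; field_simp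
  rw [← e1, ← e2, ← e3, ← e4]
  exact ⟨⟨hd.lt_norm_mul (by decide), hd.norm_mul_lt_one _ _⟩,
    ⟨hd.lt_norm_mul (by decide), hd.norm_mul_lt_one _ _⟩,
    ⟨hd.lt_norm_mul (by decide), hd.norm_mul_lt_one _ _⟩,
    ⟨hd.lt_norm_mul (by decide), hd.norm_mul_lt_one _ _⟩⟩

end QBailey

theorem mainTheorem1
    (r : ℂ) (hr : r ≠ 0) (hr1 : ‖r‖ < 1)
    (s t y : ℂ) (ns nt l : ℤ)
    (ht : ‖t‖ < 1) (hy : ‖r * y‖ < ‖s * t‖) (hy' : ‖r‖ < ‖s * t * y‖) :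
    -- the star-triangle relation
    (∀ α : ℤ → ℂ → ℂ,
      (∀ (m : ℤ) (z : ℂ), ‖z‖ = 1 → QBailey.AbsConv r (QBailey.integrandM r t nt α m z)) →
      ∀ (k : ℤ) (ω : ℂ), ‖s * ω‖ < 1 → ‖s‖ < ‖ω‖ →
        QBailey.AbsConv r (QBailey.integrandM r s ns
          (fun m z => QBailey.funD r (s * t) (ns + nt) y l z m * QBailey.opM r t nt α m z) k ω) ∧
        QBailey.AbsConv r (QBailey.integrandMM r s t ns nt
          (fun j x => QBailey.funD r s ns y l x j * α j x) k ω) ∧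
        (QBailey.denomD r t nt y l ω k ≠ 0 →
          QBailey.opM r s ns
            (fun m z => QBailey.funD r (s * t) (ns + nt) y l z m * QBailey.opM r t nt α m z) k ω =
          QBailey.funD r t nt y l ω k *
            QBailey.opMM r s t ns nt (fun j x => QBailey.funD r s ns y l x j * α j x) k ω)) ∧
    -- the Bailey lemma
    (∀ α β : ℤ → ℂ → ℂ,
      QBailey.IsBaileyPair r t nt {p | ‖p.2‖ = 1} α β →
      QBailey.IsBaileyPair₂ r s t ns nt
        {p | ‖s * p.2‖ < 1 ∧ ‖s‖ < ‖p.2‖ ∧ QBailey.denomD r t⁻¹ (-nt) y l p.2 p.1 ≠ 0}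
        (QBailey.newα r s y ns l α) (QBailey.newβ r s t y ns nt l β)) := by
  constructor
  · intro α hα k ω h1 h2
    have h := QBailey.starDom_of_lt ht hy hy' h1 h2
    obtain ⟨hL, hR, he⟩ := QBailey.star_triangle hr hr1 h ns nt l k hα
    obtain ⟨b1, b2, b3, b4⟩ := h.bounds hr
    refine ⟨hL, hR, fun hD => ?_⟩
    rw [he, QBailey.funD_eq_regD hr hr1 h.t_ne h.y_ne h.ω_ne nt l k b1.2 b2.2 b3.2 b4.2 hD]
  · rintro α β hαβ ⟨k, ω⟩ ⟨h1, h2, hD⟩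
    have h := QBailey.starDom_of_lt ht hy hy' h1 h2
    obtain ⟨hL, hR, he⟩ := QBailey.star_triangle hr hr1 h ns nt l k
      fun m z hz => (hαβ (m, z) hz).1
    obtain ⟨b1, b2, b3, b4⟩ := h.bounds hr
    refine ⟨hR, ?_⟩
    have hβ : QBailey.opM r s ns (QBailey.midβ r s t y ns nt l β) k ω = QBailey.opM r s ns
        (fun m z => QBailey.funD r (s * t) (ns + nt) y l z m * QBailey.opM r t nt α m z) k ω :=
      QBailey.opM_congr (fun m z hz => by rw [QBailey.midβ, (hαβ (m, z) hz).2]) k ω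
    change QBailey.funD r t⁻¹ (-nt) y l ω k *
      QBailey.opM r s ns (QBailey.midβ r s t y ns nt l β) k ω = _
    rw [hβ, he, ← mul_assoc,
      QBailey.funD_inv_mul_regD hr hr1 h.t_ne h.y_ne h.ω_ne nt l k b1 b2 b3 b4 hD, one_mul]
    rfl
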